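/- **Setting.** Let $d,e$ be natural numbers, $0<\gamma\le 1$ and $N=\lfloor 1/\gamma\rfloor$. *Hopf algebra.* Let $\mathcal H=\bigoplus_{n=0}^N\mathcal H_n$ be an $N$-truncated connected graded commutative Hopf algebra over $\mathbb R$: the $\mathcal H_n$ are finite-dimensional, $\mathcal H_0=\mathbb R\mathbf 1\neq 0$, the product is graded, associative, commutative with unit $\mathbf 1$, the coproduct $\Delta$ is graded, coassociative with graded counit $\epsilon$, $\epsilon(\mathbf 1)=1$, and $\Delta(xy)-\Delta(x)\Delta(y)\in\bigoplus_{p+q\ge N+1}\mathcal H_p\otimes\mathcal H_q$ for all $x,y\in\mathcal H$. Let $\|\cdot\|$ be a norm on $\mathcal H$ that no finite sum of the projections onto the $\mathcal H_n$ increases; write $\|\cdot\|_{\mathcal H^*}$ for the dual norm and $f\star g=(f\otimes g)\circ\Delta$ for $f,g\in\mathcal H^*$. Let $L_1,\dots,L_d:\mathcal H\to\mathcal H$ be linear maps of degree one with $\Delta L_i(x)=(\mathrm{Id}\otimes L_i)\Delta(x)+L_i(x)\otimes\mathbf 1$ for every homogeneous $x$ of degree $<N$, and such that $L_1(\mathbf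 1),\dots,L_d(\mathbf 1)$ is a basis of $\mathcal H_1$. *Control and rough path.* Let $T>0$ and let $\omega:\{0\le s\le t\le T\}\to[0,\infty)$ be a control ($\omega(t,t)=0$, and $\omega(s,u)+\omega(u,t)\le\omega(s,t)$ for $s\le u\le t$) that is right-continuous: $\omega(s,t_+)=\omega(s,t)$ for $0\le s\le t<T$. Let $\mathbf X=(\mathbf X_{st})_{0\le s\le t\le T}$ be an $N$-truncated rough path $\gamma$-adapted to $\omega$ above a path $X:[0,T]\to\mathcal H_1^*$. That is, each $\mathbf X_{st}\in\mathcal H^*$ satisfies $\mathbf X_{st}(\mathbf 1)=1$ and $\mathbf X_{st}(xy)=\mathbf X_{st}(x)\mathbf X_{st}(y)$ for homogeneous $x,y$ with $|x|+|y|\le N$; $\mathbf X_{st}|_{\mathcal H_1}=X_t-X_s$; $\mathbf X_{st}=\mathbf X_{su}\star\mathbf X_{ut}$ for $s\le u\le t$; and, for some constant $C$, $|\mathbf X_{st}(x)|\le C\|x\|\,\omega(s,t)^{|x|\gamma}$ for all homogeneous $x$ and all $s\le t$ (with $0^0=1$). *Controlled rough paths.* For $0<T'\le T$ let $\mathcal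 V_{\mathbf X}^{[0,T']}$ be the set of maps $\mathbf Z:[0,T']\to\mathcal H^e$ for which there is a constant $C$ such that $\big\|\langle h,\mathbf Z_t\rangle-\langle\mathbf X_{st}\star h,\mathbf Z_s\rangle\big\|_{\mathbb R^e}\le C\,\|h\|_{\mathcal H^*}\,\omega(s,t)^{(N-j)\gamma}$ for all $0\le s\le t\le T'$, all $0\le j\le N$ and all $h\in\mathcal H^*$ homogeneous of degree $j$. *Images by maps.* For $\varphi:\mathbb R^e\to\mathbb R^e$ of class $C^N$ and $\mathbf z\in\mathcal H^e$, with $z=\epsilon(\mathbf z)\in\mathbb R^e$, let $\varphi(\mathbf z)\in\mathcal H^e$ be the element with $\epsilon(\varphi(\mathbf z))=\varphi(z)$ and $$\langle h,\varphi(\mathbf z)\rangle=\sum_{n=1}^N\frac{D^n\varphi(z)}{n!}\big\langle\Delta_\star^{\mathrm{red}(n-1)}(h),\mathbf z^{\otimes n}\big\rangle\qquad\text{for all } h\in\mathcal H^*\text{ with } h(\mathbf 1)=0,$$ where $\Delta_\star$ is the transpose of the product of $\mathcal H$, $\Delta_\star^{\mathrm{red}}(h)=\Delta_\star(h)-\epsilon\otimes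 h-h\otimes\epsilon$, and $\Delta_\star^{\mathrm{red}(n-1)}$ is its $(n-1)$-fold iterate. Put $\varphi(\mathbf Z)_t=\varphi(\mathbf Z_t)$. *Lifted integral.* For a path $\mathbf Y$ in $\mathcal H^e$ put $$\int_0^t\mathbf Y_r\,dX^i_r:=L_i(\mathbf Y_t)+\Big(\lim_P\sum_{[u,v]\in P}\langle\mathbf X_{uv},L_i(\mathbf Y_u)\rangle\Big)\mathbf 1,$$ the limit being taken over the partitions $P$ of $[0,t]$ ordered by refinement. **Theorem 6.1 (Local existence and uniqueness).** In this setting let $\varphi_1,\dots,\varphi_d:\mathbb R^e\to\mathbb R^e$ be of class $C^{N+1}$ (for example smooth), and let $y\in\mathbb R^e$. There is $T_0\in(0,T]$ such that for every $T'\in(0,T_0]$ there is exactly one $\mathbf Z\in\mathcal V_{\mathbf X}^{[0,T']}$ such that for all $t\in[0,T']$ the limits defining the integrals below exist and $$\mathbf Z_t=y\,\mathbf 1+\sum_{i=1}^d\int_0^t\varphi_i(\mathbf Z)_r\,dX^i_r .$$ -/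

import Mathlib

open scoped TensorProduct

noncomputable section

namespace HopfRough

section Algebra

variable {H : Type*} [CommRing H] [Algebra ℝ H] [Coalgebra ℝ H]

/-- The subspace `H_p ⊗ H_q` of `H ⊗ H`. -/
def tensorDeg (𝒜 : ℕ → Submodule ℝ H) (p q : ℕ) : Submodule ℝ (H ⊗[ℝ] H) :=
  Submodule.map₂ (TensorProduct.mk ℝ H H) (𝒜 p) (𝒜 q)

/-- `N`-truncated connected graded commutative Hopf algebras. The associative commutative unital
product, its compatibility with the grading, and the coassociative counital coproduct are supplied
by the Mathlib classes; the product of `H ⊗ H` is `(a ⊗ b) (c ⊗ d) = ac ⊗ bd`, so that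
`Δ x * Δ y` is `(μ ⊗ μ) τ₂₃ (Δ ⊗ Δ) (x ⊗ y)`. -/
structure IsTruncatedHopfAlgebra (𝒜 : ℕ → Submodule ℝ H) [GradedAlgebra 𝒜] (N : ℕ) : Prop where
  finite : ∀ n, FiniteDimensional ℝ (𝒜 n)
  truncated : ∀ n, N < n → 𝒜 n = ⊥
  connected : 𝒜 0 = Submodule.span ℝ {(1 : H)}
  one_ne_zero : (1 : H) ≠ 0
  comul_graded : ∀ n, ∀ x ∈ 𝒜 n,
    Coalgebra.comul (R := ℝ) x ∈ ⨆ (p : ℕ) (q : ℕ) (_ : p + q = n), tensorDeg 𝒜 p q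
  counit_one : Coalgebra.counit (R := ℝ) (1 : H) = 1
  counit_graded : ∀ n, 0 < n → ∀ x ∈ 𝒜 n, Coalgebra.counit (R := ℝ) x = 0
  compat : ∀ x y : H,
    Coalgebra.comul (R := ℝ) (x * y) - Coalgebra.comul (R := ℝ) x * Coalgebra.comul (R := ℝ) y ∈
      ⨆ (p : ℕ) (q : ℕ) (_ : N + 1 ≤ p + q), tensorDeg 𝒜 p q

/-- The operators `L_i`: homogeneous of degree one, satisfying the cocycle identity, and such that
the `L_i 1` form a basis of `H_1`. As degrees greater than `N` are cut off, the cocycle identity,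
whose terms have degree `|x| + 1`, makes sense for `|x| < N`. -/
structure IsCocycleFamily (𝒜 : ℕ → Submodule ℝ H) (N : ℕ) {d : ℕ} (L : Fin d → H →ₗ[ℝ] H) :
    Prop where
  degree_one : ∀ i n, ∀ x ∈ 𝒜 n, L i x ∈ 𝒜 (n + 1)
  cocycle : ∀ i n, n < N → ∀ x ∈ 𝒜 n,
    Coalgebra.comul (R := ℝ) (L i x) =
      TensorProduct.map LinearMap.id (L i) (Coalgebra.comul (R := ℝ) x) + L i x ⊗ₜ[ℝ] (1 : H)
  linearIndependent : LinearIndependent ℝ fun i => L i 1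
  span_eq : Submodule.span ℝ (Set.range fun i => L i 1) = 𝒜 1

/-- A graded norm on `H`: a norm for which every finite sum of the projections onto homogeneous
components is a weak contraction. -/
structure IsGradedNorm (𝒜 : ℕ → Submodule ℝ H) [GradedAlgebra 𝒜] (ν : Seminorm ℝ H) : Prop where
  definite : ∀ x, ν x = 0 → x = 0
  graded : ∀ (S : Finset ℕ) (x : H), ν (∑ j ∈ S, (DirectSum.decompose 𝒜 x j : H)) ≤ ν x

/-- The operator norm on the dual of `H`. -/
def dualNorm (ν : Seminorm ℝ H) (h : Module.Dual ℝ H) : ℝ :=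
  sSup {r : ℝ | ∃ x : H, ν x ≤ 1 ∧ r = |h x|}

/-- The linear form `h` is homogeneous of degree `j`. -/
def IsHomogeneousForm (𝒜 : ℕ → Submodule ℝ H) (j : ℕ) (h : Module.Dual ℝ H) : Prop :=
  ∀ k, k ≠ j → ∀ x ∈ 𝒜 k, h x = 0

/-- The convolution product `f ⋆ g = (f ⊗ g) ∘ Δ` of linear forms. -/
def conv (f g : Module.Dual ℝ H) : Module.Dual ℝ H :=
  LinearMap.mul' ℝ ℝ ∘ₗ TensorProduct.map f g ∘ₗ Coalgebra.comul

/-- Truncated characters. -/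
structure IsTruncatedCharacter (𝒜 : ℕ → Submodule ℝ H) (N : ℕ) (f : Module.Dual ℝ H) : Prop where
  map_one : f 1 = 1
  map_mul : ∀ p q, p + q ≤ N → ∀ x ∈ 𝒜 p, ∀ y ∈ 𝒜 q, f (x * y) = f x * f y

end Algebra

/-- Controls on `[0, T]`; only the values `ω s t` with `0 ≤ s ≤ t ≤ T` matter. -/
structure IsControl (T : ℝ) (ω : ℝ → ℝ → ℝ) : Prop where
  nonneg : ∀ s t, 0 ≤ s → s ≤ t → t ≤ T → 0 ≤ ω s t
  diag : ∀ t, 0 ≤ t → t ≤ T → ω t t = 0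
  superadditive : ∀ s u t, 0 ≤ s → s ≤ u → u ≤ t → t ≤ T → ω s u + ω u t ≤ ω s t

/-- Right-continuity `ω (s, t₊) = ω (s, t)` for `0 ≤ s ≤ t ≤ T`. -/
def IsRightContinuous (T : ℝ) (ω : ℝ → ℝ → ℝ) : Prop :=
  ∀ s t, 0 ≤ s → s ≤ t → t ≤ T → ContinuousWithinAt (ω s) (Set.Icc t T) t

section RoughPaths

variable {H : Type*} [CommRing H] [Algebra ℝ H] [Coalgebra ℝ H]

/-- `𝒳` is an `N`-truncated rough path on `[0, T]`, `γ`-adapted to the control `ω`, above the path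
`X` with values in the dual of `H_1`. (That `X` is itself `γ`-adapted to `ω` is the case `n = 1` of
the bound.) -/
structure IsRoughPath (𝒜 : ℕ → Submodule ℝ H) (N : ℕ) (ν : Seminorm ℝ H) (γ T : ℝ)
    (ω : ℝ → ℝ → ℝ) (X : ℝ → Module.Dual ℝ (𝒜 1)) (𝒳 : ℝ → ℝ → Module.Dual ℝ H) : Prop where
  character : ∀ s t, 0 ≤ s → s ≤ t → t ≤ T → IsTruncatedCharacter 𝒜 N (𝒳 s t)
  above : ∀ s t, 0 ≤ s → s ≤ t → t ≤ T → ∀ x : 𝒜 1, 𝒳 s t (x : H) = X t x - X s x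
  chen : ∀ s u t, 0 ≤ s → s ≤ u → u ≤ t → t ≤ T → 𝒳 s t = conv (𝒳 s u) (𝒳 u t)
  bound : ∃ C : ℝ, ∀ s t, 0 ≤ s → s ≤ t → t ≤ T → ∀ n, ∀ x ∈ 𝒜 n,
    |𝒳 s t x| ≤ C * ν x * ω s t ^ ((n : ℝ) * γ)

/-- The pairing `⟨h, z⟩ ∈ ℝᵉ` of a linear form `h` with `z ∈ Hᵉ`. -/
def pair {e : ℕ} (h : Module.Dual ℝ H) (z : Fin e → H) : Fin e → ℝ := fun b => h (z b)

/-- `⟨h, R(Z)_{st}⟩ = ⟨h, Z_t⟩ - ⟨𝒳_{st} ⋆ h, Z_s⟩`. -/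
def remainder {e : ℕ} (𝒳 : ℝ → ℝ → Module.Dual ℝ H) (Z : ℝ → Fin e → H) (h : Module.Dual ℝ H)
    (s t : ℝ) : Fin e → ℝ :=
  pair h (Z t) - pair (conv (𝒳 s t) h) (Z s)

/-- `Z` (restricted to `[0, T]`) is a controlled rough path driven by `𝒳`, i.e. an element of the
space of controlled rough paths on `[0, T]`. All norms on `ℝᵉ` being equivalent, the choice of the
norm there is immaterial. -/
def IsControlled (𝒜 : ℕ → Submodule ℝ H) (N : ℕ) (ν : Seminorm ℝ H) (γ T : ℝ) (ω : ℝ → ℝ → ℝ)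
    (𝒳 : ℝ → ℝ → Module.Dual ℝ H) {e : ℕ} (Z : ℝ → Fin e → H) : Prop :=
  ∃ C : ℝ, ∀ s t, 0 ≤ s → s ≤ t → t ≤ T → ∀ j, j ≤ N → ∀ h : Module.Dual ℝ H,
    IsHomogeneousForm 𝒜 j h →
      ‖remainder 𝒳 Z h s t‖ ≤ C * dualNorm ν h * ω s t ^ (((N : ℝ) - (j : ℝ)) * γ)

/-- The transpose of the reduced coproduct
`Δ_⋆^red h = Δ_⋆ h - 1^⋆ ⊗ h - h ⊗ 1^⋆` of the dual, where `Δ_⋆` is the transpose of the product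
of `H` and `1^⋆` is the counit of `H`: it is determined by `h (redMul x y) = ⟨Δ_⋆^red h, x ⊗ y⟩`. -/
def redMul (x y : H) : H :=
  x * y - Coalgebra.counit (R := ℝ) x • y - Coalgebra.counit (R := ℝ) y • x

/-- The transpose of the iterated reduced coproducts: for `n ≥ 1`,
`h (redProd [x₁, …, xₙ]) = ⟨Δ_⋆^red(n-1) h, x₁ ⊗ ⋯ ⊗ xₙ⟩`. The empty list is never used. -/
def redProd : List H → H
  | [] => 1
  | x :: l => l.foldl redMul x

/-- The projection of `H` onto `Ker ε` along the unit. -/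
def kerProj (x : H) : H := x - Coalgebra.counit (R := ℝ) x • (1 : H)

/-- The image `φ(z) ∈ Hᵉ` of `z ∈ Hᵉ` by a map `φ : ℝᵉ → ℝᵉ`. With `z₀ = ⟨1^⋆, z⟩ ∈ ℝᵉ` it is
given by `⟨1^⋆, φ(z)⟩ = φ(z₀)` and, for every linear form `h` with `h 1 = 0`, by
`⟨h, φ(z)⟩ = ∑_{n=1}^{N} (1/n!) D^n φ(z₀) ⟨Δ_⋆^red(n-1) h, z^{⊗ n}⟩`; here `D^n φ(z₀)` is expanded
in the canonical basis of `ℝᵉ`, and `h (kerProj x) = h x` as soon as `h 1 = 0`. -/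
def image (N : ℕ) {e : ℕ} (φ : (Fin e → ℝ) → (Fin e → ℝ)) (z : Fin e → H) : Fin e → H :=
  fun b => φ (pair Coalgebra.counit z) b • (1 : H) +
    ∑ n ∈ Finset.Icc 1 N, (1 / (n.factorial : ℝ)) • ∑ a : Fin n → Fin e,
      iteratedFDeriv ℝ n φ (pair Coalgebra.counit z) (fun k => Pi.single (a k) 1) b •
        kerProj (redProd (List.ofFn fun k => z (a k)))

end RoughPaths

/-- `P` is (the set of division points of) a partition of `[s, t]`. -/
def IsPartition (s t : ℝ) (P : Finset ℝ) : Prop :=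
  s ∈ P ∧ t ∈ P ∧ ∀ u ∈ P, s ≤ u ∧ u ≤ t

/-- The Riemann sum `∑ Ξ u v` over the pairs `(u, v)` of consecutive points of `P`. -/
def riemannSum {V : Type*} [AddCommGroup V] (Ξ : ℝ → ℝ → V) (P : Finset ℝ) : V :=
  (List.zipWith Ξ (P.sort (· ≤ ·)) (P.sort (· ≤ ·)).tail).sum

/-- `K` is the limit, in the sense of refinement of partitions, of the Riemann sums of `Ξ` over the
partitions of `[s, t]`. -/
def IsRRSLimit {V : Type*} [NormedAddCommGroup V] (Ξ : ℝ → ℝ → V) (s t : ℝ) (K : V) : Prop :=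
  ∀ ε > 0, ∃ P₀, IsPartition s t P₀ ∧
    ∀ P, IsPartition s t P → P₀ ⊆ P → ‖riemannSum Ξ P - K‖ < ε

section Equation

variable {H : Type*} [CommRing H] [Algebra ℝ H] [Coalgebra ℝ H]

/-- `I` is the lifted rough integral of `Y` on `[0, T]` against the component of the driving path
attached to the operator `ℓ`: `I_t = ℓ(Y_t) + (∫₀ᵗ Y_r dX_r) 1`, where the scalar rough integral is
the limit of the Riemann sums of `Ξ_{uv} = ⟨𝒳_{uv}, ℓ(Y_u)⟩`, which is required to exist. -/
def IsLiftedIntegral (𝒳 : ℝ → ℝ → Module.Dual ℝ H) (ℓ : H →ₗ[ℝ] H) (T : ℝ) {e : ℕ}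
    (Y I : ℝ → Fin e → H) : Prop :=
  ∃ J : ℝ → Fin e → ℝ, ∀ t, 0 ≤ t → t ≤ T →
    IsRRSLimit (fun u v => pair (𝒳 u v) (fun b => ℓ (Y u b))) 0 t (J t) ∧
      I t = fun b => ℓ (Y t b) + J t b • (1 : H)

/-- `Z` satisfies `Z_t = y 1 + ∑_i ∫₀ᵗ φ_i(Z)_r dX^i_r` for all `t ∈ [0, T]`. -/
def SolvesLiftedIVP (N : ℕ) (𝒳 : ℝ → ℝ → Module.Dual ℝ H) {d : ℕ} (L : Fin d → H →ₗ[ℝ] H) (T : ℝ)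
    {e : ℕ} (φ : Fin d → (Fin e → ℝ) → (Fin e → ℝ)) (y : Fin e → ℝ) (Z : ℝ → Fin e → H) : Prop :=
  ∃ I : Fin d → ℝ → Fin e → H,
    (∀ i, IsLiftedIntegral 𝒳 (L i) T (fun t => image N (φ i) (Z t)) (I i)) ∧
      ∀ t, 0 ≤ t → t ≤ T → Z t = (fun b => y b • (1 : H)) + ∑ i, I i t

end Equation

end HopfRough

end

/-!
The equation is a fixed point problem for controlled paths, split into an algebraic part, which is
solved at each time separately, and an analytic part, which is solved by contraction.

All estimates are made in the coordinates of a homogeneous basis of `H`. Write `Γ_{st}` for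
`translate (𝒳 s t)`, the transpose of `h ↦ 𝒳_{st} ⋆ h`, so that the remainder of a path `Z` is
`Z_t - Γ_{st} Z_s` (`pathRem`), and write `r = ω(s, t) ^ γ`. A path is controlled if the coordinate
of degree `j` of its remainder is of order `r ^ (N - j)`.

*Images and integrals.* The image `φ(z)` is the Taylor polynomial of `φ` at `ε(z)`, evaluated at
`z - ε(z) 1` (`image_eq_aeval`). As `Γ_{st}` is multiplicative up to terms coming from degrees
greater than `N`, and as changing the base point of a Taylor polynomial of a `C^{N+1}` function
costs a remainder of the right order, images of controlled paths are controlled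
(`Ctrl.image`). The cocycle identity for `L_i` turns this into a defect of order `r ^ (N + 1 - j)`
(`Ctrl.cocycle`), and by Chen's relation the germs `⟨𝒳_{uv}, L_i φ_i(Z)_u⟩` of the rough integrals
are almost additive with error `ω(s, u) ^ ((N + 1) γ - 1) ω(s, t)`. Since `(N + 1) γ > 1`, they have
limits along refinements (`exists_isRRSLimit`); the control need not be continuous from the left, so
partition points have to be placed just before and at its jumps. All of this is done for pairs of
paths, with Lipschitz dependence on the pair; the bookkeeping is that of `Ord`, uniform orders of
magnitude of a function together with the difference of its two values.

*Gain.* The remainder of the lifted integral is of order `r ^ (N + 1 - j)`, one power better than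
needed. On an interval `[a, b]` with `ω(a, b)` small, the solution map is therefore a contraction
for the remainders among the paths with a given value at `a` (`IsRoughSystem.exists_contraction`).

*Initial value and jumps.* At a fixed time, `Z_t` is a fixed point of `z ↦ v 1 + ∑ L_i φ_i(z)`,
where `v` is the value of the underlying path. The `L_i` raise degrees, so this fixed point exists
and is unique (`exists_eq_liftMap`, `eq_of_eq_liftMap`). Existence follows by Picard iteration
among the paths starting from the lift of `y` (`IsRoughSystem.exists_solution`). For uniqueness among all
controlled paths, two solutions that agree on `[0, t)` have the same integrals up to `t`, hence
agree at `t`, even if `ω` jumps there; and they agree beyond `t` by contraction, since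
`ω(t, t') → 0` as `t' ↓ t` by right-continuity (`IsRoughSystem.solution_unique`).
-/

set_option linter.unusedSectionVars false

noncomputable section

namespace HopfRough

/-! ### Riemann sums over finite partitions -/

theorem zipWith_tail_sum_append {V : Type*} [AddCommGroup V] (Ξ : ℝ → ℝ → V) (u : ℝ)
    (l₂ : List ℝ) : ∀ l₁ : List ℝ,
    (List.zipWith Ξ (l₁ ++ u :: l₂) (l₁ ++ u :: l₂).tail).sum =
      (List.zipWith Ξ (l₁ ++ [u]) (l₁ ++ [u]).tail).sum + (List.zipWith Ξ (u :: l₂) l₂).sum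
  | [] => by simp
  | [a] => by simp
  | a :: b :: l => by
      have h := zipWith_tail_sum_append Ξ u l₂ (b :: l)
      simp only [List.cons_append, List.tail_cons, List.zipWith_cons_cons, List.sum_cons] at h ⊢
      rw [h, add_assoc]

theorem sort_filter_le {P : Finset ℝ} {u : ℝ} (hu : u ∈ P) :
    (P.filter (· ≤ u)).sort (· ≤ ·) = (P.filter (· < u)).sort (· ≤ ·) ++ [u] := by
  have hnd : ((P.filter (· < u)).sort (· ≤ ·) ++ [u]).Nodup := by
    rw [List.nodup_append]
    simp +contextual [Finset.sort_nodup, ne_of_lt]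
  have hs : ((P.filter (· < u)).sort (· ≤ ·) ++ [u]).Pairwise (· ≤ ·) := by
    rw [List.pairwise_append]
    simp +contextual [Finset.pairwise_sort, le_of_lt]
  rw [← (List.toFinset_sort (· ≤ ·) hnd).2 hs]
  congr 1
  ext x
  simp only [Finset.mem_filter, List.toFinset_append, Finset.sort_toFinset, Finset.mem_union,
    List.mem_toFinset, List.mem_singleton]
  constructor
  · rintro ⟨h1, h2⟩
    rcases h2.lt_or_eq with h | h
    · exact Or.inl ⟨h1, h⟩
    · exact Or.inr h
  · rintro (⟨h1, h2⟩ | rfl)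
    · exact ⟨h1, h2.le⟩
    · exact ⟨hu, le_rfl⟩

theorem sort_filter_ge {P : Finset ℝ} {u : ℝ} (hu : u ∈ P) :
    (P.filter (u ≤ ·)).sort (· ≤ ·) = u :: (P.filter (u < ·)).sort (· ≤ ·) := by
  rw [← Finset.sort_insert]
  · congr 1
    ext x
    simp only [Finset.mem_filter, Finset.mem_insert]
    constructor
    · rintro ⟨h1, h2⟩
      rcases h2.lt_or_eq with h | h
      · exact Or.inr ⟨h1, h⟩
      · exact Or.inl h.symm
    · rintro (rfl | ⟨h1, h2⟩)
      · exact ⟨hu, le_rfl⟩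
      · exact ⟨h1, h2.le⟩
  · intro b hb
    exact (Finset.mem_filter.1 hb).2.le
  · simp

theorem sort_eq_append {P : Finset ℝ} {u : ℝ} (hu : u ∈ P) :
    P.sort (· ≤ ·) =
      (P.filter (· < u)).sort (· ≤ ·) ++ u :: (P.filter (u < ·)).sort (· ≤ ·) := by
  have hnd : ((P.filter (· < u)).sort (· ≤ ·) ++
      u :: (P.filter (u < ·)).sort (· ≤ ·)).Nodup := by
    rw [List.nodup_append]
    refine ⟨Finset.sort_nodup _ _, ?_, ?_⟩
    · simp [Finset.sort_nodup]
    · intro a ha b hb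
      have ha' : a < u := by simpa using (Finset.mem_filter.1 ((Finset.mem_sort _).1 ha)).2
      rcases List.mem_cons.1 hb with rfl | hb
      · exact ha'.ne
      · exact (ha'.trans (Finset.mem_filter.1 ((Finset.mem_sort _).1 hb)).2).ne
  have hs : ((P.filter (· < u)).sort (· ≤ ·) ++
      u :: (P.filter (u < ·)).sort (· ≤ ·)).Pairwise (· ≤ ·) := by
    rw [List.pairwise_append]
    refine ⟨Finset.pairwise_sort _ _, ?_, ?_⟩
    · rw [List.pairwise_cons]
      refine ⟨fun b hb => ?_, Finset.pairwise_sort _ _⟩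
      exact (Finset.mem_filter.1 ((Finset.mem_sort _).1 hb)).2.le
    · intro a ha b hb
      have ha' : a < u := by simpa using (Finset.mem_filter.1 ((Finset.mem_sort _).1 ha)).2
      rcases List.mem_cons.1 hb with rfl | hb
      · exact ha'.le
      · exact (ha'.trans (Finset.mem_filter.1 ((Finset.mem_sort _).1 hb)).2).le
  rw [← (List.toFinset_sort (· ≤ ·) hnd).2 hs]
  congr 1
  ext x
  simp only [List.toFinset_append, List.toFinset_cons, Finset.sort_toFinset, Finset.mem_union,
    Finset.mem_insert, Finset.mem_filter]
  constructor
  · intro h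
    rcases lt_trichotomy x u with h' | h' | h'
    · exact Or.inl ⟨h, h'⟩
    · exact Or.inr (Or.inl h')
    · exact Or.inr (Or.inr ⟨h, h'⟩)
  · rintro (h | rfl | h)
    · exact h.1
    · exact hu
    · exact h.1

theorem riemannSum_split {V : Type*} [AddCommGroup V] (Ξ : ℝ → ℝ → V) {P : Finset ℝ} {u : ℝ}
    (hu : u ∈ P) :
    riemannSum Ξ P = riemannSum Ξ (P.filter (· ≤ u)) + riemannSum Ξ (P.filter (u ≤ ·)) := by
  unfold riemannSum
  rw [sort_filter_le hu, sort_filter_ge hu, sort_eq_append hu, zipWith_tail_sum_append]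
  rfl

theorem riemannSum_singleton {V : Type*} [AddCommGroup V] (Ξ : ℝ → ℝ → V) (s : ℝ) :
    riemannSum Ξ {s} = 0 := by
  simp [riemannSum]

theorem riemannSum_pair {V : Type*} [AddCommGroup V] (Ξ : ℝ → ℝ → V) {s t : ℝ} (h : s < t) :
    riemannSum Ξ {s, t} = Ξ s t := by
  have : ({s, t} : Finset ℝ).sort (· ≤ ·) = [s, t] := by
    rw [Finset.sort_insert _ (by simpa using h.le) (by simpa using h.ne), Finset.sort_singleton]
  simp [riemannSum, this]

theorem zipWith_tail_sum_congr {V : Type*} [AddCommGroup V] (Ξ Ξ' : ℝ → ℝ → V) :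
    ∀ l : List ℝ, l.Pairwise (· < ·) → (∀ u ∈ l, ∀ v ∈ l, u < v → Ξ u v = Ξ' u v) →
      (List.zipWith Ξ l l.tail).sum = (List.zipWith Ξ' l l.tail).sum
  | [], _, _ => by simp
  | [a], _, _ => by simp
  | a :: b :: l, hl, h => by
      have ih := zipWith_tail_sum_congr Ξ Ξ' (b :: l) (List.pairwise_cons.1 hl).2
        (fun u hu v hv => h u (List.mem_cons_of_mem _ hu) v (List.mem_cons_of_mem _ hv))
      simp only [List.tail_cons, List.zipWith_cons_cons, List.sum_cons] at ih ⊢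
      rw [ih, h a (by simp) b (by simp) ((List.pairwise_cons.1 hl).1 b (by simp))]

theorem riemannSum_congr {V : Type*} [AddCommGroup V] {Ξ Ξ' : ℝ → ℝ → V} {P : Finset ℝ}
    (h : ∀ u ∈ P, ∀ v ∈ P, u < v → Ξ u v = Ξ' u v) : riemannSum Ξ P = riemannSum Ξ' P :=
  zipWith_tail_sum_congr Ξ Ξ' _ (Finset.sortedLT_sort P).pairwise
    fun u hu v hv => h u ((Finset.mem_sort _).1 hu) v ((Finset.mem_sort _).1 hv)

theorem zipWith_tail_sum_sub {V : Type*} [AddCommGroup V] (Ξ Ξ' : ℝ → ℝ → V) :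
    ∀ l : List ℝ, (List.zipWith (fun u v => Ξ u v - Ξ' u v) l l.tail).sum =
      (List.zipWith Ξ l l.tail).sum - (List.zipWith Ξ' l l.tail).sum
  | [] => by simp
  | [a] => by simp
  | a :: b :: l => by
      have ih := zipWith_tail_sum_sub Ξ Ξ' (b :: l)
      simp only [List.tail_cons, List.zipWith_cons_cons, List.sum_cons] at ih ⊢
      rw [ih]
      abel

theorem riemannSum_sub {V : Type*} [AddCommGroup V] (Ξ Ξ' : ℝ → ℝ → V) (P : Finset ℝ) :
    riemannSum (fun u v => Ξ u v - Ξ' u v) P = riemannSum Ξ P - riemannSum Ξ' P :=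
  zipWith_tail_sum_sub Ξ Ξ' _

theorem IsPartition.filter_le {s t u : ℝ} {P : Finset ℝ} (h : IsPartition s t P) (hu : u ∈ P) :
    IsPartition s u (P.filter (· ≤ u)) :=
  ⟨by simpa [h.1] using (h.2.2 u hu).1, by simpa using hu,
    fun v hv => ⟨(h.2.2 v (Finset.mem_filter.1 hv).1).1, (Finset.mem_filter.1 hv).2⟩⟩

theorem IsPartition.filter_ge {s t u : ℝ} {P : Finset ℝ} (h : IsPartition s t P) (hu : u ∈ P) :
    IsPartition u t (P.filter (u ≤ ·)) :=
  ⟨by simpa using hu, by simpa [h.2.1] using (h.2.2 u hu).2,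
    fun v hv => ⟨(Finset.mem_filter.1 hv).2, (h.2.2 v (Finset.mem_filter.1 hv).1).2⟩⟩

theorem IsPartition.eq_singleton {s : ℝ} {P : Finset ℝ} (h : IsPartition s s P) : P = {s} := by
  ext x
  rw [Finset.mem_singleton]
  refine ⟨fun hx => le_antisymm (h.2.2 x hx).2 (h.2.2 x hx).1, ?_⟩
  rintro rfl
  exact h.1

theorem isPartition_pair {s t : ℝ} (h : s ≤ t) : IsPartition s t {s, t} :=
  ⟨by simp, by simp, fun u hu => by
    rcases Finset.mem_insert.1 hu with rfl | hu
    · exact ⟨le_rfl, h⟩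
    · rw [Finset.mem_singleton.1 hu]; exact ⟨h, le_rfl⟩⟩

theorem IsPartition.union {s t : ℝ} {P Q : Finset ℝ} (hP : IsPartition s t P)
    (hQ : IsPartition s t Q) : IsPartition s t (P ∪ Q) :=
  ⟨Finset.mem_union_left _ hP.1, Finset.mem_union_left _ hP.2.1, fun u hu =>
    (Finset.mem_union.1 hu).elim (hP.2.2 u) (hQ.2.2 u)⟩

theorem IsPartition.concat {s u t : ℝ} {P Q : Finset ℝ} (hP : IsPartition s u P)
    (hQ : IsPartition u t Q) (hsu : s ≤ u) (hut : u ≤ t) : IsPartition s t (P ∪ Q) :=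
  ⟨Finset.mem_union_left _ hP.1, Finset.mem_union_right _ hQ.2.1, fun v hv =>
    (Finset.mem_union.1 hv).elim (fun h => ⟨(hP.2.2 v h).1, (hP.2.2 v h).2.trans hut⟩)
      (fun h => ⟨hsu.trans (hQ.2.2 v h).1, (hQ.2.2 v h).2⟩)⟩

/-! ### Real induction -/

theorem real_induction {a b : ℝ} {p : ℝ → Prop} (h0 : p a)
    (hl : ∀ t, a < t → t ≤ b → (∀ u, a ≤ u → u < t → p u) → p t)
    (hr : ∀ t, a ≤ t → t < b → (∀ u, a ≤ u → u ≤ t → p u) →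
      ∃ t' > t, ∀ u, t < u → u ≤ t' → u ≤ b → p u) :
    ∀ t, a ≤ t → t ≤ b → p t := by
  by_contra! hcon
  obtain ⟨t₀, h1, h2, h3⟩ := hcon
  set S : Set ℝ := {t | a ≤ t ∧ t ≤ b ∧ ¬ p t} with hS
  have hSne : S.Nonempty := ⟨t₀, h1, h2, h3⟩
  have hSbd : BddBelow S := ⟨a, fun t ht => ht.1⟩
  set m := sInf S with hm
  have ham : a ≤ m := le_csInf hSne fun t ht => ht.1
  have hmt : m ≤ t₀ := csInf_le hSbd ⟨h1, h2, h3⟩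
  have hlt : ∀ u, a ≤ u → u < m → p u := by
    intro u hau hum
    by_contra hpu
    exact absurd (csInf_le hSbd ⟨hau, (hum.le.trans hmt).trans h2, hpu⟩) (not_le.2 hum)
  have hpm : p m := by
    rcases ham.lt_or_eq with h | h
    · exact hl m h (hmt.trans h2) hlt
    · rw [← h]; exact h0
  have hmt' : m < t₀ := lt_of_le_of_ne hmt (by rintro h; rw [h] at hpm; exact h3 hpm)
  obtain ⟨t', ht', H⟩ := hr m ham (hmt'.trans_le h2) fun u hau hum => by
    rcases hum.lt_or_eq with h | h
    · exact hlt u hau h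
    · rw [h]; exact hpm
  obtain ⟨s, hsS, hst'⟩ := exists_lt_of_csInf_lt hSne ht'
  have hms : m < s := lt_of_le_of_ne (csInf_le hSbd hsS) (by
    rintro h
    rw [h] at hpm
    exact hsS.2.2 hpm)
  exact hsS.2.2 (H s hms hst'.le hsS.2.1)

/-! ### Sewing along a right-continuous control -/

section Sewing

theorem IsControl.mono_right {T : ℝ} {ω : ℝ → ℝ → ℝ} (hω : IsControl T ω) {s u t : ℝ} (hs : 0 ≤ s)
    (hsu : s ≤ u) (hut : u ≤ t) (ht : t ≤ T) : ω s u ≤ ω s t := by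
  have h1 := hω.superadditive s u t hs hsu hut ht
  have h2 := hω.nonneg u t (hs.trans hsu) hut ht
  linarith

theorem IsControl.mono_left {T : ℝ} {ω : ℝ → ℝ → ℝ} (hω : IsControl T ω) {s u t : ℝ} (hs : 0 ≤ s)
    (hsu : s ≤ u) (hut : u ≤ t) (ht : t ≤ T) : ω u t ≤ ω s t := by
  have h1 := hω.superadditive s u t hs hsu hut ht
  have h2 := hω.nonneg s u hs hsu (hut.trans ht)
  linarith

theorem IsControl.mono {T : ℝ} {ω : ℝ → ℝ → ℝ} (hω : IsControl T ω) {a s t b : ℝ} (ha : 0 ≤ a)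
    (has : a ≤ s) (hst : s ≤ t) (htb : t ≤ b) (hb : b ≤ T) : ω s t ≤ ω a b :=
  (hω.mono_left ha has hst (htb.trans hb)).trans (hω.mono_right ha (has.trans hst) htb hb)

theorem IsControl.restrict {T T' : ℝ} {ω : ℝ → ℝ → ℝ} (hω : IsControl T ω) (h : T' ≤ T) :
    IsControl T' ω :=
  ⟨fun s t h1 h2 h3 => hω.nonneg s t h1 h2 (h3.trans h), fun t h1 h2 => hω.diag t h1 (h2.trans h),
    fun s u t h1 h2 h3 h4 => hω.superadditive s u t h1 h2 h3 (h4.trans h)⟩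

theorem IsRightContinuous.restrict {T T' : ℝ} {ω : ℝ → ℝ → ℝ} (hω : IsRightContinuous T ω)
    (h : T' ≤ T) : IsRightContinuous T' ω :=
  fun s t h1 h2 h3 => (hω s t h1 h2 (h3.trans h)).mono (Set.Icc_subset_Icc_right h)

theorem exists_control_lt {T : ℝ} {ω : ℝ → ℝ → ℝ} (hω : IsControl T ω)
    (hr : IsRightContinuous T ω) {t ε : ℝ} (ht : 0 ≤ t) (htT : t < T) (hε : 0 < ε) :
    ∃ t' > t, t' ≤ T ∧ ω t t' < ε := by
  have h := hr t t ht le_rfl htT.le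
  rw [Metric.continuousWithinAt_iff] at h
  obtain ⟨δ, hδ, H⟩ := h ε hε
  have hmin : t < min T (t + δ / 2) := lt_min htT (by linarith)
  refine ⟨min T (t + δ / 2), hmin, min_le_left _ _, ?_⟩
  have := H (x := min T (t + δ / 2)) ⟨hmin.le, min_le_left _ _⟩ (by
    rw [Real.dist_eq, abs_of_pos (by linarith)]
    have := min_le_right T (t + δ / 2)
    linarith)
  rw [hω.diag t ht htT.le, Real.dist_eq, sub_zero] at this
  exact (le_abs_self _).trans_lt this

/-- The constant of the maximal inequality for Riemann sums: the solution `K` of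
`K = 2 (K (1/2) ^ (1 + η)) + 2`. -/
def sewingConst (η : ℝ) : ℝ := 2 / (1 - (1 / 2 : ℝ) ^ η)

theorem sewingConst_spec {η : ℝ} (hη : 0 < η) :
    0 ≤ sewingConst η ∧ sewingConst η * (1 / 2 : ℝ) ^ η + 2 = sewingConst η := by
  have h : (1 / 2 : ℝ) ^ η < 1 := Real.rpow_lt_one (by norm_num) (by norm_num) hη
  have h' : 0 < 1 - (1 / 2 : ℝ) ^ η := by linarith
  refine ⟨by unfold sewingConst; positivity, ?_⟩
  unfold sewingConst
  field_simp
  ring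

variable {E : Type*} [NormedAddCommGroup E] {T η M : ℝ} {ω : ℝ → ℝ → ℝ} {Ξ : ℝ → ℝ → E}

/-- The defect of additivity of `Ξ` on `[a, b]` is controlled. -/
def IsAlmostAdditive (ω : ℝ → ℝ → ℝ) (η M : ℝ) (Ξ : ℝ → ℝ → E) (a b : ℝ) : Prop :=
  ∀ s u t, a ≤ s → s ≤ u → u ≤ t → t ≤ b → ‖Ξ s t - Ξ s u - Ξ u t‖ ≤ M * ω s u ^ η * ω s t

theorem IsAlmostAdditive.restrict {a b a' b' : ℝ} (h : IsAlmostAdditive ω η M Ξ a b)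
    (ha : a ≤ a') (hb : b' ≤ b) : IsAlmostAdditive ω η M Ξ a' b' :=
  fun s u t h1 h2 h3 h4 => h s u t (ha.trans h1) h2 h3 (h4.trans hb)

theorem IsAlmostAdditive.diag (hω : IsControl T ω) {a b : ℝ} (ha : 0 ≤ a) (hb : b ≤ T)
    (h : IsAlmostAdditive ω η M Ξ a b) {s : ℝ} (h1 : a ≤ s) (h2 : s ≤ b) : Ξ s s = 0 := by
  have := h s s s h1 le_rfl le_rfl h2
  rw [hω.diag s (ha.trans h1) (h2.trans hb), mul_zero, norm_le_zero_iff] at this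
  simpa using this

/-- The maximal inequality. The partition is cut at the step over which `ω s ·` passes half of its
total variation, so that both remaining pieces carry at most half of the control. -/
theorem norm_riemannSum_sub_le (hω : IsControl T ω) (hη : 0 < η) (hM : 0 ≤ M) (P : Finset ℝ) :
    ∀ s t, 0 ≤ s → s ≤ t → t ≤ T → IsPartition s t P → IsAlmostAdditive ω η M Ξ s t →
      ‖riemannSum Ξ P - Ξ s t‖ ≤ sewingConst η * M * ω s t ^ η * ω s t := by
  induction P using Finset.strongInduction with
  | H P ih =>
  intro s t hs hst ht hP hΞ
  obtain ⟨hK, hKeq⟩ := sewingConst_spec hη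
  have hω0 : 0 ≤ ω s t := hω.nonneg s t hs hst ht
  rcases hst.eq_or_lt with rfl | hlt
  · rw [hP.eq_singleton, riemannSum_singleton, hΞ.diag hω hs ht le_rfl le_rfl]
    simpa using by positivity
  set A : Finset ℝ := P.filter fun v => v < t ∧ ω s v ≤ ω s t / 2 with hA
  have hsA : s ∈ A := by
    rw [hA, Finset.mem_filter]
    refine ⟨hP.1, hlt, ?_⟩
    rw [hω.diag s hs (hst.trans ht)]
    positivity
  have hAne : A.Nonempty := ⟨s, hsA⟩
  set u := A.max' hAne with hu
  obtain ⟨huP, hut, huω⟩ : u ∈ P ∧ u < t ∧ ω s u ≤ ω s t / 2 := by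
    exact Finset.mem_filter.1 (A.max'_mem hAne)
  set B : Finset ℝ := P.filter fun v => u < v with hB
  have htB : t ∈ B := by rw [hB, Finset.mem_filter]; exact ⟨hP.2.1, hut⟩
  have hBne : B.Nonempty := ⟨t, htB⟩
  set w := B.min' hBne with hw
  obtain ⟨hwP, huw⟩ : w ∈ P ∧ u < w := by
    exact Finset.mem_filter.1 (B.min'_mem hBne)
  have hsu : s ≤ u := (hP.2.2 u huP).1
  have hsw : s ≤ w := hsu.trans huw.le
  have hwt : w ≤ t := (hP.2.2 w hwP).2
  have hu0 : 0 ≤ u := hs.trans hsu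
  have hw0 : 0 ≤ w := hs.trans hsw
  have hwω : ω w t ≤ ω s t / 2 := by
    rcases hwt.eq_or_lt with h | h
    · rw [h, hω.diag t (hs.trans hst) ht]; positivity
    · have : ¬ ω s w ≤ ω s t / 2 := by
        intro h'
        have : w ∈ A := by rw [hA, Finset.mem_filter]; exact ⟨hwP, h, h'⟩
        exact absurd (A.le_max' w this) (not_le.2 huw)
      have h' := hω.superadditive s w t hs hsw hwt ht
      linarith
  have hsplit : riemannSum Ξ P = riemannSum Ξ (P.filter (· ≤ u)) + Ξ u w +
      riemannSum Ξ (P.filter (w ≤ ·)) := by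
    have hw' : w ∈ P.filter (u ≤ ·) := by simp [hwP, huw.le]
    rw [riemannSum_split Ξ huP, riemannSum_split Ξ hw', ← add_assoc]
    congr 2
    · rw [← riemannSum_pair Ξ huw]
      congr 1
      ext x
      simp only [Finset.mem_filter, Finset.mem_insert, Finset.mem_singleton]
      constructor
      · rintro ⟨⟨h1, h2⟩, h3⟩
        rcases h2.eq_or_lt with h | h
        · exact Or.inl h.symm
        · exact Or.inr (le_antisymm h3 (B.min'_le x (by rw [hB, Finset.mem_filter]; exact ⟨h1, h⟩)))
      · rintro (rfl | rfl)
        · exact ⟨⟨huP, le_rfl⟩, huw.le⟩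
        · exact ⟨⟨hwP, huw.le⟩, le_rfl⟩
    · ext x
      simp only [Finset.mem_filter]
      exact ⟨fun h => ⟨h.1.1, h.2⟩, fun h => ⟨⟨h.1, huw.le.trans h.2⟩, h.2⟩⟩
  have hc1 : P.filter (· ≤ u) ⊂ P := Finset.filter_ssubset.2 ⟨t, hP.2.1, not_le.2 hut⟩
  have hc2 : P.filter (w ≤ ·) ⊂ P :=
    Finset.filter_ssubset.2 ⟨s, hP.1, not_le.2 (hsu.trans_lt huw)⟩
  have i1 := ih _ hc1 s u hs hsu (hut.le.trans ht) (hP.filter_le huP)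
    (hΞ.restrict le_rfl hut.le)
  have i2 := ih _ hc2 w t hw0 hwt ht (hP.filter_ge hwP) (hΞ.restrict hsw le_rfl)
  have half : ∀ x : ℝ, 0 ≤ x → x ≤ ω s t / 2 →
      sewingConst η * M * x ^ η * x ≤
        sewingConst η * M * ((1 / 2 : ℝ) ^ η * ω s t ^ η) * (ω s t / 2) := by
    intro x hx hx'
    have : x ^ η ≤ (1 / 2 : ℝ) ^ η * ω s t ^ η := by
      rw [← Real.mul_rpow (by norm_num) hω0]
      exact Real.rpow_le_rpow hx (by linarith) hη.le
    gcongr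
  have j1 := i1.trans (half _ (hω.nonneg s u hs hsu (hut.le.trans ht)) huω)
  have j2 := i2.trans (half _ (hω.nonneg w t hw0 hwt ht) hwω)
  have d1 : ‖Ξ s w - Ξ s u - Ξ u w‖ ≤ M * ω s t ^ η * ω s t := by
    refine (hΞ s u w le_rfl hsu huw.le hwt).trans ?_
    have h1 := hω.nonneg s u hs hsu (hut.le.trans ht)
    have h2 := hω.mono_right hs hsw hwt ht
    have h3 := hω.nonneg s w hs hsw (hwt.trans ht)
    gcongr
    linarith
  have d2 : ‖Ξ s t - Ξ s w - Ξ w t‖ ≤ M * ω s t ^ η * ω s t := by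
    refine (hΞ s w t le_rfl hsw hwt le_rfl).trans ?_
    have h2 := hω.mono_right hs hsw hwt ht
    have h3 := hω.nonneg s w hs hsw (hwt.trans ht)
    gcongr
  have heq : riemannSum Ξ P - Ξ s t =
      (riemannSum Ξ (P.filter (· ≤ u)) - Ξ s u) + (riemannSum Ξ (P.filter (w ≤ ·)) - Ξ w t) -
        (Ξ s w - Ξ s u - Ξ u w) - (Ξ s t - Ξ s w - Ξ w t) := by
    rw [hsplit]; abel
  calc ‖riemannSum Ξ P - Ξ s t‖
      ≤ ‖riemannSum Ξ (P.filter (· ≤ u)) - Ξ s u‖ + ‖riemannSum Ξ (P.filter (w ≤ ·)) - Ξ w t‖ +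
        ‖Ξ s w - Ξ s u - Ξ u w‖ + ‖Ξ s t - Ξ s w - Ξ w t‖ := by
        rw [heq]
        refine (norm_sub_le _ _).trans (add_le_add ((norm_sub_le _ _).trans
          (add_le_add (norm_add_le _ _) le_rfl)) le_rfl)
    _ ≤ _ := add_le_add (add_le_add (add_le_add j1 j2) d1) d2
    _ = (sewingConst η * (1 / 2 : ℝ) ^ η + 2) * M * ω s t ^ η * ω s t := by ring
    _ = _ := by rw [hKeq]

theorem IsRRSLimit.unique {s t : ℝ} {K K' : E} (h : IsRRSLimit Ξ s t K)
    (h' : IsRRSLimit Ξ s t K') : K = K' := by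
  refine eq_of_forall_dist_le fun ε hε => ?_
  obtain ⟨P, hP, H⟩ := h (ε / 2) (half_pos hε)
  obtain ⟨P', hP', H'⟩ := h' (ε / 2) (half_pos hε)
  have h1 := H (P ∪ P') (hP.union hP') Finset.subset_union_left
  have h2 := H' (P ∪ P') (hP.union hP') Finset.subset_union_right
  rw [dist_eq_norm]
  have : K - K' = (riemannSum Ξ (P ∪ P') - K') - (riemannSum Ξ (P ∪ P') - K) := by abel
  rw [this]
  exact (norm_sub_le _ _).trans (by linarith)

theorem IsRRSLimit.congr {s t : ℝ} {K : E} {Ξ' : ℝ → ℝ → E} (h : IsRRSLimit Ξ s t K)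
    (hΞ : ∀ u v, s ≤ u → u < v → v ≤ t → Ξ u v = Ξ' u v) : IsRRSLimit Ξ' s t K := by
  intro ε hε
  obtain ⟨P, hP, H⟩ := h ε hε
  refine ⟨P, hP, fun Q hQ hPQ => ?_⟩
  rw [← riemannSum_congr fun u hu v hv huv => hΞ u v (hQ.2.2 u hu).1 huv (hQ.2.2 v hv).2]
  exact H Q hQ hPQ

theorem IsRRSLimit.sub {s t : ℝ} {K K' : E} {Ξ' : ℝ → ℝ → E} (h : IsRRSLimit Ξ s t K)
    (h' : IsRRSLimit Ξ' s t K') : IsRRSLimit (fun u v => Ξ u v - Ξ' u v) s t (K - K') := by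
  intro ε hε
  obtain ⟨P, hP, H⟩ := h (ε / 2) (half_pos hε)
  obtain ⟨P', hP', H'⟩ := h' (ε / 2) (half_pos hε)
  refine ⟨P ∪ P', hP.union hP', fun Q hQ hPQ => ?_⟩
  have h1 := H Q hQ (Finset.union_subset_left hPQ)
  have h2 := H' Q hQ (Finset.union_subset_right hPQ)
  have : riemannSum (fun u v => Ξ u v - Ξ' u v) Q - (K - K') =
      (riemannSum Ξ Q - K) - (riemannSum Ξ' Q - K') := by
    rw [riemannSum_sub]; abel
  rw [this]
  exact (norm_sub_le _ _).trans_lt (by linarith)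

theorem IsRRSLimit.concat {s u t : ℝ} {K K' : E} (hsu : s ≤ u) (hut : u ≤ t)
    (h : IsRRSLimit Ξ s u K) (h' : IsRRSLimit Ξ u t K') : IsRRSLimit Ξ s t (K + K') := by
  intro ε hε
  obtain ⟨P, hP, H⟩ := h (ε / 2) (half_pos hε)
  obtain ⟨P', hP', H'⟩ := h' (ε / 2) (half_pos hε)
  refine ⟨P ∪ P', hP.concat hP' hsu hut, fun Q hQ hPQ => ?_⟩
  have huQ : u ∈ Q := hPQ (Finset.mem_union_left _ hP.2.1)
  have h1 := H _ (hQ.filter_le huQ) fun v hv =>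
    Finset.mem_filter.2 ⟨hPQ (Finset.mem_union_left _ hv), (hP.2.2 v hv).2⟩
  have h2 := H' _ (hQ.filter_ge huQ) fun v hv =>
    Finset.mem_filter.2 ⟨hPQ (Finset.mem_union_right _ hv), (hP'.2.2 v hv).1⟩
  rw [riemannSum_split Ξ huQ, add_sub_add_comm]
  exact (norm_add_le _ _).trans_lt (by linarith)

theorem IsRRSLimit.norm_sub_le (hω : IsControl T ω) (hη : 0 < η) (hM : 0 ≤ M) {s t : ℝ} {K : E}
    (hs : 0 ≤ s) (hst : s ≤ t) (ht : t ≤ T) (hΞ : IsAlmostAdditive ω η M Ξ s t)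
    (h : IsRRSLimit Ξ s t K) : ‖K - Ξ s t‖ ≤ sewingConst η * M * ω s t ^ η * ω s t := by
  refine le_of_forall_pos_le_add fun ε hε => ?_
  obtain ⟨P, hP, H⟩ := h ε hε
  have h1 := H P hP subset_rfl
  have h2 := norm_riemannSum_sub_le hω hη hM P s t hs hst ht hP hΞ
  have : K - Ξ s t = (riemannSum Ξ P - Ξ s t) - (riemannSum Ξ P - K) := by abel
  rw [this]
  exact (_root_.norm_sub_le _ _).trans (by linarith)

/-- If `ω s v ≤ ε` for all `v < t`, refining the trivial partition of `[s, t]` changes the Riemann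
sum by little, even when `ω` jumps at `t`: the last division point before `t` is removed first, and
the defect there involves `ω s u ^ η` with `u < t`. -/
theorem norm_riemannSum_sub_le_of_small (hω : IsControl T ω) (hη : 0 < η) (hM : 0 ≤ M) {ε : ℝ}
    {s t : ℝ} (hs : 0 ≤ s) (hst : s < t) (ht : t ≤ T) (hΞ : IsAlmostAdditive ω η M Ξ s t)
    (hsmall : ∀ v, s ≤ v → v < t → ω s v ≤ ε) {P : Finset ℝ} (hP : IsPartition s t P) :
    ‖riemannSum Ξ P - Ξ s t‖ ≤ (sewingConst η + 1) * M * ε ^ η * ω s t := by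
  obtain ⟨hK, -⟩ := sewingConst_spec hη
  have hω0 : 0 ≤ ω s t := hω.nonneg s t hs hst.le ht
  set A : Finset ℝ := P.filter fun v => v < t with hA
  have hAne : A.Nonempty := ⟨s, by rw [hA, Finset.mem_filter]; exact ⟨hP.1, hst⟩⟩
  set u := A.max' hAne with hu
  obtain ⟨huP, hut⟩ : u ∈ P ∧ u < t := by
    exact Finset.mem_filter.1 (A.max'_mem hAne)
  have hsu : s ≤ u := (hP.2.2 u huP).1
  have hsplit : riemannSum Ξ P = riemannSum Ξ (P.filter (· ≤ u)) + Ξ u t := by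
    rw [riemannSum_split Ξ huP, ← riemannSum_pair Ξ hut]
    congr 2
    ext x
    simp only [Finset.mem_filter, Finset.mem_insert, Finset.mem_singleton]
    constructor
    · rintro ⟨h1, h2⟩
      rcases (hP.2.2 x h1).2.eq_or_lt with h | h
      · exact Or.inr h
      · exact Or.inl (le_antisymm (A.le_max' x (by rw [hA, Finset.mem_filter]; exact ⟨h1, h⟩)) h2)
    · rintro (rfl | rfl)
      · exact ⟨huP, le_rfl⟩
      · exact ⟨hP.2.1, hut.le⟩
  have h0 := hω.nonneg s u hs hsu (hut.le.trans ht)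
  have hε := hsmall u hsu hut
  have hm := hω.mono_right hs hsu hut.le ht
  have i1 := norm_riemannSum_sub_le hω hη hM _ s u hs hsu (hut.le.trans ht) (hP.filter_le huP)
    (hΞ.restrict le_rfl hut.le)
  have i2 := hΞ s u t le_rfl hsu hut.le le_rfl
  have hp : ω s u ^ η ≤ ε ^ η := Real.rpow_le_rpow h0 hε hη.le
  have heq : riemannSum Ξ P - Ξ s t =
      (riemannSum Ξ (P.filter (· ≤ u)) - Ξ s u) - (Ξ s t - Ξ s u - Ξ u t) := by
    rw [hsplit]; abel
  rw [heq]
  calc _ ≤ sewingConst η * M * ω s u ^ η * ω s u + M * ω s u ^ η * ω s t :=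
        (_root_.norm_sub_le _ _).trans (add_le_add i1 i2)
    _ ≤ sewingConst η * M * ε ^ η * ω s t + M * ε ^ η * ω s t := by
        have : 0 ≤ ε := h0.trans hε
        gcongr
    _ = _ := by ring

/-- Partitions along which Riemann sums are nearly stable under refinement. -/
theorem exists_stable_partition (hω : IsControl T ω) (hr : IsRightContinuous T ω) (hη : 0 < η)
    (hM : 0 ≤ M) {ε : ℝ} (hε : 0 < ε) {s t : ℝ} (hs : 0 ≤ s) (hst : s ≤ t) (ht : t ≤ T)
    (hΞ : IsAlmostAdditive ω η M Ξ s t) :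
    ∃ P₀, IsPartition s t P₀ ∧ ∀ P, IsPartition s t P → P₀ ⊆ P →
      ‖riemannSum Ξ P - riemannSum Ξ P₀‖ ≤ (sewingConst η + 1) * M * ε ^ η * ω s t := by
  obtain ⟨hK, -⟩ := sewingConst_spec hη
  set κ := (sewingConst η + 1) * M * ε ^ η with hκ
  have hκ0 : 0 ≤ κ := by positivity
  -- steps over which the control is small up to the right end point, where it may jump
  have step : ∀ a b, s ≤ a → a < b → b ≤ t → (∀ v, a ≤ v → v < b → ω a v ≤ ε) →
      (∃ P₀, IsPartition s a P₀ ∧ ∀ P, IsPartition s a P → P₀ ⊆ P →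
        ‖riemannSum Ξ P - riemannSum Ξ P₀‖ ≤ κ * ω s a) →
      ∃ P₀, IsPartition s b P₀ ∧ ∀ P, IsPartition s b P → P₀ ⊆ P →
        ‖riemannSum Ξ P - riemannSum Ξ P₀‖ ≤ κ * ω s b := by
    rintro a b hsa hab hbt hsmall ⟨P₀, hP₀, H⟩
    have hQ := isPartition_pair hab.le
    refine ⟨P₀ ∪ {a, b}, hP₀.concat hQ hsa hab.le, fun P hP hsub => ?_⟩
    have haP : a ∈ P := hsub (Finset.mem_union_left _ hP₀.2.1)
    have e1 : (P₀ ∪ {a, b}).filter (· ≤ a) = P₀ := by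
      ext x
      simp only [Finset.mem_filter, Finset.mem_union, Finset.mem_insert, Finset.mem_singleton]
      constructor
      · rintro ⟨h | h | h, h'⟩
        · exact h
        · rw [h]; exact hP₀.2.1
        · rw [h] at h'; exact absurd h' (not_le.2 hab)
      · exact fun h => ⟨Or.inl h, (hP₀.2.2 x h).2⟩
    have e2 : (P₀ ∪ {a, b}).filter (a ≤ ·) = {a, b} := by
      ext x
      simp only [Finset.mem_filter, Finset.mem_union, Finset.mem_insert, Finset.mem_singleton]
      constructor
      · rintro ⟨h | h, h'⟩
        · exact Or.inl (le_antisymm (hP₀.2.2 x h).2 h')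
        · exact h
      · rintro (h | h)
        · exact ⟨Or.inr (Or.inl h), h.ge⟩
        · exact ⟨Or.inr (Or.inr h), by rw [h]; exact hab.le⟩
    rw [riemannSum_split Ξ haP, riemannSum_split Ξ (P := P₀ ∪ {a, b}) (u := a) (by simp), e1, e2,
      riemannSum_pair Ξ hab, add_sub_add_comm]
    have i1 := H _ (hP.filter_le haP) fun v hv =>
      Finset.mem_filter.2 ⟨hsub (Finset.mem_union_left _ hv), (hP₀.2.2 v hv).2⟩
    have i2 := norm_riemannSum_sub_le_of_small hω hη hM (hs.trans hsa) hab (hbt.trans ht)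
      (hΞ.restrict hsa hbt) hsmall (hP.filter_ge haP)
    have i3 := hω.superadditive s a b hs hsa hab.le (hbt.trans ht)
    calc _ ≤ κ * ω s a + κ * ω a b := (norm_add_le _ _).trans (add_le_add i1 i2)
      _ = κ * (ω s a + ω a b) := by ring
      _ ≤ _ := by gcongr
  refine real_induction (a := s) (b := t) (p := fun b => ∃ P₀, IsPartition s b P₀ ∧
    ∀ P, IsPartition s b P → P₀ ⊆ P → ‖riemannSum Ξ P - riemannSum Ξ P₀‖ ≤ κ * ω s b)
    ?_ ?_ ?_ t hst le_rfl
  · refine ⟨{s}, ⟨by simp, by simp, by simp⟩, fun P hP _ => ?_⟩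
    rw [hP.eq_singleton, sub_self, norm_zero]
    exact mul_nonneg hκ0 (hω.nonneg s s hs le_rfl (hst.trans ht))
  · intro b hsb hbt ih
    -- choose `a < b` with `ω s a` close to the supremum of `ω s v`, `v < b`
    set S : Set ℝ := (ω s) '' Set.Ico s b with hS
    have hne : S.Nonempty := ⟨ω s s, s, ⟨le_rfl, hsb⟩, rfl⟩
    have hbd : BddAbove S := by
      refine ⟨ω s b, ?_⟩
      rintro _ ⟨v, hv, rfl⟩
      exact hω.mono_right hs hv.1 hv.2.le (hbt.trans ht)
    obtain ⟨_, ⟨a, ha, rfl⟩, hlt⟩ := exists_lt_of_lt_csSup hne (sub_lt_self (sSup S) hε)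
    refine step a b ha.1 ha.2 hbt (fun v hav hvb => ?_) (ih a ha.1 ha.2)
    have h1 := hω.superadditive s a v hs ha.1 hav ((hvb.le.trans hbt).trans ht)
    have h2 : ω s v ≤ sSup S := le_csSup hbd ⟨v, ⟨ha.1.trans hav, hvb⟩, rfl⟩
    linarith
  · intro a hsa hat ih
    obtain ⟨t', ht', ht'T, hlt⟩ := exists_control_lt hω hr (hs.trans hsa) (hat.trans_le ht) hε
    refine ⟨t', ht', fun b hab hbt' hbt => step a b hsa hab hbt (fun v hav hvb => ?_)
      (ih a hsa le_rfl)⟩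
    exact (hω.mono_right (hs.trans hsa) hav (hvb.le.trans hbt') ht'T).trans hlt.le

theorem exists_isRRSLimit [CompleteSpace E] (hω : IsControl T ω) (hr : IsRightContinuous T ω)
    (hη : 0 < η) (hM : 0 ≤ M) {s t : ℝ} (hs : 0 ≤ s) (hst : s ≤ t) (ht : t ≤ T)
    (hΞ : IsAlmostAdditive ω η M Ξ s t) : ∃ K, IsRRSLimit Ξ s t K := by
  obtain ⟨hK, -⟩ := sewingConst_spec hη
  have stable : ∀ ε > 0, ∃ P₀, IsPartition s t P₀ ∧ ∀ P, IsPartition s t P → P₀ ⊆ P →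
      ‖riemannSum Ξ P - riemannSum Ξ P₀‖ ≤ ε := by
    intro ε hε
    set c := (sewingConst η + 1) * M * ω s t with hc
    have hc0 : 0 ≤ c := mul_nonneg (mul_nonneg (by linarith) hM) (hω.nonneg s t hs hst ht)
    have hpos : 0 < ε / (c + 1) := by positivity
    obtain ⟨P₀, h1, h2⟩ := exists_stable_partition hω hr hη hM
      (Real.rpow_pos_of_pos hpos (1 / η)) hs hst ht hΞ
    refine ⟨P₀, h1, fun P hP hsub => (h2 P hP hsub).trans ?_⟩
    rw [← Real.rpow_mul hpos.le, one_div_mul_cancel hη.ne', Real.rpow_one]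
    calc _ = c * (ε / (c + 1)) := by rw [hc]; ring
      _ ≤ (c + 1) * (ε / (c + 1)) := by gcongr; linarith
      _ = ε := by field_simp
  have hpos : ∀ n : ℕ, (0 : ℝ) < (1 / 2) ^ n := fun n => by positivity
  choose P hP H using fun n : ℕ => stable ((1 / 2) ^ n) (hpos n)
  have hcl : ∀ n m, ‖riemannSum Ξ (P n) - riemannSum Ξ (P m)‖ ≤ (1 / 2) ^ n + (1 / 2) ^ m := by
    intro n m
    have h1 := H n (P n ∪ P m) ((hP n).union (hP m)) Finset.subset_union_left
    have h2 := H m (P n ∪ P m) ((hP n).union (hP m)) Finset.subset_union_right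
    have : riemannSum Ξ (P n) - riemannSum Ξ (P m) =
        (riemannSum Ξ (P n ∪ P m) - riemannSum Ξ (P m)) -
          (riemannSum Ξ (P n ∪ P m) - riemannSum Ξ (P n)) := by abel
    rw [this]
    exact (_root_.norm_sub_le _ _).trans (by linarith)
  have hlim : Filter.Tendsto (fun n : ℕ => 2 * (1 / 2 : ℝ) ^ n) Filter.atTop (nhds 0) := by
    simpa using (tendsto_pow_atTop_nhds_zero_of_lt_one (by norm_num : (0 : ℝ) ≤ 1 / 2)
      (by norm_num)).const_mul 2
  have hcau : CauchySeq fun n => riemannSum Ξ (P n) := by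
    refine cauchySeq_of_le_tendsto_0 (fun n : ℕ => 2 * (1 / 2 : ℝ) ^ n) (fun n m k hn hm => ?_) hlim
    rw [dist_eq_norm]
    have h1 : ((1 / 2 : ℝ)) ^ n ≤ (1 / 2) ^ k := pow_le_pow_of_le_one (by norm_num) (by norm_num) hn
    have h2 : ((1 / 2 : ℝ)) ^ m ≤ (1 / 2) ^ k := pow_le_pow_of_le_one (by norm_num) (by norm_num) hm
    exact (hcl n m).trans (by linarith)
  obtain ⟨K, hKlim⟩ := cauchySeq_tendsto_of_complete hcau
  refine ⟨K, fun ε hε => ?_⟩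
  obtain ⟨n₀, hn₀⟩ := Metric.tendsto_atTop.1 hKlim (ε / 2) (half_pos hε)
  obtain ⟨m, hm⟩ := exists_pow_lt_of_lt_one (half_pos hε) (by norm_num : (1 / 2 : ℝ) < 1)
  set n := max n₀ m
  have hn1 := hn₀ n (le_max_left _ _)
  have hn2 : (1 / 2 : ℝ) ^ n < ε / 2 :=
    (pow_le_pow_of_le_one (by norm_num) (by norm_num) (le_max_right _ _)).trans_lt hm
  refine ⟨P n, hP n, fun Q hQ hsub => ?_⟩
  have h1 := H n Q hQ hsub
  rw [dist_eq_norm] at hn1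
  have : riemannSum Ξ Q - K = (riemannSum Ξ Q - riemannSum Ξ (P n)) + (riemannSum Ξ (P n) - K) := by
    abel
  rw [this]
  exact (norm_add_le _ _).trans_lt (by linarith)

/-- The indefinite integral: the limits on `[0, t]` determine those on all subintervals. -/
theorem isRRSLimit_sub [CompleteSpace E] (hω : IsControl T ω) (hr : IsRightContinuous T ω)
    (hη : 0 < η) (hM : 0 ≤ M) (hΞ : IsAlmostAdditive ω η M Ξ 0 T) {J : ℝ → E}
    (hJ : ∀ t, 0 ≤ t → t ≤ T → IsRRSLimit Ξ 0 t (J t)) {s t : ℝ} (hs : 0 ≤ s) (hst : s ≤ t)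
    (ht : t ≤ T) : IsRRSLimit Ξ s t (J t - J s) := by
  obtain ⟨K, hK⟩ := exists_isRRSLimit hω hr hη hM hs hst ht (hΞ.restrict hs ht)
  have := ((hJ s hs (hst.trans ht)).concat hs hst hK).unique (hJ t (hs.trans hst) ht)
  rw [← this, add_sub_cancel_left]
  exact hK

end Sewing

/-! ### Homogeneous coordinates -/

section Algebra

open Asymptotics Filter

variable {H : Type*} [CommRing H] [Algebra ℝ H] [Coalgebra ℝ H]

/-- `b` is a finite basis of `H` made of homogeneous elements, `deg k ≤ N` being the degree of
`b k`. -/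
structure IsHomogeneousBasis {ι : Type*} (𝒜 : ℕ → Submodule ℝ H) (N : ℕ) (b : Module.Basis ι ℝ H)
    (deg : ι → ℕ) : Prop where
  mem : ∀ k, b k ∈ 𝒜 (deg k)
  deg_le : ∀ k, deg k ≤ N
  repr_eq_zero : ∀ n, ∀ x ∈ 𝒜 n, ∀ k, deg k ≠ n → b.repr x k = 0

variable {𝒜 : ℕ → Submodule ℝ H} [GradedAlgebra 𝒜] {N : ℕ}

theorem exists_isHomogeneousBasis (hH : IsTruncatedHopfAlgebra 𝒜 N) :
    ∃ (ι : Type) (_ : Fintype ι) (b : Module.Basis ι ℝ H) (deg : ι → ℕ),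
      IsHomogeneousBasis 𝒜 N b deg := by
  have := hH.finite
  have hint := DirectSum.Decomposition.isInternal 𝒜
  let v : ∀ n, Module.Basis (Fin (Module.finrank ℝ (𝒜 n))) ℝ (𝒜 n) :=
    fun n => Module.finBasis ℝ (𝒜 n)
  have hle : ∀ a : Σ n, Fin (Module.finrank ℝ (𝒜 n)), a.1 ≤ N := by
    rintro ⟨n, i⟩
    by_contra h
    have h0 : Module.finrank ℝ (𝒜 n) = 0 := by
      rw [hH.truncated n (not_le.1 h)]; simp
    rw [h0] at i
    exact i.elim0
  have hfin : Finite (Σ n, Fin (Module.finrank ℝ (𝒜 n))) :=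
    Finite.of_injective
      (β := Σ n : Fin (N + 1), Fin (Module.finrank ℝ (𝒜 n)))
      (fun a => ⟨⟨a.1, Nat.lt_succ_of_le (hle a)⟩, a.2⟩) (by
        rintro ⟨n, i⟩ ⟨m, j⟩ h
        simp only [Sigma.mk.injEq, Fin.mk.injEq] at h
        obtain ⟨rfl, h⟩ := h
        simpa using h)
  refine ⟨_, Fintype.ofFinite _, hint.collectedBasis v, fun a => a.1, ?_, hle, ?_⟩
  · exact fun k => hint.collectedBasis_mem v k
  · rintro n x hx ⟨m, i⟩ hne
    exact hint.collectedBasis_repr_of_mem_ne v hne.symm hx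

theorem counit_mul (hH : IsTruncatedHopfAlgebra 𝒜 N) (x y : H) :
    Coalgebra.counit (R := ℝ) (x * y) =
      Coalgebra.counit (R := ℝ) x * Coalgebra.counit (R := ℝ) y := by
  induction x using DirectSum.Decomposition.inductionOn 𝒜 with
  | zero => simp
  | add x x' hx hx' => rw [add_mul, map_add, hx, hx', map_add, add_mul]
  | @homogeneous i x =>
    induction y using DirectSum.Decomposition.inductionOn 𝒜 with
    | zero => simp
    | add y y' hy hy' => rw [mul_add, map_add, hy, hy', map_add, mul_add]
    | @homogeneous j y =>
      rcases Nat.eq_zero_or_pos i with rfl | hi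
      · obtain ⟨c, hc⟩ := Submodule.mem_span_singleton.1 (hH.connected.le x.2)
        rw [← hc, smul_mul_assoc, one_mul, map_smul, map_smul, hH.counit_one]
        simp
      · rw [hH.counit_graded (i + j) (by omega) _ (SetLike.mul_mem_graded x.2 y.2),
          hH.counit_graded i hi _ x.2, zero_mul]

section Basis

variable {ι : Type*} [Fintype ι] {b : Module.Basis ι ℝ H} {deg : ι → ℕ}

theorem repr_mul_eq_zero (hb : IsHomogeneousBasis 𝒜 N b deg) {l m k : ι}
    (h : deg k ≠ deg l + deg m) : b.repr (b l * b m) k = 0 :=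
  hb.repr_eq_zero _ _ (SetLike.mul_mem_graded (hb.mem l) (hb.mem m)) k h

theorem repr_sub_counit_eq_zero (hH : IsTruncatedHopfAlgebra 𝒜 N)
    (hb : IsHomogeneousBasis 𝒜 N b deg) (x : H) {k : ι} (hk : deg k = 0) :
    b.repr (x - Coalgebra.counit (R := ℝ) x • (1 : H)) k = 0 := by
  induction x using DirectSum.Decomposition.inductionOn 𝒜 with
  | zero => simp
  | add x y hx hy =>
    have : x + y - Coalgebra.counit (R := ℝ) (x + y) • (1 : H) =
        (x - Coalgebra.counit (R := ℝ) x • (1 : H)) +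
          (y - Coalgebra.counit (R := ℝ) y • (1 : H)) := by
      rw [map_add, add_smul]; abel
    rw [this, map_add, Finsupp.add_apply, hx, hy, add_zero]
  | @homogeneous i x =>
    rcases Nat.eq_zero_or_pos i with rfl | hi
    · obtain ⟨c, hc⟩ := Submodule.mem_span_singleton.1 (hH.connected.le x.2)
      rw [← hc, map_smul, hH.counit_one]
      simp
    · rw [hH.counit_graded i hi _ x.2, zero_smul, sub_zero]
      exact hb.repr_eq_zero i _ x.2 k (by omega)

theorem repr_map_eq_sum (A : H →ₗ[ℝ] H) (x : H) (k : ι) :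
    b.repr (A x) k = ∑ m, b.repr x m * b.repr (A (b m)) k := by
  conv_lhs => rw [← b.sum_repr x, map_sum, map_sum, Finsupp.finsetSum_apply]
  simp only [map_smul, Finsupp.smul_apply, smul_eq_mul]

end Basis

/-! ### Translation operators -/

/-- The contraction `x ⊗ y ↦ f x • y` of the left factor of `H ⊗ H`. -/
def contract (f : Module.Dual ℝ H) : H ⊗[ℝ] H →ₗ[ℝ] H :=
  (TensorProduct.lid ℝ H).toLinearMap ∘ₗ LinearMap.rTensor H f

@[simp]
theorem contract_tmul (f : Module.Dual ℝ H) (x y : H) : contract f (x ⊗ₜ[ℝ] y) = f x • y := by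
  simp [contract]

/-- The transpose `(f ⊗ id) ∘ Δ` of `h ↦ f ⋆ h`. -/
def translate (f : Module.Dual ℝ H) : H →ₗ[ℝ] H := contract f ∘ₗ Coalgebra.comul

theorem translate_apply (f : Module.Dual ℝ H) (x : H) :
    translate f x = contract f (Coalgebra.comul x) := rfl

theorem conv_apply (f h : Module.Dual ℝ H) (x : H) : conv f h x = h (translate f x) := by
  have : ∀ u : H ⊗[ℝ] H, LinearMap.mul' ℝ ℝ (TensorProduct.map f h u) = h (contract f u) := by
    intro u
    induction u with
    | zero => simp
    | tmul x y => simp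
    | add u v hu hv => simp only [map_add, hu, hv]
  exact this _

theorem counit_translate (f : Module.Dual ℝ H) (x : H) :
    Coalgebra.counit (R := ℝ) (translate f x) = f x := by
  have : ∀ u : H ⊗[ℝ] H, Coalgebra.counit (R := ℝ) (contract f u) =
      LinearMap.mul' ℝ ℝ (TensorProduct.map f LinearMap.id
        (LinearMap.lTensor H (Coalgebra.counit (R := ℝ)) u)) := by
    intro u
    induction u with
    | zero => simp
    | tmul x y => simp
    | add u v hu hv => simp only [map_add, hu, hv]
  rw [translate_apply, this, Coalgebra.lTensor_counit_comul]
  simp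

theorem translate_conv (f g : Module.Dual ℝ H) (x : H) :
    translate (conv f g) x = translate g (translate f x) := by
  let C : H ⊗[ℝ] (H ⊗[ℝ] H) →ₗ[ℝ] H :=
    (TensorProduct.lid ℝ H).toLinearMap ∘ₗ TensorProduct.map f (contract g)
  have h1 : ∀ u : H ⊗[ℝ] H, translate g (contract f u) =
      C (LinearMap.lTensor H (Coalgebra.comul (R := ℝ)) u) := by
    intro u
    induction u with
    | zero => simp
    | tmul x y => simp [C, translate_apply]
    | add u v hu hv => simp only [map_add, hu, hv]
  have h2 : ∀ (v : H ⊗[ℝ] H) (y : H), C (TensorProduct.assoc ℝ H H H (v ⊗ₜ[ℝ] y)) =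
      LinearMap.mul' ℝ ℝ (TensorProduct.map f g v) • y := by
    intro v y
    induction v with
    | zero => simp
    | tmul x z => simp [C, mul_smul, smul_comm (g z)]
    | add u v hu hv => simp only [map_add, hu, hv, TensorProduct.add_tmul, add_smul]
  have h3 : ∀ u : H ⊗[ℝ] H, contract (conv f g) u =
      C (TensorProduct.assoc ℝ H H H (LinearMap.rTensor H (Coalgebra.comul (R := ℝ)) u)) := by
    intro u
    induction u with
    | zero => simp
    | tmul x y => rw [LinearMap.rTensor_tmul, h2, contract_tmul]; rfl
    | add u v hu hv => simp only [map_add, hu, hv]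
  rw [translate_apply f, h1, translate_apply (conv f g), h3, Coalgebra.coassoc_apply]

theorem comul_one (hH : IsTruncatedHopfAlgebra 𝒜 N) :
    Coalgebra.comul (R := ℝ) (1 : H) = (1 : H) ⊗ₜ[ℝ] (1 : H) := by
  have h := hH.comul_graded 0 1 (SetLike.one_mem_graded 𝒜)
  have hle : (⨆ (p : ℕ) (q : ℕ) (_ : p + q = 0), tensorDeg 𝒜 p q) ≤
      Submodule.span ℝ {(1 : H) ⊗ₜ[ℝ] (1 : H)} := by
    refine iSup_le fun p => iSup_le fun q => iSup_le fun hpq => ?_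
    obtain ⟨rfl, rfl⟩ : p = 0 ∧ q = 0 := by omega
    rw [tensorDeg, hH.connected, Submodule.map₂_span_span]
    simp
  obtain ⟨c, hc⟩ := Submodule.mem_span_singleton.1 (hle h)
  have h1 := counit_translate (Coalgebra.counit (R := ℝ)) (1 : H)
  rw [translate_apply, ← hc, map_smul, contract_tmul, hH.counit_one, map_smul, map_smul,
    hH.counit_one] at h1
  have : c = 1 := by simpa using h1
  rw [← hc, this, one_smul]

theorem translate_one (hH : IsTruncatedHopfAlgebra 𝒜 N) (f : Module.Dual ℝ H) :
    translate f (1 : H) = f 1 • (1 : H) := by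
  rw [translate_apply, comul_one hH, contract_tmul]

theorem translate_cocycle {d : ℕ} {L : Fin d → H →ₗ[ℝ] H} (hL : IsCocycleFamily 𝒜 N L) (i : Fin d)
    (f : Module.Dual ℝ H) {n : ℕ} (hn : n < N) {x : H} (hx : x ∈ 𝒜 n) :
    translate f (L i x) = L i (translate f x) + f (L i x) • (1 : H) := by
  have : ∀ u : H ⊗[ℝ] H, contract f (TensorProduct.map LinearMap.id (L i) u) =
      L i (contract f u) := by
    intro u
    induction u with
    | zero => simp
    | tmul x y => simp
    | add u v hu hv => simp only [map_add, hu, hv]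
  rw [translate_apply, hL.cocycle i n hn x hx, map_add, this, contract_tmul]
  rfl

/-! ### Orders of magnitude of translations -/

/-- A family of truncated characters whose values on elements of degree `n` are of order `r ^ n`,
the scale `r` being bounded. Orders of magnitude are uniform over the whole parameter set `α`, that
is, they are taken along the filter `⊤`. -/
structure IsScaledCharacter {α : Type*} (𝒜 : ℕ → Submodule ℝ H) (N : ℕ) (r : α → ℝ)
    (f : α → Module.Dual ℝ H) : Prop where
  bdd : r =O[⊤] fun _ => (1 : ℝ)
  character : ∀ a, IsTruncatedCharacter 𝒜 N (f a)
  order : ∀ n, ∀ x ∈ 𝒜 n, (fun a => f a x) =O[⊤] fun a => r a ^ n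

theorem isBigO_of_eq_zero {α E : Type*} [NormedAddCommGroup E] {u : α → E} {v : α → ℝ}
    (h : ∀ a, u a = 0) : u =O[⊤] v := by
  rw [show u = fun _ => 0 from funext h]
  exact isBigO_zero _ _

theorem pow_isBigO {α : Type*} {r : α → ℝ} (hr : r =O[⊤] fun _ => (1 : ℝ)) {m n : ℕ}
    (h : m ≤ n) : (fun a => r a ^ n) =O[⊤] fun a => r a ^ m := by
  obtain ⟨k, rfl⟩ := Nat.exists_eq_add_of_le h
  have := (isBigO_refl (fun a => r a ^ m) ⊤).mul (hr.pow k)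
  simpa [pow_add] using this

variable {ι : Type*} [Fintype ι] {b : Module.Basis ι ℝ H} {deg : ι → ℕ}
  {α : Type*} {r : α → ℝ} {f : α → Module.Dual ℝ H}

theorem contract_isBigO (hb : IsHomogeneousBasis 𝒜 N b deg) (hf : IsScaledCharacter 𝒜 N r f) {n : ℕ}
    {u : H ⊗[ℝ] H} (hu : u ∈ ⨆ (p : ℕ) (q : ℕ) (_ : n ≤ p + q), tensorDeg 𝒜 p q) (k : ι) :
    (fun a => b.repr (contract (f a) u) k) =O[⊤] fun a => r a ^ (n - deg k) := by
  let S : Submodule ℝ (H ⊗[ℝ] H) :=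
    { carrier := {u | (fun a => b.repr (contract (f a) u) k) =O[⊤] fun a => r a ^ (n - deg k)}
      zero_mem' := isBigO_of_eq_zero fun a => by simp
      add_mem' := fun {u v} hu hv => by
        simpa using (show _ =O[⊤] _ from hu).add hv
      smul_mem' := fun c u hu => by
        simpa using IsBigO.const_mul_left (show _ =O[⊤] _ from hu) c }
  suffices h : (⨆ (p : ℕ) (q : ℕ) (_ : n ≤ p + q), tensorDeg 𝒜 p q) ≤ S from h hu
  refine iSup_le fun p => iSup_le fun q => iSup_le fun hpq => ?_
  rw [tensorDeg, Submodule.map₂_le]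
  intro x hx y hy
  change (fun a => b.repr (contract (f a) (x ⊗ₜ[ℝ] y)) k) =O[⊤] _
  simp only [contract_tmul, map_smul, Finsupp.smul_apply, smul_eq_mul]
  by_cases hk : deg k = q
  · have h1 := (hf.order p x hx).trans (pow_isBigO hf.bdd (show n - deg k ≤ p by omega))
    simpa [mul_comm] using h1.const_mul_left (b.repr y k)
  · exact isBigO_of_eq_zero fun a => by rw [hb.repr_eq_zero q y hy k hk, mul_zero]

theorem translate_isBigO (hH : IsTruncatedHopfAlgebra 𝒜 N) (hb : IsHomogeneousBasis 𝒜 N b deg)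
    (hf : IsScaledCharacter 𝒜 N r f) {n : ℕ} {x : H} (hx : x ∈ 𝒜 n) (k : ι) :
    (fun a => b.repr (translate (f a) x) k) =O[⊤] fun a => r a ^ (n - deg k) := by
  refine contract_isBigO hb hf ?_ k
  refine (iSup_mono fun p => iSup_mono fun q => ?_ :
    (⨆ (p : ℕ) (q : ℕ) (_ : p + q = n), tensorDeg 𝒜 p q) ≤ _) (hH.comul_graded n x hx)
  exact iSup_le fun h => le_iSup_of_le h.ge le_rfl

theorem character_defect_isBigO (hf : IsScaledCharacter 𝒜 N r f) (x y : H) :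
    (fun a => f a x * f a y - f a (x * y)) =O[⊤] fun a => r a ^ (N + 1) := by
  induction x using DirectSum.Decomposition.inductionOn 𝒜 with
  | zero => exact isBigO_of_eq_zero fun a => by simp
  | add x x' hx hx' =>
    refine (hx.add hx').congr_left fun a => ?_
    rw [add_mul, map_add, map_add]; ring
  | @homogeneous i x =>
    induction y using DirectSum.Decomposition.inductionOn 𝒜 with
    | zero => exact isBigO_of_eq_zero fun a => by simp
    | add x x' hx hx' =>
      refine (hx.add hx').congr_left fun a => ?_
      rw [mul_add, map_add, map_add]; ring
    | @homogeneous j y =>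
      by_cases h : i + j ≤ N
      · refine (isBigO_zero _ _).congr_left fun a => ?_
        rw [(hf.character a).map_mul i j h x x.2 y y.2, sub_self]
      · have h1 := (hf.order i x x.2).mul (hf.order j y y.2)
        have h2 := hf.order (i + j) _ (SetLike.mul_mem_graded x.2 y.2)
        simp only [← pow_add] at h1
        exact (h1.sub h2).trans (pow_isBigO hf.bdd (by omega))

/-- Translations are multiplicative up to terms that the truncation makes negligible. -/
theorem translate_mul_isBigO (hH : IsTruncatedHopfAlgebra 𝒜 N)
    (hb : IsHomogeneousBasis 𝒜 N b deg) (hf : IsScaledCharacter 𝒜 N r f) (x y : H) (k : ι) :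
    (fun a => b.repr (translate (f a) x * translate (f a) y - translate (f a) (x * y)) k) =O[⊤]
      fun a => r a ^ (N + 1 - deg k) := by
  have h1 : ∀ u v : H ⊗[ℝ] H,
      (fun a => b.repr (contract (f a) u * contract (f a) v - contract (f a) (u * v)) k) =O[⊤]
        fun a => r a ^ (N + 1 - deg k) := by
    intro u v
    induction u with
    | zero => exact isBigO_of_eq_zero fun a => by simp
    | add u u' hu hu' =>
      refine (hu.add hu').congr_left fun a => ?_
      rw [← Finsupp.add_apply, ← map_add b.repr, add_mul, map_add (contract (f a)),
        map_add (contract (f a)), add_mul]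
      congr 2; ring
    | tmul x y =>
      induction v with
      | zero => exact isBigO_of_eq_zero fun a => by simp
      | add u u' hu hu' =>
        refine (hu.add hu').congr_left fun a => ?_
        rw [← Finsupp.add_apply, ← map_add b.repr, mul_add, map_add (contract (f a)),
          map_add (contract (f a)), mul_add]
        congr 2; ring
      | tmul z w =>
        have h := ((character_defect_isBigO hf x z).const_mul_left (b.repr (y * w) k)).trans
          (pow_isBigO hf.bdd (Nat.sub_le (N + 1) (deg k)))
        refine h.congr_left fun a => ?_
        rw [Algebra.TensorProduct.tmul_mul_tmul, contract_tmul, contract_tmul, contract_tmul,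
          smul_mul_smul_comm, ← sub_smul, map_smul, Finsupp.smul_apply, smul_eq_mul, mul_comm]
  have h2 := contract_isBigO hb hf (hH.compat x y) k
  refine ((h1 (Coalgebra.comul x) (Coalgebra.comul y)).sub h2).congr_left fun a => ?_
  rw [← Finsupp.sub_apply, ← map_sub, map_sub (contract (f a))]
  simp only [translate_apply]
  congr 2; ring

/-- The cocycle identity `Γ L = L Γ + (f ∘ L) 1` holds up to terms that come from the top degree. -/
theorem translate_cocycle_isBigO (hH : IsTruncatedHopfAlgebra 𝒜 N)
    (hb : IsHomogeneousBasis 𝒜 N b deg) (hf : IsScaledCharacter 𝒜 N r f) {d : ℕ}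
    {L : Fin d → H →ₗ[ℝ] H} (hL : IsCocycleFamily 𝒜 N L) (i : Fin d) (x : H) (k : ι) :
    (fun a => b.repr (L i (translate (f a) x) - translate (f a) (L i x) +
      f a (L i x) • (1 : H)) k) =O[⊤] fun a => r a ^ (N + 1 - deg k) := by
  induction x using DirectSum.Decomposition.inductionOn 𝒜 with
  | zero => exact isBigO_of_eq_zero fun a => by simp
  | add x y hx hy =>
    refine (hx.add hy).congr_left fun a => ?_
    rw [← Finsupp.add_apply, ← map_add b.repr]
    congr 2
    simp only [map_add, add_smul]
    abel
  | @homogeneous n x =>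
    by_cases hn : n < N
    · refine (isBigO_zero _ _).congr_left fun a => ?_
      rw [translate_cocycle hL i (f a) hn x.2]
      simp
    · have h0 : L i x = 0 := by
        have h := hL.degree_one i n x x.2
        rw [hH.truncated (n + 1) (by omega)] at h
        simpa using h
      have hsum : ∀ a, b.repr (L i (translate (f a) x) - translate (f a) (L i x) +
          f a (L i x) • (1 : H)) k =
          ∑ m, b.repr (translate (f a) x) m * b.repr (L i (b m)) k := by
        intro a
        rw [h0, map_zero, map_zero, sub_zero, zero_smul, add_zero]
        exact repr_map_eq_sum (L i) _ k
      simp only [hsum]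
      refine IsBigO.fun_sum fun m _ => ?_
      by_cases hk : deg k = deg m + 1
      · have h1 := (translate_isBigO hH hb hf x.2 m).trans
          (pow_isBigO hf.bdd (show N + 1 - deg k ≤ n - deg m by omega))
        simpa [mul_comm] using h1.const_mul_left (b.repr (L i (b m)) k)
      · exact isBigO_of_eq_zero fun a => by
          rw [hb.repr_eq_zero _ _ (hL.degree_one i _ _ (hb.mem m)) k hk, mul_zero]

end Algebra

/-! ### Pairs of families: bounds together with Lipschitz bounds -/

section Orders

open Asymptotics Filter

variable {α E : Type*} [NormedAddCommGroup E]

/-- Two families `u · true` and `u · false` of vectors are of order `g`, and their difference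
is of order `δ g`. Bounds and Lipschitz estimates are thus propagated together. -/
def Ord (δ g : α → ℝ) (u : α → Bool → E) : Prop :=
  (∀ i, (fun a => u a i) =O[⊤] g) ∧ (fun a => u a true - u a false) =O[⊤] fun a => δ a * g a

variable {δ g g' : α → ℝ} {u v : α → Bool → E}

theorem Ord.add (hu : Ord δ g u) (hv : Ord δ g v) : Ord δ g fun a i => u a i + v a i :=
  ⟨fun i => (hu.1 i).add (hv.1 i), (hu.2.add hv.2).congr_left fun _ => (add_sub_add_comm _ _ _ _).symm⟩

theorem Ord.neg (hu : Ord δ g u) : Ord δ g fun a i => -u a i :=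
  ⟨fun i => (hu.1 i).neg_left, hu.2.neg_left.congr_left fun a => by rw [neg_sub, neg_sub_neg]⟩

theorem Ord.sub (hu : Ord δ g u) (hv : Ord δ g v) : Ord δ g fun a i => u a i - v a i := by
  simpa only [sub_eq_add_neg] using hu.add hv.neg

theorem Ord.mul {u v : α → Bool → ℝ} (hu : Ord δ g u) (hv : Ord δ g' v) :
    Ord δ (fun a => g a * g' a) fun a i => u a i * v a i := by
  refine ⟨fun i => (hu.1 i).mul (hv.1 i), ?_⟩
  have h1 := (hu.2.mul (hv.1 true)).congr_right
    (g₂ := fun a => δ a * (g a * g' a)) fun a => by ring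
  have h2 := ((hu.1 false).mul hv.2).congr_right
    (g₂ := fun a => δ a * (g a * g' a)) fun a => by ring
  exact (h1.add h2).congr_left fun a => by ring

theorem Ord.mono (hu : Ord δ g u) (h : g =O[⊤] g') : Ord δ g' u :=
  ⟨fun i => (hu.1 i).trans h, hu.2.trans ((isBigO_refl δ ⊤).mul h)⟩

theorem Ord.of_isBigO {w : α → E} (h : w =O[⊤] g) : Ord δ g fun a _ => w a :=
  ⟨fun _ => h, isBigO_of_eq_zero fun a => by rw [sub_self]⟩

theorem Ord.of_eq_zero (h : ∀ a i, u a i = 0) : Ord δ g u :=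
  ⟨fun i => isBigO_of_eq_zero fun a => h a i, isBigO_of_eq_zero fun a => by rw [h, h, sub_self]⟩

theorem Ord.congr (hu : Ord δ g u) (h : ∀ a i, u a i = v a i) : Ord δ g v := by
  have : u = v := funext fun a => funext fun i => h a i
  rwa [← this]

theorem Ord.sum {κ : Type*} {s : Finset κ} {u : κ → α → Bool → E} (h : ∀ m ∈ s, Ord δ g (u m)) :
    Ord δ g fun a i => ∑ m ∈ s, u m a i :=
  ⟨fun i => IsBigO.fun_sum fun m hm => (h m hm).1 i,
    (IsBigO.fun_sum fun m hm => (h m hm).2).congr_left fun a => by rw [Finset.sum_sub_distrib]⟩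

variable {H : Type*} [CommRing H] [Algebra ℝ H] [Coalgebra ℝ H] {ι : Type*} [Fintype ι]

/-- The coordinate of index `k` of the pair of families `x` in `H` is of order `w k`. -/
def HOrd (b : Module.Basis ι ℝ H) (δ : α → ℝ) (w : ι → α → ℝ) (x : α → Bool → H) : Prop :=
  ∀ k, Ord δ (w k) fun a i => b.repr (x a i) k

variable {b : Module.Basis ι ℝ H} {w w' w'' : ι → α → ℝ} {x y : α → Bool → H}

theorem HOrd.add (hx : HOrd b δ w x) (hy : HOrd b δ w y) : HOrd b δ w fun a i => x a i + y a i :=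
  fun k => ((hx k).add (hy k)).congr fun a i => by simp

theorem HOrd.sub (hx : HOrd b δ w x) (hy : HOrd b δ w y) : HOrd b δ w fun a i => x a i - y a i :=
  fun k => ((hx k).sub (hy k)).congr fun a i => by simp

theorem HOrd.congr (hx : HOrd b δ w x) (h : ∀ a i, x a i = y a i) : HOrd b δ w y :=
  fun k => (hx k).congr fun a i => by rw [h]

theorem HOrd.sum {κ : Type*} {s : Finset κ} {x : κ → α → Bool → H}
    (h : ∀ m ∈ s, HOrd b δ w (x m)) : HOrd b δ w fun a i => ∑ m ∈ s, x m a i :=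
  fun k => (Ord.sum fun m hm => h m hm k).congr fun a i => by
    rw [map_sum, Finsupp.finsetSum_apply]

theorem HOrd.smul {c : α → Bool → ℝ} (hc : Ord δ g c) (hx : HOrd b δ w x) :
    HOrd b δ (fun k a => g a * w k a) fun a i => c a i • x a i :=
  fun k => (hc.mul (hx k)).congr fun a i => by simp

theorem HOrd.mono (hx : HOrd b δ w x) (h : ∀ k, w k =O[⊤] w' k) : HOrd b δ w' x :=
  fun k => (hx k).mono (h k)

theorem HOrd.map {A : α → H →ₗ[ℝ] H} (hx : HOrd b δ w x)
    (hA : ∀ l k, (fun a => w l a * b.repr (A a (b l)) k) =O[⊤] w' k) :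
    HOrd b δ w' fun a i => A a (x a i) := by
  intro k
  refine (Ord.sum (s := Finset.univ) fun l _ => ((hx l).mul (Ord.of_isBigO (δ := δ)
    (isBigO_refl (fun a => b.repr (A a (b l)) k) ⊤))).mono (hA l k)).congr fun a i => ?_
  exact (repr_map_eq_sum (A a) (x a i) k).symm

theorem HOrd.map₂ {B : α → H →ₗ[ℝ] H →ₗ[ℝ] H} (hx : HOrd b δ w x) (hy : HOrd b δ w' y)
    (hB : ∀ l m k, (fun a => w l a * w' m a * b.repr (B a (b l) (b m)) k) =O[⊤] w'' k) :
    HOrd b δ w'' fun a i => B a (x a i) (y a i) := by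
  intro k
  refine (Ord.sum (s := Finset.univ) fun l _ => Ord.sum (s := Finset.univ) fun m _ =>
    (((hx l).mul (hy m)).mul (Ord.of_isBigO (δ := δ)
      (isBigO_refl (fun a => b.repr (B a (b l) (b m)) k) ⊤))).mono (hB l m k)).congr fun a i => ?_
  rw [repr_map_eq_sum (B a (x a i)) (y a i) k, Finset.sum_comm]
  refine Finset.sum_congr rfl fun m _ => ?_
  have := repr_map_eq_sum ((B a).flip (b m)) (x a i) k (b := b)
  simp only [LinearMap.flip_apply] at this
  rw [this, Finset.mul_sum]
  exact Finset.sum_congr rfl fun l _ => by ring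

/-- The pair of families `x` is bounded, and Lipschitz in the parameter `δ`. -/
def Bdd (b : Module.Basis ι ℝ H) (δ : α → ℝ) (x : α → Bool → H) : Prop :=
  HOrd b δ (fun _ _ => 1) x

/-- The pair of families `x` has the size of a remainder of controlled paths: its components of
degree `j` are of order `r ^ (N - j)`. -/
def Rem (b : Module.Basis ι ℝ H) (deg : ι → ℕ) (N : ℕ) (r δ : α → ℝ) (x : α → Bool → H) : Prop :=
  HOrd b δ (fun k a => r a ^ (N - deg k)) x

variable {𝒜 : ℕ → Submodule ℝ H} [GradedAlgebra 𝒜] {N : ℕ} {deg : ι → ℕ} {r : α → ℝ}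
  {f : α → Module.Dual ℝ H}

theorem Bdd.const (z : H) : Bdd b δ fun _ _ => z :=
  fun _ => Ord.of_isBigO (isBigO_const_const _ one_ne_zero _)

theorem Bdd.smul {c : α → Bool → ℝ} (hc : Ord δ (fun _ => 1) c) (hx : Bdd b δ x) :
    Bdd b δ fun a i => c a i • x a i :=
  (HOrd.smul hc hx).mono fun k => (isBigO_refl _ _).congr_left fun a => by simp

theorem Rem.smul {c : α → Bool → ℝ} (hc : Ord δ (fun _ => 1) c) (hx : Rem b deg N r δ x) :
    Rem b deg N r δ fun a i => c a i • x a i :=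
  (HOrd.smul hc hx).mono fun k => (isBigO_refl _ _).congr_left fun a => by simp

theorem Bdd.mul (hx : Bdd b δ x) (hy : Bdd b δ y) : Bdd b δ fun a i => x a i * y a i :=
  HOrd.map₂ (B := fun _ => LinearMap.mul ℝ H) hx hy fun _ _ _ =>
    isBigO_const_const _ one_ne_zero _

theorem Bdd.prod {κ : Type*} {s : Finset κ} {x : κ → α → Bool → H}
    (h : ∀ m ∈ s, Bdd b δ (x m)) : Bdd b δ fun a i => ∏ m ∈ s, x m a i := by
  classical
  induction s using Finset.induction_on with
  | empty => simpa using Bdd.const (1 : H)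
  | insert m s hm ih =>
    simp only [Finset.prod_insert hm]
    exact (h m (Finset.mem_insert_self _ _)).mul
      (ih fun l hl => h l (Finset.mem_insert_of_mem hl))

theorem Bdd.pow (hx : Bdd b δ x) (n : ℕ) : Bdd b δ fun a i => x a i ^ n := by
  simpa using Bdd.prod (s := Finset.range n) fun _ _ => hx

/-- A fixed linear form sends bounded pairs to bounded pairs. -/
theorem Bdd.apply (hx : Bdd b δ x) (h : Module.Dual ℝ H) :
    Ord δ (fun _ => 1) fun a i => h (x a i) := by
  refine (Ord.sum (s := Finset.univ) fun l _ => ((hx l).mul (Ord.of_isBigO (δ := δ) (g := fun _ => 1)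
    (isBigO_const_const (h (b l)) one_ne_zero ⊤))).mono
      ((isBigO_refl _ _).congr_left fun a => by simp)).congr fun a i => ?_
  conv_rhs => rw [← b.sum_repr (x a i), map_sum]
  simp

theorem Rem.mul (hb : IsHomogeneousBasis 𝒜 N b deg) (hf : IsScaledCharacter 𝒜 N r f)
    (hx : Rem b deg N r δ x) (hy : Bdd b δ y) : Rem b deg N r δ fun a i => x a i * y a i := by
  refine HOrd.map₂ (B := fun _ => LinearMap.mul ℝ H) hx hy fun l m k => ?_
  by_cases hk : deg k = deg l + deg m
  · have := (pow_isBigO hf.bdd (show N - deg k ≤ N - deg l by omega)).const_mul_left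
      (b.repr (b l * b m) k)
    exact this.congr_left fun a => by simp [mul_comm]
  · exact isBigO_of_eq_zero fun a => by
      rw [LinearMap.mul_apply', repr_mul_eq_zero hb hk, mul_zero]

theorem Bdd.translate (hH : IsTruncatedHopfAlgebra 𝒜 N) (hb : IsHomogeneousBasis 𝒜 N b deg)
    (hf : IsScaledCharacter 𝒜 N r f) (hx : Bdd b δ x) :
    Bdd b δ fun a i => translate (f a) (x a i) := by
  refine HOrd.map (A := fun a => HopfRough.translate (f a)) hx fun l k => ?_
  have := (translate_isBigO hH hb hf (hb.mem l) k).trans (pow_isBigO hf.bdd (Nat.zero_le _))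
  simpa using this

/-- The multiplicativity defect of translations has the size of a remainder. -/
theorem Rem.translate_mul (hH : IsTruncatedHopfAlgebra 𝒜 N) (hb : IsHomogeneousBasis 𝒜 N b deg)
    (hf : IsScaledCharacter 𝒜 N r f) (hx : Bdd b δ x) (hy : Bdd b δ y) :
    Rem b deg N r δ fun a i =>
      translate (f a) (x a i) * translate (f a) (y a i) - translate (f a) (x a i * y a i) := by
  let B : α → H →ₗ[ℝ] H →ₗ[ℝ] H := fun a =>
    (LinearMap.mul ℝ H).compl₁₂ (translate (f a)) (translate (f a)) -
      (LinearMap.mul ℝ H).compr₂ (translate (f a))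
  refine (HOrd.map₂ (B := B) hx hy fun l m k => ?_ : Rem b deg N r δ fun a i => B a _ _)
  have := (translate_mul_isBigO hH hb hf (b l) (b m) k).trans
    (pow_isBigO hf.bdd (show N - deg k ≤ N + 1 - deg k by omega))
  simpa [B] using this

/-- `y` is the increment of `x` up to a remainder: `x` and `y` are bounded and `y - Γ x` has the
size of a remainder of controlled paths. -/
structure Ctrl (b : Module.Basis ι ℝ H) (deg : ι → ℕ) (N : ℕ) (r δ : α → ℝ)
    (f : α → Module.Dual ℝ H) (x y : α → Bool → H) : Prop where
  left : Bdd b δ x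
  right : Bdd b δ y
  rem : Rem b deg N r δ fun a i => y a i - translate (f a) (x a i)

variable {x' y' : α → Bool → H}

theorem Ctrl.sub (h : Ctrl b deg N r δ f x y) (h' : Ctrl b deg N r δ f x' y') :
    Ctrl b deg N r δ f (fun a i => x a i - x' a i) fun a i => y a i - y' a i :=
  ⟨HOrd.sub h.left h'.left, HOrd.sub h.right h'.right, (HOrd.sub h.rem h'.rem).congr fun a i => by
    rw [map_sub]; abel⟩

theorem Ctrl.smul {c : α → Bool → ℝ} (hc : Ord δ (fun _ => 1) c) (h : Ctrl b deg N r δ f x y) :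
    Ctrl b deg N r δ f (fun a i => c a i • x a i) fun a i => c a i • y a i :=
  ⟨h.left.smul hc, h.right.smul hc, (h.rem.smul hc).congr fun a i => by
    rw [map_smul, smul_sub]⟩

theorem Ctrl.one (hH : IsTruncatedHopfAlgebra 𝒜 N) (hf : IsScaledCharacter 𝒜 N r f) :
    Ctrl b deg N r δ f (fun _ _ => 1) fun _ _ => 1 :=
  ⟨Bdd.const 1, Bdd.const 1, fun k => Ord.of_eq_zero fun a i => by
    change b.repr (1 - translate (f a) 1) k = 0
    rw [translate_one hH, (hf.character a).map_one, one_smul, sub_self, map_zero,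
      Finsupp.zero_apply]⟩

theorem Ctrl.sum {κ : Type*} {s : Finset κ} {x y : κ → α → Bool → H}
    (h : ∀ m ∈ s, Ctrl b deg N r δ f (x m) (y m)) :
    Ctrl b deg N r δ f (fun a i => ∑ m ∈ s, x m a i) fun a i => ∑ m ∈ s, y m a i :=
  ⟨HOrd.sum fun m hm => (h m hm).left, HOrd.sum fun m hm => (h m hm).right,
    (HOrd.sum fun m hm => (h m hm).rem).congr fun a i => by
      rw [map_sum, Finset.sum_sub_distrib]⟩

/-- Controlled families form an algebra. -/
theorem Ctrl.mul (hH : IsTruncatedHopfAlgebra 𝒜 N) (hb : IsHomogeneousBasis 𝒜 N b deg)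
    (hf : IsScaledCharacter 𝒜 N r f) (h : Ctrl b deg N r δ f x y)
    (h' : Ctrl b deg N r δ f x' y') :
    Ctrl b deg N r δ f (fun a i => x a i * x' a i) fun a i => y a i * y' a i := by
  refine ⟨h.left.mul h'.left, h.right.mul h'.right, ?_⟩
  have h1 := h.rem.mul hb hf h'.right
  have h2 := h'.rem.mul hb hf (h.left.translate hH hb hf)
  have h3 := Rem.translate_mul hH hb hf h.left h'.left
  exact ((HOrd.add h1 h2).add h3).congr fun a i => by ring

theorem Ctrl.prod (hH : IsTruncatedHopfAlgebra 𝒜 N) (hb : IsHomogeneousBasis 𝒜 N b deg)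
    (hf : IsScaledCharacter 𝒜 N r f) {κ : Type*} {s : Finset κ} {x y : κ → α → Bool → H}
    (h : ∀ m ∈ s, Ctrl b deg N r δ f (x m) (y m)) :
    Ctrl b deg N r δ f (fun a i => ∏ m ∈ s, x m a i) fun a i => ∏ m ∈ s, y m a i := by
  classical
  induction s using Finset.induction_on with
  | empty => simpa using Ctrl.one hH hf
  | insert m s hm ih =>
    simp only [Finset.prod_insert hm]
    exact (h m (Finset.mem_insert_self _ _)).mul hH hb hf
      (ih fun l hl => h l (Finset.mem_insert_of_mem hl))

end Orders

/-! ### Taylor expansions with Lipschitz remainders -/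

section Taylor

open Asymptotics Filter

variable {V W : Type*} [NormedAddCommGroup V] [NormedSpace ℝ V] [NormedAddCommGroup W]
  [NormedSpace ℝ W]

theorem iteratedDeriv_comp_line {φ : V → W} {M : ℕ} (hφ : ContDiff ℝ M φ) (z x : V) {n : ℕ}
    (hn : n ≤ M) (t : ℝ) : iteratedDeriv n (fun s : ℝ => φ (z + s • x)) t =
      iteratedFDeriv ℝ n φ (z + t • x) fun _ => x := by
  induction n generalizing t with
  | zero => simp
  | succ n ih =>
    have h1 : iteratedDeriv n (fun s : ℝ => φ (z + s • x)) =
        fun s => iteratedFDeriv ℝ n φ (z + s • x) fun _ => x :=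
      funext fun s => ih (by omega) s
    rw [iteratedDeriv_succ, h1]
    have h2 : HasFDerivAt (iteratedFDeriv ℝ n φ)
        (fderiv ℝ (iteratedFDeriv ℝ n φ) (z + t • x)) (z + t • x) :=
      ((hφ.differentiable_iteratedFDeriv (by exact_mod_cast hn)) _).hasFDerivAt
    have h3 : HasDerivAt (fun s : ℝ => z + s • x) x t := by
      simpa using ((hasDerivAt_id t).smul_const x).const_add z
    have h4 := h2.comp_hasDerivAt t h3
    have h5 : HasDerivAt (fun s : ℝ => iteratedFDeriv ℝ n φ (z + s • x) fun _ => x)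
        (fderiv ℝ (iteratedFDeriv ℝ n φ) (z + t • x) x fun _ => x) t :=
      ((ContinuousMultilinearMap.apply ℝ (fun _ : Fin n => V) W fun _ => x).hasFDerivAt
        ).comp_hasDerivAt t h4
    rw [h5.deriv, iteratedFDeriv_succ_apply_left]
    rfl

/-- The remainder of the Taylor expansion of order `N` of `φ` at `z`. -/
def taylorRem (N : ℕ) (φ : V → W) (z x : V) : W :=
  φ (z + x) - ∑ n ∈ Finset.range (N + 1),
    (1 / (n.factorial : ℝ)) • iteratedFDeriv ℝ n φ z fun _ => x

/-- A difference of two Taylor remainders is, up to the terms of top order, the Taylor remainder of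
a difference of functions of one variable. -/
theorem norm_taylorRem_sub_le {n : ℕ} {φ : V → W} (hφ : ContDiff ℝ (n + 1 : ℕ) φ) (z z' x x' : V)
    {C : ℝ} (hC : ∀ t ∈ Set.Icc (0 : ℝ) 1,
      ‖(iteratedFDeriv ℝ (n + 1) φ (z + t • x) fun _ => x) -
        iteratedFDeriv ℝ (n + 1) φ (z' + t • x') fun _ => x'‖ ≤ C) :
    ‖taylorRem (n + 1) φ z x - taylorRem (n + 1) φ z' x'‖ ≤ 2 * C := by
  have hline : ∀ z x : V, ContDiff ℝ (n + 1 : ℕ) fun s : ℝ => φ (z + s • x) := fun z x =>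
    hφ.comp (contDiff_const.add (contDiff_id.smul contDiff_const))
  set h : ℝ → W := (fun s : ℝ => φ (z + s • x)) - fun s : ℝ => φ (z' + s • x') with hh
  have hcd : ContDiff ℝ (n + 1 : ℕ) h := (hline z x).sub (hline z' x')
  have hder : ∀ k ≤ n + 1, ∀ t ∈ Set.Icc (0 : ℝ) 1, iteratedDerivWithin k h (Set.Icc 0 1) t =
      (iteratedFDeriv ℝ k φ (z + t • x) fun _ => x) -
        iteratedFDeriv ℝ k φ (z' + t • x') fun _ => x' := by
    intro k hk t ht
    have hk' : ((k : ℕ) : WithTop ℕ∞) ≤ (n + 1 : ℕ) := by exact_mod_cast hk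
    rw [iteratedDerivWithin_eq_iteratedDeriv (uniqueDiffOn_Icc zero_lt_one)
      (hcd.of_le hk').contDiffAt ht, hh,
      iteratedDeriv_sub ((hline z x).of_le hk').contDiffAt ((hline z' x').of_le hk').contDiffAt,
      iteratedDeriv_comp_line hφ z x hk, iteratedDeriv_comp_line hφ z' x' hk]
  have hC0 : 0 ≤ C := (norm_nonneg _).trans (hC 0 ⟨le_rfl, zero_le_one⟩)
  have hT := taylor_mean_remainder_bound (f := h) (n := n) (x := 1) zero_le_one
    (by exact_mod_cast hcd.contDiffOn) ⟨zero_le_one, le_rfl⟩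
    fun t ht => (hder (n + 1) le_rfl t ht).symm ▸ hC t ht
  rw [taylor_within_apply, sub_zero, one_pow, mul_one] at hT
  have hsum : ∑ k ∈ Finset.range (n + 1), ((k.factorial : ℝ)⁻¹ * (1 : ℝ) ^ k) •
      iteratedDerivWithin k h (Set.Icc 0 1) 0 =
      (∑ k ∈ Finset.range (n + 1), (1 / (k.factorial : ℝ)) • iteratedFDeriv ℝ k φ z fun _ => x) -
      ∑ k ∈ Finset.range (n + 1), (1 / (k.factorial : ℝ)) •
        iteratedFDeriv ℝ k φ z' fun _ => x' := by
    rw [← Finset.sum_sub_distrib]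
    refine Finset.sum_congr rfl fun k hk => ?_
    rw [hder k (by have := Finset.mem_range.1 hk; omega) 0 ⟨le_rfl, zero_le_one⟩, ← smul_sub]
    simp
  rw [hsum] at hT
  have hfac : C / (n.factorial : ℝ) ≤ C :=
    div_le_self hC0 (by exact_mod_cast Nat.one_le_iff_ne_zero.2 n.factorial_ne_zero)
  have htop := hC 0 ⟨le_rfl, zero_le_one⟩
  rw [zero_smul, zero_smul, add_zero, add_zero] at htop
  have hfac' : ‖(1 / ((n + 1).factorial : ℝ)) • ((iteratedFDeriv ℝ (n + 1) φ z fun _ => x) -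
      iteratedFDeriv ℝ (n + 1) φ z' fun _ => x')‖ ≤ C := by
    rw [norm_smul, Real.norm_of_nonneg (by positivity)]
    refine (mul_le_of_le_one_left (norm_nonneg _) ?_).trans htop
    rw [div_le_one (by positivity)]
    exact_mod_cast Nat.one_le_iff_ne_zero.2 (n + 1).factorial_ne_zero
  have heq : taylorRem (n + 1) φ z x - taylorRem (n + 1) φ z' x' =
      (h 1 - ((∑ k ∈ Finset.range (n + 1), (1 / (k.factorial : ℝ)) •
        iteratedFDeriv ℝ k φ z fun _ => x) - ∑ k ∈ Finset.range (n + 1),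
          (1 / (k.factorial : ℝ)) • iteratedFDeriv ℝ k φ z' fun _ => x')) -
      (1 / ((n + 1).factorial : ℝ)) • ((iteratedFDeriv ℝ (n + 1) φ z fun _ => x) -
        iteratedFDeriv ℝ (n + 1) φ z' fun _ => x') := by
    rw [taylorRem, taylorRem, Finset.sum_range_succ _ (n + 1), Finset.sum_range_succ _ (n + 1), hh,
      smul_sub]
    simp only [Pi.sub_apply, one_smul]
    abel
  rw [heq]
  exact (norm_sub_le _ _).trans (by linarith)

theorem exists_lipschitz_closedBall [FiniteDimensional ℝ V] {g : V → W} (hg : ContDiff ℝ 1 g)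
    (R : ℝ) : ∃ K, 0 ≤ K ∧ (∀ x ∈ Metric.closedBall (0 : V) R, ‖g x‖ ≤ K) ∧
      ∀ x ∈ Metric.closedBall (0 : V) R, ∀ y ∈ Metric.closedBall (0 : V) R,
        ‖g x - g y‖ ≤ K * ‖x - y‖ := by
  have : ProperSpace V := FiniteDimensional.proper ℝ V
  have hc := isCompact_closedBall (0 : V) R
  obtain ⟨K₁, hK₁⟩ := hc.exists_bound_of_continuousOn hg.continuous.continuousOn
  obtain ⟨K₂, hK₂⟩ := hc.exists_bound_of_continuousOn
    (hg.continuous_fderiv one_ne_zero).continuousOn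
  refine ⟨max 0 (max K₁ K₂), le_max_left _ _, fun x hx => (hK₁ x hx).trans
    ((le_max_left _ _).trans (le_max_right _ _)), fun x hx y hy => ?_⟩
  refine (convex_closedBall (0 : V) R).norm_image_sub_le_of_norm_fderiv_le
    (fun z _ => (hg.differentiable one_ne_zero) z) (fun z hz => (hK₂ z hz).trans
      ((le_max_right _ _).trans (le_max_right _ _))) hy hx

theorem exists_taylorRem_bound [FiniteDimensional ℝ V] {N : ℕ} (hN : 1 ≤ N) {φ : V → W}
    (hφ : ContDiff ℝ (N + 1) φ) (R : ℝ) :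
    ∃ K, 0 ≤ K ∧ ∀ z z' x x' : V, ∀ m, ‖z‖ ≤ R → ‖z'‖ ≤ R → ‖x‖ ≤ m → ‖x'‖ ≤ m → m ≤ R →
      ‖taylorRem N φ z x - taylorRem N φ z' x'‖ ≤
        K * (m ^ N * ‖z - z'‖ + m ^ (N - 1) * ‖x - x'‖) := by
  obtain ⟨n, rfl⟩ : ∃ n, N = n + 1 := ⟨N - 1, by omega⟩
  have hD : ContDiff ℝ 1 (iteratedFDeriv ℝ (n + 1) φ) :=
    hφ.iteratedFDeriv_right (by push_cast; rw [add_comm])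
  obtain ⟨K, hK, hK1, hK2⟩ := exists_lipschitz_closedBall hD (R + R)
  refine ⟨2 * (K + K * |R| + K * (n + 1 : ℕ)), by positivity, ?_⟩
  intro z z' x x' m hz hz' hx hx' hmR
  have hm : 0 ≤ m := (norm_nonneg x).trans hx
  have hR : 0 ≤ R := hm.trans hmR
  rw [abs_of_nonneg hR, mul_assoc]
  refine norm_taylorRem_sub_le (by exact_mod_cast hφ.of_le (by simp)) z z' x x' fun t ht => ?_
  have hmem : ∀ z x : V, ‖z‖ ≤ R → ‖x‖ ≤ m → z + t • x ∈ Metric.closedBall (0 : V) (R + R) := by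
    intro z x hz hx
    rw [mem_closedBall_zero_iff]
    refine (norm_add_le _ _).trans (add_le_add hz ?_)
    rw [norm_smul, Real.norm_of_nonneg ht.1]
    exact (mul_le_of_le_one_left (norm_nonneg _) ht.2).trans (hx.trans hmR)
  set p := z + t • x with hp
  set p' := z' + t • x' with hp'
  have hpp : ‖p - p'‖ ≤ ‖z - z'‖ + ‖x - x'‖ := by
    have : p - p' = (z - z') + t • (x - x') := by rw [hp, hp', smul_sub]; abel
    rw [this]
    refine (norm_add_le _ _).trans (add_le_add le_rfl ?_)
    rw [norm_smul, Real.norm_of_nonneg ht.1]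
    exact mul_le_of_le_one_left (norm_nonneg _) ht.2
  have h1 : ‖(iteratedFDeriv ℝ (n + 1) φ p - iteratedFDeriv ℝ (n + 1) φ p') fun _ => x‖ ≤
      K * (‖z - z'‖ + ‖x - x'‖) * m ^ (n + 1) := by
    refine (ContinuousMultilinearMap.le_opNorm _ _).trans ?_
    rw [Finset.prod_const, Finset.card_univ, Fintype.card_fin]
    have := (hK2 p (hmem z x hz hx) p' (hmem z' x' hz' hx')).trans
      (mul_le_mul_of_nonneg_left hpp hK)
    gcongr
  have h2 : ‖(iteratedFDeriv ℝ (n + 1) φ p' fun _ => x) -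
      iteratedFDeriv ℝ (n + 1) φ p' fun _ => x'‖ ≤ K * (n + 1 : ℕ) * m ^ n * ‖x - x'‖ := by
    refine (ContinuousMultilinearMap.norm_image_sub_le _ _ _).trans ?_
    rw [Fintype.card_fin, Nat.add_sub_cancel]
    have e1 : ‖(fun _ : Fin (n + 1) => x) - fun _ : Fin (n + 1) => x'‖ = ‖x - x'‖ :=
      pi_norm_const (x - x')
    have e2 : max ‖fun _ : Fin (n + 1) => x‖ ‖fun _ : Fin (n + 1) => x'‖ ≤ m := by
      rw [pi_norm_const, pi_norm_const]
      exact max_le hx hx'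
    have e3 := hK1 p' (hmem z' x' hz' hx')
    rw [e1]
    gcongr
  have heq : (iteratedFDeriv ℝ (n + 1) φ p fun _ => x) -
      (iteratedFDeriv ℝ (n + 1) φ p' fun _ => x') =
      ((iteratedFDeriv ℝ (n + 1) φ p - iteratedFDeriv ℝ (n + 1) φ p') fun _ => x) +
      ((iteratedFDeriv ℝ (n + 1) φ p' fun _ => x) -
        iteratedFDeriv ℝ (n + 1) φ p' fun _ => x') := by
    rw [sub_apply]; abel
  rw [heq]
  refine (norm_add_le _ _).trans ((add_le_add h1 h2).trans ?_)
  rw [Nat.add_sub_cancel]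
  have a1 : 0 ≤ ‖z - z'‖ := norm_nonneg _
  have a2 : 0 ≤ ‖x - x'‖ := norm_nonneg _
  have a3 : K * ‖x - x'‖ * m ^ (n + 1) ≤ K * R * (m ^ n * ‖x - x'‖) := by
    have : m ^ (n + 1) ≤ m ^ n * R := by rw [pow_succ]; gcongr
    calc _ ≤ K * ‖x - x'‖ * (m ^ n * R) := by gcongr
      _ = _ := by ring
  have a4 : 0 ≤ (K * R + K * (n + 1 : ℕ)) * (m ^ (n + 1) * ‖z - z'‖) := by positivity
  have a5 : 0 ≤ K * (m ^ n * ‖x - x'‖) := by positivity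
  linarith

theorem taylorRem_zero (N : ℕ) (φ : V → W) (z : V) : taylorRem N φ z 0 = 0 := by
  rw [taylorRem, Finset.sum_range_succ', Finset.sum_eq_zero]
  · simp
  · intro n _
    have : (iteratedFDeriv ℝ (n + 1) φ z fun _ => (0 : V)) = 0 :=
      (iteratedFDeriv ℝ (n + 1) φ z).map_zero
    rw [this, smul_zero]

variable {α : Type*} {δ g h r : α → ℝ}

theorem Ord.exists_bound {u : α → Bool → V} (hu : Ord δ g u) : ∃ K, 0 ≤ K ∧ ∀ a,
    (∀ i, ‖u a i‖ ≤ K * |g a|) ∧ ‖u a true - u a false‖ ≤ K * (|δ a| * |g a|) := by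
  obtain ⟨C₁, h₁⟩ := isBigO_top.1 (hu.1 true)
  obtain ⟨C₂, h₂⟩ := isBigO_top.1 (hu.1 false)
  obtain ⟨C₃, h₃⟩ := isBigO_top.1 hu.2
  refine ⟨|C₁| + |C₂| + |C₃|, by positivity, fun a => ⟨fun i => ?_, ?_⟩⟩
  · rcases i with _ | _
    · refine (h₂ a).trans ?_
      rw [Real.norm_eq_abs]
      gcongr
      linarith [le_abs_self C₂, abs_nonneg C₁, abs_nonneg C₃]
    · refine (h₁ a).trans ?_
      rw [Real.norm_eq_abs]
      gcongr
      linarith [le_abs_self C₁, abs_nonneg C₂, abs_nonneg C₃]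
  · refine (h₃ a).trans ?_
    rw [Real.norm_eq_abs, abs_mul]
    gcongr
    linarith [le_abs_self C₃, abs_nonneg C₂, abs_nonneg C₁]

theorem Ord.of_bound {u : α → Bool → V} {K : ℝ} (h1 : ∀ a i, ‖u a i‖ ≤ K * |g a|)
    (h2 : ∀ a, ‖u a true - u a false‖ ≤ K * (|δ a| * |g a|)) : Ord δ g u :=
  ⟨fun i => isBigO_top.2 ⟨K, fun a => h1 a i⟩, isBigO_top.2 ⟨K, fun a => by
    rw [Real.norm_eq_abs, abs_mul]; exact h2 a⟩⟩

theorem Ord.pi {κ : Type*} [Fintype κ] {u : α → Bool → κ → ℝ}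
    (hu : ∀ j, Ord δ g fun a i => u a i j) : Ord δ g u :=
  ⟨fun i => isBigO_pi.2 fun j => (hu j).1 i, isBigO_pi.2 fun j => (hu j).2⟩

theorem Ord.apply {κ : Type*} [Fintype κ] {u : α → Bool → κ → ℝ} (hu : Ord δ g u) (j : κ) :
    Ord δ g fun a i => u a i j :=
  ⟨fun i => isBigO_pi.1 (hu.1 i) j, isBigO_pi.1 hu.2 j⟩

theorem Ord.comp [FiniteDimensional ℝ V] {u : α → Bool → V} {φ : V → W} (hφ : ContDiff ℝ 1 φ)
    (hu : Ord δ (fun _ => 1) u) : Ord δ (fun _ => 1) fun a i => φ (u a i) := by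
  obtain ⟨R, hR, hu'⟩ := hu.exists_bound
  obtain ⟨K, hK, hK1, hK2⟩ := exists_lipschitz_closedBall hφ R
  have hmem : ∀ a i, u a i ∈ Metric.closedBall (0 : V) R := fun a i => by
    simpa using (hu' a).1 i
  refine Ord.of_bound (K := K + K * R) (fun a i => ?_) fun a => ?_
  · refine (hK1 _ (hmem a i)).trans ?_
    rw [abs_one, mul_one]
    exact le_add_of_nonneg_right (by positivity)
  · refine (hK2 _ (hmem a _) _ (hmem a _)).trans ?_
    calc _ ≤ K * (R * (|δ a| * |1|)) := by gcongr; exact (hu' a).2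
      _ ≤ _ := by
        rw [← mul_assoc]
        gcongr
        linarith

theorem Ord.taylorRem [FiniteDimensional ℝ V] {N : ℕ} (hN : 1 ≤ N) {φ : V → W}
    (hφ : ContDiff ℝ (N + 1) φ) (hr : r =O[⊤] fun _ => (1 : ℝ)) {z x : α → Bool → V}
    (hz : Ord δ (fun _ => 1) z) (hx : Ord δ r x) :
    Ord δ (fun a => r a ^ N) fun a i => taylorRem N φ (z a i) (x a i) := by
  obtain ⟨K₁, hK₁, hz'⟩ := hz.exists_bound
  obtain ⟨K₂, hK₂, hx'⟩ := hx.exists_bound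
  obtain ⟨ρ, hρ⟩ := isBigO_top.1 hr
  obtain ⟨K, hK, H⟩ := exists_taylorRem_bound hN hφ (K₁ + K₂ * |ρ|)
  have hzR : ∀ a i, ‖z a i‖ ≤ K₁ + K₂ * |ρ| := fun a i => by
    have := (hz' a).1 i
    rw [abs_one, mul_one] at this
    exact this.trans (le_add_of_nonneg_right (by positivity))
  have hmR : ∀ a, K₂ * |r a| ≤ K₁ + K₂ * |ρ| := fun a => by
    have h1 := hρ a
    rw [norm_one, mul_one, Real.norm_eq_abs] at h1
    have h2 := mul_le_mul_of_nonneg_left (h1.trans (le_abs_self ρ)) hK₂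
    linarith
  have hpow : ∀ a, (K₂ * |r a|) ^ (N - 1) * (K₂ * |r a|) = K₂ ^ N * |r a ^ N| := fun a => by
    rw [← pow_succ, Nat.sub_add_cancel hN, mul_pow, abs_pow]
  refine Ord.of_bound (K := K * K₂ ^ N * (K₁ + 1)) (fun a i => ?_) fun a => ?_
  · have h1 := H (z a i) (z a i) (x a i) 0 (K₂ * |r a|) (hzR a i) (hzR a i) ((hx' a).1 i)
      (by rw [norm_zero]; positivity) (hmR a)
    rw [taylorRem_zero, sub_zero, sub_zero, sub_self, norm_zero, mul_zero, zero_add] at h1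
    calc _ ≤ K * ((K₂ * |r a|) ^ (N - 1) * (K₂ * |r a|)) := by
          refine h1.trans ?_
          gcongr
          exact (hx' a).1 i
      _ = K * K₂ ^ N * 1 * |r a ^ N| := by rw [hpow]; ring
      _ ≤ _ := by gcongr; linarith
  · have h1 := H (z a true) (z a false) (x a true) (x a false) (K₂ * |r a|) (hzR a _) (hzR a _)
      ((hx' a).1 _) ((hx' a).1 _) (hmR a)
    have h2 := (hz' a).2
    rw [abs_one, mul_one] at h2
    calc _ ≤ K * ((K₂ * |r a|) ^ N * (K₁ * |δ a|) +
          (K₂ * |r a|) ^ (N - 1) * (K₂ * (|δ a| * |r a|))) := by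
          refine h1.trans ?_
          gcongr
          exact (hx' a).2
      _ = K * ((K₂ * |r a|) ^ N * (K₁ * |δ a|) +
          (K₂ * |r a|) ^ (N - 1) * (K₂ * |r a|) * |δ a|) := by ring
      _ = _ := by rw [hpow, mul_pow, abs_pow]; ring

end Taylor

/-! ### Taylor polynomials -/

section Polynomials

open Asymptotics Filter MvPolynomial

variable {e : ℕ}

/-- The Taylor polynomial of order `N` at `z` of the component of index `c` of `φ`. -/
def taylorPoly (N : ℕ) (φ : (Fin e → ℝ) → (Fin e → ℝ)) (z : Fin e → ℝ) (c : Fin e) :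
    MvPolynomial (Fin e) ℝ :=
  ∑ n ∈ Finset.range (N + 1), ∑ a : Fin n → Fin e,
    C (1 / (n.factorial : ℝ) * iteratedFDeriv ℝ n φ z (fun k => Pi.single (a k) 1) c) *
      ∏ k, X (a k)

theorem aeval_taylorPoly {A : Type*} [CommRing A] [Algebra ℝ A] (N : ℕ)
    (φ : (Fin e → ℝ) → (Fin e → ℝ)) (z : Fin e → ℝ) (c : Fin e) (x : Fin e → A) :
    aeval x (taylorPoly N φ z c) = ∑ n ∈ Finset.range (N + 1), ∑ a : Fin n → Fin e,
      (1 / (n.factorial : ℝ) * iteratedFDeriv ℝ n φ z (fun k => Pi.single (a k) 1) c) •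
        ∏ k, x (a k) := by
  simp only [taylorPoly, map_sum, map_mul, map_prod, aeval_X, algHom_C, Algebra.smul_def]

theorem sub_eval_taylorPoly (N : ℕ) (φ : (Fin e → ℝ) → (Fin e → ℝ)) (z x : Fin e → ℝ)
    (c : Fin e) : φ (z + x) c - eval x (taylorPoly N φ z c) = taylorRem N φ z x c := by
  rw [← MvPolynomial.coe_aeval_eq_eval, RingHom.coe_coe, aeval_taylorPoly, taylorRem,
    Pi.sub_apply, Finset.sum_apply]
  congr 1
  refine Finset.sum_congr rfl fun n _ => ?_
  have hx : (fun _ : Fin n => x) =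
      fun _ : Fin n => ∑ j, x j • (Pi.single j (1 : ℝ) : Fin e → ℝ) := by
    funext _
    exact pi_eq_sum_univ' x
  have h1 : (iteratedFDeriv ℝ n φ z fun _ => x) = ∑ a : Fin n → Fin e,
      (∏ k, x (a k)) • iteratedFDeriv ℝ n φ z fun k => Pi.single (a k) 1 := by
    rw [hx]
    refine ((iteratedFDeriv ℝ n φ z).toMultilinearMap.map_sum _).trans ?_
    exact Finset.sum_congr rfl fun a _ =>
      (iteratedFDeriv ℝ n φ z).toMultilinearMap.map_smul_univ _ _
  rw [h1, Pi.smul_apply, Finset.sum_apply, Finset.smul_sum]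
  refine Finset.sum_congr rfl fun a _ => ?_
  simp only [Pi.smul_apply, smul_eq_mul]
  ring

theorem totalDegree_taylorPoly_aux {N : ℕ} (κ : ∀ n, (Fin n → Fin e) → ℝ)
    (y : Fin e → MvPolynomial (Fin e) ℝ) (hy : ∀ j, (y j).totalDegree ≤ 1) :
    (∑ n ∈ Finset.range (N + 1), ∑ a : Fin n → Fin e, κ n a • ∏ k, y (a k)).totalDegree ≤ N := by
  refine totalDegree_finsetSum_le fun n hn => totalDegree_finsetSum_le fun a _ =>
    (totalDegree_smul_le _ _).trans ((totalDegree_finsetProd _ _).trans ?_)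
  refine (Finset.sum_le_card_nsmul _ _ 1 fun k _ => hy (a k)).trans ?_
  have := Finset.mem_range.1 hn
  simp
  omega

/-- The polynomial `p (X + c)`. -/
def shiftPoly (c : Fin e → ℝ) : MvPolynomial (Fin e) ℝ →ₐ[ℝ] MvPolynomial (Fin e) ℝ :=
  aeval fun j => X j + C (c j)

theorem aeval_shiftPoly {A : Type*} [CommRing A] [Algebra ℝ A] (c : Fin e → ℝ) (x : Fin e → A)
    (p : MvPolynomial (Fin e) ℝ) :
    aeval x (shiftPoly c p) = aeval (fun j => x j + c j • (1 : A)) p := by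
  rw [shiftPoly, ← AlgHom.comp_apply, comp_aeval]
  congr 2
  funext j
  simp [Algebra.smul_def]

theorem totalDegree_taylorPoly (N : ℕ) (φ : (Fin e → ℝ) → (Fin e → ℝ)) (z : Fin e → ℝ)
    (c : Fin e) : (taylorPoly N φ z c).totalDegree ≤ N := by
  have := aeval_taylorPoly N φ z c (X : Fin e → MvPolynomial (Fin e) ℝ)
  rw [aeval_X_left_apply] at this
  rw [this]
  exact totalDegree_taylorPoly_aux _ _ fun j => (totalDegree_X j).le

theorem totalDegree_shiftPoly_taylorPoly (N : ℕ) (φ : (Fin e → ℝ) → (Fin e → ℝ))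
    (z w : Fin e → ℝ) (c : Fin e) : (shiftPoly w (taylorPoly N φ z c)).totalDegree ≤ N := by
  have hy : ∀ j, (X j + C (w j) : MvPolynomial (Fin e) ℝ).totalDegree ≤ 1 := fun j =>
    (totalDegree_add _ _).trans (by rw [totalDegree_X, totalDegree_C]; exact le_rfl)
  have h := aeval_taylorPoly N φ z c fun j => (X j + C (w j) : MvPolynomial (Fin e) ℝ)
  have h' := totalDegree_taylorPoly_aux (N := N) (fun n a => 1 / (n.factorial : ℝ) *
    iteratedFDeriv ℝ n φ z (fun k => Pi.single (a k) 1) c) _ hy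
  rw [← h] at h'
  exact h'

theorem span_range_eq_top_of_separating {V κ : Type*} [AddCommGroup V] [Module ℝ V]
    [FiniteDimensional ℝ V] (ev : κ → Module.Dual ℝ V) (h : ∀ v, (∀ x, ev x v = 0) → v = 0) :
    Submodule.span ℝ (Set.range ev) = ⊤ := by
  have h1 := Subspace.dualCoannihilator_dualAnnihilator_eq (W := Submodule.span ℝ (Set.range ev))
  have h2 : (Submodule.span ℝ (Set.range ev)).dualCoannihilator = ⊥ := by
    rw [eq_bot_iff]
    intro v hv
    rw [Submodule.mem_dualCoannihilator] at hv
    exact h v fun x => hv (ev x) (Submodule.subset_span ⟨x, rfl⟩)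
  rw [← h1, h2, Submodule.dualAnnihilator_bot]

theorem exists_coeff_eq_sum_eval (N : ℕ) (m : Fin e →₀ ℕ) :
    ∃ w : (Fin e → ℝ) →₀ ℝ, ∀ q : MvPolynomial (Fin e) ℝ, q.totalDegree ≤ N →
      coeff m q = ∑ x ∈ w.support, w x * eval x q := by
  let U := restrictTotalDegree (Fin e) ℝ N
  let ev : (Fin e → ℝ) → Module.Dual ℝ U := fun x =>
    (aeval x : MvPolynomial (Fin e) ℝ →ₐ[ℝ] ℝ).toLinearMap ∘ₗ U.subtype
  let co : Module.Dual ℝ U := lcoeff ℝ m ∘ₗ U.subtype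
  have hspan : Submodule.span ℝ (Set.range ev) = ⊤ := by
    refine span_range_eq_top_of_separating ev fun p hp => ?_
    have h0 : (p : MvPolynomial (Fin e) ℝ) = 0 := by
      refine MvPolynomial.funext fun x => ?_
      simpa [ev, MvPolynomial.aeval_eq_eval] using hp x
    simpa using h0
  obtain ⟨w, hw⟩ := (Finsupp.mem_span_range_iff_exists_finsupp (v := ev) (x := co)).1
    (by rw [hspan]; trivial)
  refine ⟨w, fun q hq => ?_⟩
  have h1 := congrArg (fun F : Module.Dual ℝ U => F ⟨q, (mem_restrictTotalDegree _ _ _).2 hq⟩) hw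
  simp only [Finsupp.sum, LinearMap.sum_apply, LinearMap.smul_apply, smul_eq_mul] at h1
  have h2 : ∀ x, ev x ⟨q, (mem_restrictTotalDegree _ _ _).2 hq⟩ = eval x q := fun x => by
    simp [ev, MvPolynomial.aeval_eq_eval]
  simp only [h2] at h1
  rw [h1]
  rfl

/-- The coefficients of a polynomial of degree at most `N` are recovered from its values on any
dilation of a fixed finite set. -/
theorem exists_pow_mul_coeff_eq_sum_eval (N : ℕ) (m : Fin e →₀ ℕ) :
    ∃ w : (Fin e → ℝ) →₀ ℝ, ∀ q : MvPolynomial (Fin e) ℝ, q.totalDegree ≤ N → ∀ ρ : ℝ,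
      ρ ^ (∑ j, m j) * coeff m q = ∑ x ∈ w.support, w x * eval (ρ • x) q := by
  obtain ⟨w, hw⟩ := exists_coeff_eq_sum_eval N m
  refine ⟨w, fun q hq ρ => ?_⟩
  set p : MvPolynomial (Fin e) ℝ :=
    ∑ l ∈ q.support, monomial l (ρ ^ (∑ j, l j) * coeff l q) with hp
  have hpc : coeff m p = ρ ^ (∑ j, m j) * coeff m q := by
    rw [hp, coeff_sum]
    simp only [coeff_monomial]
    rw [Finset.sum_ite_eq']
    split_ifs with h
    · rfl
    · rw [notMem_support_iff.1 h, mul_zero]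
  have hpd : p.totalDegree ≤ N := by
    refine totalDegree_finsetSum_le fun l hl => (totalDegree_monomial_le _ _).trans ?_
    exact (le_totalDegree hl).trans hq
  have hpe : ∀ x, eval x p = eval (ρ • x) q := by
    intro x
    rw [hp, map_sum, eval_eq']
    refine Finset.sum_congr rfl fun l _ => ?_
    rw [eval_monomial, Finsupp.prod_fintype _ _ (fun _ => pow_zero _)]
    simp only [Pi.smul_apply, smul_eq_mul, mul_pow]
    rw [Finset.prod_mul_distrib, Finset.prod_pow_eq_pow_sum]
    ring
  rw [← hpc, hw p hpd]
  exact Finset.sum_congr rfl fun x _ => by rw [hpe]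

variable {α : Type*} {δ g h r : α → ℝ}

theorem isBigO_of_mul {u : α → ℝ} (hu : (fun a => g a * u a) =O[⊤] fun a => g a * h a)
    (h0 : ∀ a, g a = 0 → u a = 0) : u =O[⊤] h := by
  obtain ⟨K, hK⟩ := isBigO_top.1 hu
  refine isBigO_top.2 ⟨|K|, fun a => ?_⟩
  by_cases hg : g a = 0
  · rw [h0 a hg, norm_zero]; positivity
  · have h1 := hK a
    rw [norm_mul, norm_mul, mul_left_comm] at h1
    exact (le_of_mul_le_mul_left h1 (norm_pos_iff.2 hg)).trans
      (mul_le_mul_of_nonneg_right (le_abs_self K) (norm_nonneg _))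

theorem Ord.of_mul {u : α → Bool → ℝ} (hu : Ord δ (fun a => g a * h a) fun a i => g a * u a i)
    (h0 : ∀ a, g a = 0 → ∀ i, u a i = 0) : Ord δ h u := by
  refine ⟨fun i => isBigO_of_mul (hu.1 i) fun a ha => h0 a ha i, isBigO_of_mul (g := g) ?_ ?_⟩
  · exact (hu.2.congr_left fun a => by ring).congr_right fun a => by ring
  · intro a ha
    rw [h0 a ha, h0 a ha, sub_zero]

theorem Ord.coeff_of_eval {N : ℕ} {q : α → Bool → MvPolynomial (Fin e) ℝ}
    (hq : ∀ a i, (q a i).totalDegree ≤ N) (h0 : ∀ a, r a = 0 → ∀ i, q a i = 0)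
    (hev : ∀ x, Ord δ (fun a => r a ^ N) fun a i => eval (r a • x) (q a i)) (m : Fin e →₀ ℕ)
    (hm : ∑ j, m j ≤ N) :
    Ord δ (fun a => r a ^ (N - ∑ j, m j)) fun a i => coeff m (q a i) := by
  obtain ⟨w, hw⟩ := exists_pow_mul_coeff_eq_sum_eval N m
  refine Ord.of_mul (g := fun a => r a ^ (∑ j, m j)) ?_ fun a ha i => ?_
  · have h1 : Ord δ (fun a => r a ^ N) fun a i =>
        ∑ x ∈ w.support, w x * eval (r a • x) (q a i) := by
      refine Ord.sum fun x _ => ?_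
      have h2 := (Ord.of_isBigO (δ := δ) (g := fun _ => (1 : ℝ))
        (isBigO_const_const (w x) one_ne_zero (⊤ : Filter α))).mul (hev x)
      exact h2.mono ((isBigO_refl _ _).congr_left fun a => (one_mul _).symm)
    refine (h1.congr fun a i => (hw _ (hq a i) (r a)).symm).mono ((isBigO_refl _ _).congr_right
      fun a => ?_)
    rw [← pow_add, Nat.add_sub_cancel' hm]
  · rw [h0 a (by_contra fun h => pow_ne_zero _ h ha) i, coeff_zero]

/-- The Taylor polynomials of `φ` at the two points `z` and `z + c` differ little. -/
theorem Ord.coeff_taylorPoly {N : ℕ} (hN : 1 ≤ N) {φ : (Fin e → ℝ) → (Fin e → ℝ)}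
    (hφ : ContDiff ℝ (N + 1) φ) (hr : r =O[⊤] fun _ => (1 : ℝ)) {z w : α → Bool → Fin e → ℝ}
    (hz : Ord δ (fun _ => 1) z) (hw : Ord δ r w) (c : Fin e) (m : Fin e →₀ ℕ)
    (hm : ∑ j, m j ≤ N) :
    Ord δ (fun a => r a ^ (N - ∑ j, m j)) fun a i =>
      coeff m (taylorPoly N φ (z a i + w a i) c - shiftPoly (w a i) (taylorPoly N φ (z a i) c)) := by
  refine Ord.coeff_of_eval (fun a i => ?_) (fun a ha i => ?_) (fun x => ?_) m hm
  · exact (totalDegree_sub _ _).trans (max_le (totalDegree_taylorPoly _ _ _ _)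
      (totalDegree_shiftPoly_taylorPoly _ _ _ _ _))
  · obtain ⟨K, hK, H⟩ := hw.exists_bound
    have : w a i = 0 := by
      have := (H a).1 i
      rwa [ha, abs_zero, mul_zero, norm_le_zero_iff] at this
    rw [this, add_zero]
    have h1 : shiftPoly (0 : Fin e → ℝ) = AlgHom.id ℝ _ := by
      refine MvPolynomial.algHom_ext fun j => ?_
      simp [shiftPoly]
    rw [h1, AlgHom.id_apply, sub_self]
  · have hx : Ord δ r fun a (_ : Bool) => r a • x :=
      Ord.of_isBigO (isBigO_top.2 ⟨‖x‖, fun a => by rw [norm_smul, mul_comm]⟩)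
    have hzw : Ord δ (fun _ => 1) fun a i => z a i + w a i := hz.add (hw.mono hr)
    have h1 := (Ord.taylorRem hN hφ hr hz (hw.add hx)).sub (Ord.taylorRem hN hφ hr hzw hx)
    refine (h1.apply c).congr fun a i => ?_
    rw [Pi.sub_apply, ← sub_eval_taylorPoly, ← sub_eval_taylorPoly, map_sub, add_assoc]
    have h2 := aeval_shiftPoly (w a i) (r a • x) (taylorPoly N φ (z a i) c)
    rw [MvPolynomial.aeval_eq_eval, MvPolynomial.aeval_eq_eval] at h2
    have h3 : (fun j => (r a • x) j + w a i j • (1 : ℝ)) = w a i + r a • x := by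
      funext j; simp [add_comm]
    rw [h3] at h2
    rw [show eval (r a • x) (shiftPoly (w a i) (taylorPoly N φ (z a i) c)) =
      eval (w a i + r a • x) (taylorPoly N φ (z a i) c) from h2]
    ring

end Polynomials

/-! ### Images of controlled families by smooth maps -/

section Image

open Asymptotics Filter

variable {H : Type*} [CommRing H] [Algebra ℝ H] [Coalgebra ℝ H]
  {𝒜 : ℕ → Submodule ℝ H} [GradedAlgebra 𝒜] {N e : ℕ}

theorem kerProj_foldl_redMul (hH : IsTruncatedHopfAlgebra 𝒜 N) (l : List H) (x : H) :
    kerProj (l.foldl redMul x) = kerProj x * (l.map kerProj).prod := by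
  induction l generalizing x with
  | nil => simp
  | cons y l ih =>
    have h : kerProj (redMul x y) = kerProj x * kerProj y := by
      simp only [kerProj, redMul, map_sub, counit_mul hH, map_smul, smul_eq_mul]
      simp only [Algebra.smul_def, map_mul, map_sub, mul_one]
      ring
    rw [List.foldl_cons, ih, h, List.map_cons, List.prod_cons, mul_assoc]

theorem kerProj_redProd (hH : IsTruncatedHopfAlgebra 𝒜 N) {n : ℕ} (hn : n ≠ 0) (x : Fin n → H) :
    kerProj (redProd (List.ofFn x)) = ∏ k, kerProj (x k) := by
  obtain ⟨n, rfl⟩ := Nat.exists_eq_succ_of_ne_zero hn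
  rw [List.ofFn_succ, redProd, kerProj_foldl_redMul hH, List.map_ofFn, List.prod_ofFn,
    Fin.prod_univ_succ]
  rfl

/-- The image `φ(z)` is the Taylor polynomial of `φ` at `ε(z)`, evaluated at the nilpotent element
`z - ε(z) 1`. -/
theorem image_eq_aeval (hH : IsTruncatedHopfAlgebra 𝒜 N) (φ : (Fin e → ℝ) → (Fin e → ℝ))
    (z : Fin e → H) (c : Fin e) :
    image N φ z c = MvPolynomial.aeval (fun j => kerProj (z j))
      (taylorPoly N φ (pair Coalgebra.counit z) c) := by
  rw [aeval_taylorPoly, Finset.sum_range_eq_add_Ico _ (Nat.succ_pos N), image]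
  congr 1
  · simp
  · have : Finset.Icc 1 N = Finset.Ico 1 (N + 1) := by
      ext n; simp only [Finset.mem_Icc, Finset.mem_Ico]; omega
    rw [this]
    refine Finset.sum_congr rfl fun n hn => ?_
    have hn0 : n ≠ 0 := by have := (Finset.mem_Ico.1 hn).1; omega
    rw [Finset.smul_sum]
    refine Finset.sum_congr rfl fun a _ => ?_
    rw [kerProj_redProd hH hn0, smul_smul]

variable {ι : Type*} [Fintype ι] {b : Module.Basis ι ℝ H} {deg : ι → ℕ}
  {α : Type*} {r δ : α → ℝ} {f : α → Module.Dual ℝ H}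

/-- The elements all of whose components have degree at least `n`. -/
def degreeIdeal (hb : IsHomogeneousBasis 𝒜 N b deg) (n : ℕ) : Ideal H where
  carrier := {x | ∀ k, deg k < n → b.repr x k = 0}
  zero_mem' := fun k _ => by simp
  add_mem' := fun {x y} hx hy k hk => by
    rw [map_add, Finsupp.add_apply, hx k hk, hy k hk, add_zero]
  smul_mem' := fun x y hy k hk => by
    rw [smul_eq_mul, mul_comm]
    have h1 := repr_map_eq_sum ((LinearMap.mul ℝ H).flip x) y k (b := b)
    rw [LinearMap.flip_apply, LinearMap.mul_apply'] at h1
    rw [h1]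
    refine Finset.sum_eq_zero fun m _ => ?_
    by_cases hm : deg m < n
    · rw [hy m hm, zero_mul]
    · have h2 := repr_map_eq_sum (LinearMap.mul ℝ H (b m)) x k (b := b)
      rw [LinearMap.flip_apply, h2, Finset.sum_eq_zero, mul_zero]
      intro l _
      rw [LinearMap.mul_apply', repr_mul_eq_zero hb (by omega), mul_zero]

theorem mul_mem_degreeIdeal {hb : IsHomogeneousBasis 𝒜 N b deg} {m n : ℕ} {x y : H}
    (hx : x ∈ degreeIdeal hb m) (hy : y ∈ degreeIdeal hb n) :
    x * y ∈ degreeIdeal hb (m + n) := by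
  intro k hk
  have h1 := repr_map_eq_sum ((LinearMap.mul ℝ H).flip y) x k (b := b)
  rw [LinearMap.flip_apply, LinearMap.mul_apply'] at h1
  rw [h1]
  refine Finset.sum_eq_zero fun l _ => ?_
  by_cases hl : deg l < m
  · rw [hx l hl, zero_mul]
  have h2 := repr_map_eq_sum (LinearMap.mul ℝ H (b l)) y k (b := b)
  rw [LinearMap.flip_apply, h2, Finset.sum_eq_zero, mul_zero]
  intro l' _
  by_cases hl' : deg l' < n
  · rw [hy l' hl', zero_mul]
  · rw [LinearMap.mul_apply', repr_mul_eq_zero hb (by omega), mul_zero]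

theorem pow_mem_degreeIdeal {hb : IsHomogeneousBasis 𝒜 N b deg} {x : H}
    (hx : x ∈ degreeIdeal hb 1) (n : ℕ) : x ^ n ∈ degreeIdeal hb n := by
  induction n with
  | zero => exact fun k hk => absurd hk (Nat.not_lt_zero _)
  | succ n ih => rw [pow_succ]; exact mul_mem_degreeIdeal ih hx

theorem prod_pow_mem_degreeIdeal {hb : IsHomogeneousBasis 𝒜 N b deg} {κ : Type*} {x : κ → H}
    (hx : ∀ j, x j ∈ degreeIdeal hb 1) (s : Finset κ) (m : κ → ℕ) :
    ∏ j ∈ s, x j ^ m j ∈ degreeIdeal hb (∑ j ∈ s, m j) := by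
  classical
  induction s using Finset.induction_on with
  | empty => exact fun k hk => absurd hk (Nat.not_lt_zero _)
  | insert j s hj ih =>
    rw [Finset.prod_insert hj, Finset.sum_insert hj]
    exact mul_mem_degreeIdeal (pow_mem_degreeIdeal (hx j) _) ih

theorem kerProj_mem_degreeIdeal (hH : IsTruncatedHopfAlgebra 𝒜 N)
    (hb : IsHomogeneousBasis 𝒜 N b deg) (x : H) : kerProj x ∈ degreeIdeal hb 1 :=
  fun _ hk => repr_sub_counit_eq_zero hH hb x (by omega)

theorem eq_zero_of_mem_degreeIdeal {hb : IsHomogeneousBasis 𝒜 N b deg} {x : H}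
    (hx : x ∈ degreeIdeal hb (N + 1)) : x = 0 := by
  refine b.repr.injective (Finsupp.ext fun k => ?_)
  rw [hx k (Nat.lt_succ_of_le (hb.deg_le k)), map_zero, Finsupp.zero_apply]

theorem map_mem_degreeIdeal {hb : IsHomogeneousBasis 𝒜 N b deg} {d : ℕ}
    {L : Fin d → H →ₗ[ℝ] H} (hL : IsCocycleFamily 𝒜 N L) (i : Fin d) {n : ℕ} {x : H}
    (hx : x ∈ degreeIdeal hb n) : L i x ∈ degreeIdeal hb (n + 1) := by
  intro k hk
  rw [repr_map_eq_sum (L i) x k]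
  refine Finset.sum_eq_zero fun m _ => ?_
  by_cases hm : deg m < n
  · rw [hx m hm, zero_mul]
  · rw [hb.repr_eq_zero _ _ (hL.degree_one i _ _ (hb.mem m)) k (by omega), mul_zero]

/-- Once `ε(z)` is fixed, the image `φ(z)` modulo elements of degree at least `n` depends on `z`
only modulo such elements. -/
theorem image_sub_mem_degreeIdeal (hH : IsTruncatedHopfAlgebra 𝒜 N)
    (hb : IsHomogeneousBasis 𝒜 N b deg) (φ : (Fin e → ℝ) → (Fin e → ℝ)) {z z' : Fin e → H}
    (hε : pair (Coalgebra.counit (R := ℝ)) z = pair Coalgebra.counit z') {n : ℕ}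
    (h : ∀ j, z j - z' j ∈ degreeIdeal hb n) (c : Fin e) :
    image N φ z c - image N φ z' c ∈ degreeIdeal hb n := by
  rw [image_eq_aeval hH, image_eq_aeval hH, ← hε]
  have hmk : ∀ (x : Fin e → H) (p : MvPolynomial (Fin e) ℝ),
      Ideal.Quotient.mkₐ ℝ (degreeIdeal hb n) (MvPolynomial.aeval x p) =
        MvPolynomial.aeval (fun j => Ideal.Quotient.mkₐ ℝ (degreeIdeal hb n) (x j)) p := by
    intro x p
    rw [← AlgHom.comp_apply, MvPolynomial.comp_aeval]
  have hk : (fun j => Ideal.Quotient.mkₐ ℝ (degreeIdeal hb n) (kerProj (z j))) =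
      fun j => Ideal.Quotient.mkₐ ℝ (degreeIdeal hb n) (kerProj (z' j)) := by
    funext j
    refine Ideal.Quotient.eq.2 ?_
    have : kerProj (z j) - kerProj (z' j) = z j - z' j := by
      have h1 : Coalgebra.counit (R := ℝ) (z j) = Coalgebra.counit (R := ℝ) (z' j) :=
        congrFun hε j
      rw [kerProj, kerProj, h1]; abel
    rw [this]
    exact h j
  refine Ideal.Quotient.eq.1 ?_
  change Ideal.Quotient.mkₐ ℝ (degreeIdeal hb n) _ = Ideal.Quotient.mkₐ ℝ (degreeIdeal hb n) _
  rw [hmk, hmk, hk]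

/-- The monomials of degree at most `N`. -/
def monomials (e N : ℕ) : Finset (Fin e →₀ ℕ) :=
  (Finset.range (N + 1)).biUnion fun n => Finset.finsuppAntidiag Finset.univ n

theorem mem_monomials {m : Fin e →₀ ℕ} : m ∈ monomials e N ↔ ∑ j, m j ≤ N := by
  simp [monomials, Finset.mem_finsuppAntidiag]

theorem aeval_eq_sum_monomials {q : MvPolynomial (Fin e) ℝ} (hq : q.totalDegree ≤ N)
    (x : Fin e → H) : MvPolynomial.aeval x q =
      ∑ m ∈ monomials e N, MvPolynomial.coeff m q • ∏ j, x j ^ m j := by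
  rw [MvPolynomial.aeval_def, MvPolynomial.eval₂_eq']
  have hsub : q.support ⊆ monomials e N := fun m hm => by
    rw [mem_monomials]
    have := (MvPolynomial.le_totalDegree hm).trans hq
    rwa [Finsupp.sum_fintype _ _ fun _ => rfl] at this
  simp only [← Algebra.smul_def]
  refine Finset.sum_subset hsub fun m _ hm => ?_
  rw [MvPolynomial.notMem_support_iff.1 hm, zero_smul]

theorem Bdd.kerProj {x : α → Bool → H} (hx : Bdd b δ x) : Bdd b δ fun a i => kerProj (x a i) :=
  HOrd.sub hx ((Bdd.const 1).smul (hx.apply Coalgebra.counit))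

/-- A monomial of degree `|m|` in elements of the augmentation ideal has components of degree at
least `|m|` only, so a coefficient of order `r ^ (N - |m|)` suffices. -/
theorem Rem.aeval (hH : IsTruncatedHopfAlgebra 𝒜 N) (hb : IsHomogeneousBasis 𝒜 N b deg)
    (hr : r =O[⊤] fun _ => (1 : ℝ)) {q : α → Bool → MvPolynomial (Fin e) ℝ}
    (hq : ∀ a i, (q a i).totalDegree ≤ N)
    (hc : ∀ m : Fin e →₀ ℕ, ∑ j, m j ≤ N →
      Ord δ (fun a => r a ^ (N - ∑ j, m j)) fun a i => MvPolynomial.coeff m (q a i))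
    {x : α → Bool → Fin e → H} (hx : ∀ j, Bdd b δ fun a i => x a i j) :
    Rem b deg N r δ fun a i => MvPolynomial.aeval (fun j => HopfRough.kerProj (x a i j)) (q a i) := by
  have hmon : ∀ m ∈ monomials e N, Rem b deg N r δ fun a i =>
      MvPolynomial.coeff m (q a i) • ∏ j, HopfRough.kerProj (x a i j) ^ m j := by
    intro m hm k
    rw [mem_monomials] at hm
    have hbd : Bdd b δ fun a i => ∏ j, HopfRough.kerProj (x a i j) ^ m j :=
      Bdd.prod fun j _ => (hx j).kerProj.pow (m j)
    by_cases hk : deg k < ∑ j, m j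
    · refine Ord.of_eq_zero fun a i => ?_
      rw [map_smul, Finsupp.smul_apply, prod_pow_mem_degreeIdeal (hb := hb)
        (fun j => kerProj_mem_degreeIdeal hH hb (x a i j)) Finset.univ m k hk, smul_zero]
    · refine (((hc m hm).mul (hbd k)).mono ?_).congr fun a i => ?_
      · simpa using pow_isBigO hr (show N - deg k ≤ N - ∑ j, m j by omega)
      · rw [map_smul, Finsupp.smul_apply, smul_eq_mul]
  exact (HOrd.sum hmon).congr fun a i => (aeval_eq_sum_monomials (hq a i) _).symm

theorem Ord.taylorCoeff {φ : (Fin e → ℝ) → (Fin e → ℝ)} (hφ : ContDiff ℝ (N + 1) φ)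
    {z : α → Bool → Fin e → ℝ} (hz : Ord δ (fun _ => 1) z) {n : ℕ} (hn : n ∈ Finset.range (N + 1))
    (v : Fin n → Fin e) (c : Fin e) :
    Ord δ (fun _ => 1) fun a i => 1 / (n.factorial : ℝ) *
      iteratedFDeriv ℝ n φ (z a i) (fun k => Pi.single (v k) 1) c := by
  have hn' : ((n : ℕ) : WithTop ℕ∞) + 1 ≤ (N + 1 : ℕ) := by
    exact_mod_cast Finset.mem_range.1 hn
  have h1 : ContDiff ℝ 1 (iteratedFDeriv ℝ n φ) :=
    hφ.iteratedFDeriv_right (by rw [add_comm]; exact_mod_cast hn')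
  have h2 : ContDiff ℝ 1 fun z => iteratedFDeriv ℝ n φ z fun k => Pi.single (v k) (1 : ℝ) :=
    (ContinuousMultilinearMap.apply ℝ (fun _ : Fin n => Fin e → ℝ) (Fin e → ℝ)
      fun k => Pi.single (v k) 1).contDiff.comp h1
  have hD : ContDiff ℝ 1 fun z => 1 / (n.factorial : ℝ) *
      iteratedFDeriv ℝ n φ z (fun k => Pi.single (v k) 1) c :=
    contDiff_const.mul ((contDiff_apply ℝ ℝ c).comp h2)
  exact Ord.comp (φ := fun z => 1 / (n.factorial : ℝ) *
    iteratedFDeriv ℝ n φ z (fun k => Pi.single (v k) 1) c) hD hz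

theorem Bdd.image (hH : IsTruncatedHopfAlgebra 𝒜 N) {φ : (Fin e → ℝ) → (Fin e → ℝ)}
    (hφ : ContDiff ℝ (N + 1) φ) {x : α → Bool → Fin e → H} (hx : ∀ j, Bdd b δ fun a i => x a i j)
    (c : Fin e) : Bdd b δ fun a i => image N φ (x a i) c := by
  have hz : Ord δ (fun _ => 1) fun a i => pair (Coalgebra.counit (R := ℝ)) (x a i) :=
    Ord.pi fun j => (hx j).apply Coalgebra.counit
  refine (HOrd.sum (s := Finset.range (N + 1)) (x := fun n a i => ∑ v : Fin n → Fin e,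
    (1 / (n.factorial : ℝ) * iteratedFDeriv ℝ n φ (pair Coalgebra.counit (x a i))
      (fun k => Pi.single (v k) 1) c) • ∏ k, HopfRough.kerProj (x a i (v k))) fun n hn =>
      HOrd.sum fun v _ => Bdd.smul ?_ (Bdd.prod fun k _ => (hx (v k)).kerProj)).congr
    fun a i => ?_
  · exact Ord.taylorCoeff hφ hz hn v c
  · rw [image_eq_aeval hH, aeval_taylorPoly]

/-- The increment of the component of degree `0` of a controlled family is of order `r`. -/
theorem Ctrl.counit_sub (hH : IsTruncatedHopfAlgebra 𝒜 N) (hN : 1 ≤ N)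
    (hb : IsHomogeneousBasis 𝒜 N b deg) (hf : IsScaledCharacter 𝒜 N r f) {x y : α → Bool → H}
    (h : Ctrl b deg N r δ f x y) :
    Ord δ r fun a i => Coalgebra.counit (R := ℝ) (y a i) - Coalgebra.counit (R := ℝ) (x a i) := by
  have hsum : ∀ (g : Module.Dual ℝ H) (x : H), g x = ∑ k, b.repr x k * g (b k) := by
    intro g x
    conv_lhs => rw [← b.sum_repr x, map_sum]
    simp only [map_smul, smul_eq_mul]
  have hpow : ∀ {n : ℕ}, 1 ≤ n → (fun a => r a ^ n) =O[⊤] r := fun hn => by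
    simpa using pow_isBigO hf.bdd hn
  have h1 : Ord δ r fun a i => ∑ k, b.repr (y a i - translate (f a) (x a i)) k *
      Coalgebra.counit (R := ℝ) (b k) := by
    refine Ord.sum fun k _ => ?_
    rcases Nat.eq_zero_or_pos (deg k) with hk | hk
    · refine ((h.rem k).mul (Ord.of_isBigO (g := fun _ => (1 : ℝ))
        (isBigO_const_const (Coalgebra.counit (R := ℝ) (b k)) one_ne_zero ⊤))).mono ?_
      simpa [hk] using hpow hN
    · exact Ord.of_eq_zero fun a i => by rw [hH.counit_graded _ hk _ (hb.mem k), mul_zero]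
  have h2 : Ord δ r fun a i => ∑ k, b.repr (kerProj (x a i)) k * f a (b k) := by
    refine Ord.sum fun k _ => ?_
    rcases Nat.eq_zero_or_pos (deg k) with hk | hk
    · exact Ord.of_eq_zero fun a i => by
        rw [kerProj_mem_degreeIdeal hH hb (x a i) k (by omega), zero_mul]
    · refine ((h.left.kerProj k).mul (Ord.of_isBigO (hf.order _ _ (hb.mem k)))).mono ?_
      simpa using hpow hk
  refine (h1.add h2).congr fun a i => ?_
  rw [← hsum, ← hsum, map_sub, counit_translate, kerProj, map_sub, map_smul,
    (hf.character a).map_one, smul_eq_mul, mul_one]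
  ring

/-- Images of controlled families by maps of class `C ^ (N + 1)` are controlled, with Lipschitz
dependence. -/
theorem Ctrl.image (hH : IsTruncatedHopfAlgebra 𝒜 N) (hN : 1 ≤ N)
    (hb : IsHomogeneousBasis 𝒜 N b deg) (hf : IsScaledCharacter 𝒜 N r f)
    {φ : (Fin e → ℝ) → (Fin e → ℝ)} (hφ : ContDiff ℝ (N + 1) φ) {x y : α → Bool → Fin e → H}
    (h : ∀ j, Ctrl b deg N r δ f (fun a i => x a i j) fun a i => y a i j) (c : Fin e) :
    Ctrl b deg N r δ f (fun a i => image N φ (x a i) c) fun a i => image N φ (y a i) c := by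
  refine ⟨Bdd.image hH hφ (fun j => (h j).left) c, Bdd.image hH hφ (fun j => (h j).right) c, ?_⟩
  set z : α → Bool → Fin e → ℝ := fun a i => pair (Coalgebra.counit (R := ℝ)) (x a i) with hzdef
  set w : α → Bool → Fin e → ℝ :=
    fun a i => pair (Coalgebra.counit (R := ℝ)) (y a i) - z a i with hwdef
  have hz : Ord δ (fun _ => 1) z := Ord.pi fun j => (h j).left.apply Coalgebra.counit
  have hw : Ord δ r w := Ord.pi fun j => (h j).counit_sub hH hN hb hf
  have hzw : ∀ a i, pair (Coalgebra.counit (R := ℝ)) (y a i) = z a i + w a i := fun a i => by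
    rw [hwdef]; simp
  -- the change of Taylor polynomial from `ε(x)` to `ε(y)`
  have h1 := Rem.aeval hH hb hf.bdd
    (q := fun a i => taylorPoly N φ (z a i + w a i) c - shiftPoly (w a i) (taylorPoly N φ (z a i) c))
    (fun a i => (MvPolynomial.totalDegree_sub _ _).trans (max_le (totalDegree_taylorPoly _ _ _ _)
      (totalDegree_shiftPoly_taylorPoly _ _ _ _ _)))
    (fun m hm => Ord.coeff_taylorPoly hN hφ hf.bdd hz hw c m hm) fun j => (h j).right
  -- the Taylor polynomial at `ε(x)` applied to the controlled family `x - ε(x)`, `y - ε(x)`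
  have hbase : ∀ j, Ctrl b deg N r δ f (fun a i => HopfRough.kerProj (x a i j))
      fun a i => y a i j - z a i j • (1 : H) := fun j =>
    (h j).sub ((Ctrl.one hH hf).smul (hz.apply j))
  have h2 : Ctrl b deg N r δ f
      (fun a i => MvPolynomial.aeval (fun j => HopfRough.kerProj (x a i j))
        (taylorPoly N φ (z a i) c))
      fun a i => MvPolynomial.aeval (fun j => y a i j - z a i j • (1 : H))
        (taylorPoly N φ (z a i) c) := by
    simp only [aeval_taylorPoly]
    refine Ctrl.sum fun n hn => Ctrl.sum fun v _ => Ctrl.smul ?_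
      (Ctrl.prod hH hb hf fun k _ => hbase (v k))
    exact Ord.taylorCoeff hφ hz hn v c
  refine (HOrd.add h1 h2.rem).congr fun a i => ?_
  have hshift : MvPolynomial.aeval (fun j => HopfRough.kerProj (y a i j))
      (shiftPoly (w a i) (taylorPoly N φ (z a i) c)) =
      MvPolynomial.aeval (fun j => y a i j - z a i j • (1 : H)) (taylorPoly N φ (z a i) c) := by
    rw [aeval_shiftPoly]
    congr 2
    funext j
    have : w a i j = Coalgebra.counit (R := ℝ) (y a i j) - z a i j := rfl
    rw [HopfRough.kerProj, this, sub_smul]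
    abel
  rw [map_sub, hshift, image_eq_aeval hH, image_eq_aeval hH, hzw]
  abel

/-- The defect `L y - Γ L x + f(L x) 1`, which governs both the additivity of the germ
`f(L x)` of the rough integral and the remainder of the lifted integral, gains one power of `r`. -/
theorem Ctrl.cocycle (hH : IsTruncatedHopfAlgebra 𝒜 N) (hb : IsHomogeneousBasis 𝒜 N b deg)
    (hf : IsScaledCharacter 𝒜 N r f) {d : ℕ} {L : Fin d → H →ₗ[ℝ] H}
    (hL : IsCocycleFamily 𝒜 N L) (l : Fin d) {x y : α → Bool → H}
    (h : Ctrl b deg N r δ f x y) :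
    HOrd b δ (fun k a => r a ^ (N + 1 - deg k)) fun a i =>
      L l (y a i) - translate (f a) (L l (x a i)) + f a (L l (x a i)) • (1 : H) := by
  have h1 : HOrd b δ (fun k a => r a ^ (N + 1 - deg k)) fun a i =>
      L l (y a i - translate (f a) (x a i)) := by
    refine HOrd.map (A := fun _ => L l) h.rem fun m k => ?_
    by_cases hk : deg k = deg m + 1
    · have : N + 1 - deg k = N - deg m := by omega
      rw [this]
      simpa [mul_comm] using
        (isBigO_refl (fun a => r a ^ (N - deg m)) ⊤).const_mul_left (b.repr (L l (b m)) k)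
    · exact isBigO_of_eq_zero fun a => by
        rw [hb.repr_eq_zero _ _ (hL.degree_one l _ _ (hb.mem m)) k hk, mul_zero]
  have h2 : HOrd b δ (fun k a => r a ^ (N + 1 - deg k)) fun a i =>
      (L l ∘ₗ translate (f a) - translate (f a) ∘ₗ L l + (f a ∘ₗ L l).smulRight (1 : H))
        (x a i) := by
    refine HOrd.map (A := fun a => L l ∘ₗ translate (f a) - translate (f a) ∘ₗ L l +
      (f a ∘ₗ L l).smulRight (1 : H)) h.left fun m k => ?_
    simpa using translate_cocycle_isBigO hH hb hf hL l (b m) k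
  refine (h1.add h2).congr fun a i => ?_
  simp only [map_sub, LinearMap.add_apply, LinearMap.sub_apply, LinearMap.comp_apply,
    LinearMap.smulRight_apply]
  abel

theorem repr_cocycle_eq_zero (hH : IsTruncatedHopfAlgebra 𝒜 N)
    (hb : IsHomogeneousBasis 𝒜 N b deg) {d : ℕ} {L : Fin d → H →ₗ[ℝ] H}
    (hL : IsCocycleFamily 𝒜 N L) (l : Fin d) (f : Module.Dual ℝ H) (x y : H) {k : ι}
    (hk : deg k = 0) :
    b.repr (L l y - translate f (L l x) + f (L l x) • (1 : H)) k = 0 := by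
  have h1 : L l y ∈ degreeIdeal hb 1 :=
    map_mem_degreeIdeal hL l (n := 0) fun k hk => absurd hk (Nat.not_lt_zero _)
  have h2 := kerProj_mem_degreeIdeal hH hb (translate f (L l x))
  rw [kerProj, counit_translate] at h2
  have := (degreeIdeal hb 1).sub_mem h1 h2 k (by omega)
  rwa [← sub_add] at this

end Image

/-! ### Rough integrals of controlled paths -/

section Integral

open Asymptotics Filter

variable {H : Type*} [CommRing H] [Algebra ℝ H] [Coalgebra ℝ H]

/-- The data of the initial value problem, in homogeneous coordinates. The scale of the increment
over `[s, t]` is `ω s t ^ γ`, and the exponents are such that `N γ ≤ 1 < (N + 1) γ`. -/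
structure IsRoughSystem (𝒜 : ℕ → Submodule ℝ H) [GradedAlgebra 𝒜] (N : ℕ) {ι : Type*} [Fintype ι]
    (b : Module.Basis ι ℝ H) (deg : ι → ℕ) {d e : ℕ} (L : Fin d → H →ₗ[ℝ] H) (γ T : ℝ)
    (ω : ℝ → ℝ → ℝ) (𝒳 : ℝ → ℝ → Module.Dual ℝ H) (φ : Fin d → (Fin e → ℝ) → (Fin e → ℝ)) :
    Prop where
  hopf : IsTruncatedHopfAlgebra 𝒜 N
  basis : IsHomogeneousBasis 𝒜 N b deg
  cocycle : IsCocycleFamily 𝒜 N L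
  one_le : 1 ≤ N
  gamma_pos : 0 < γ
  mul_le_one : N * γ ≤ 1
  one_lt_mul : 1 < (N + 1) * γ
  control : IsControl T ω
  right : IsRightContinuous T ω
  character : ∀ s t, 0 ≤ s → s ≤ t → t ≤ T → IsTruncatedCharacter 𝒜 N (𝒳 s t)
  chen : ∀ s u t, 0 ≤ s → s ≤ u → u ≤ t → t ≤ T → 𝒳 s t = conv (𝒳 s u) (𝒳 u t)
  bound : ∀ n, ∀ x ∈ 𝒜 n, ∃ C, ∀ s t, 0 ≤ s → s ≤ t → t ≤ T → |𝒳 s t x| ≤ C * (ω s t ^ γ) ^ n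
  contDiff : ∀ i, ContDiff ℝ (N + 1) (φ i)

/-- The remainder `R(Z)_{st} = Z_t - Γ_{st} Z_s`. -/
def pathRem {e : ℕ} (𝒳 : ℝ → ℝ → Module.Dual ℝ H) (Z : ℝ → Fin e → H) (s t : ℝ) (c : Fin e) : H :=
  Z t c - translate (𝒳 s t) (Z s c)

/-- The defect of the germ `f (ℓ x)` of the rough integral, as an element of `H`. -/
def defect (ℓ : H →ₗ[ℝ] H) (f : Module.Dual ℝ H) (x y : H) : H :=
  ℓ y - translate f (ℓ x) + f (ℓ x) • (1 : H)

/-- The germ of the rough integral of `φ(Z)` against the component attached to `ℓ`. -/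
def germ {e : ℕ} (N : ℕ) (𝒳 : ℝ → ℝ → Module.Dual ℝ H) (ℓ : H →ₗ[ℝ] H)
    (φ : (Fin e → ℝ) → (Fin e → ℝ)) (Z : ℝ → Fin e → H) (u v : ℝ) : Fin e → ℝ :=
  pair (𝒳 u v) fun c => ℓ (image N φ (Z u) c)

variable {𝒜 : ℕ → Submodule ℝ H} [GradedAlgebra 𝒜] {N : ℕ} {ι : Type*} [Fintype ι]
  {b : Module.Basis ι ℝ H} {deg : ι → ℕ} {d e : ℕ} {L : Fin d → H →ₗ[ℝ] H} {γ T : ℝ}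
  {ω : ℝ → ℝ → ℝ} {𝒳 : ℝ → ℝ → Module.Dual ℝ H} {φ : Fin d → (Fin e → ℝ) → (Fin e → ℝ)}

section System

variable (S : IsRoughSystem 𝒜 N b deg L γ T ω 𝒳 φ)
include S

theorem IsRoughSystem.scale_nonneg {s t : ℝ} (hs : 0 ≤ s) (hst : s ≤ t) (ht : t ≤ T) :
    0 ≤ ω s t ^ γ :=
  Real.rpow_nonneg (S.control.nonneg s t hs hst ht) _

theorem IsRoughSystem.scale_mono {a s t b' : ℝ} (ha : 0 ≤ a) (has : a ≤ s) (hst : s ≤ t)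
    (htb : t ≤ b') (hb : b' ≤ T) : ω s t ^ γ ≤ ω a b' ^ γ :=
  Real.rpow_le_rpow (S.control.nonneg s t (ha.trans has) hst (htb.trans hb))
    (S.control.mono ha has hst htb hb) S.gamma_pos.le

/-- Increments of the rough path form a family of scaled characters, over any parameter space. -/
theorem IsRoughSystem.isScaledCharacter {α : Type*} (s t : α → ℝ) (hs : ∀ a, 0 ≤ s a)
    (hst : ∀ a, s a ≤ t a) (ht : ∀ a, t a ≤ T) :
    IsScaledCharacter 𝒜 N (fun a => ω (s a) (t a) ^ γ) fun a => 𝒳 (s a) (t a) where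
  bdd := isBigO_top.2 ⟨ω 0 T ^ γ, fun a => by
    rw [norm_one, mul_one, Real.norm_of_nonneg (S.scale_nonneg (hs a) (hst a) (ht a))]
    exact S.scale_mono le_rfl (hs a) (hst a) (ht a) le_rfl⟩
  character a := S.character _ _ (hs a) (hst a) (ht a)
  order n x hx := by
    obtain ⟨C, hC⟩ := S.bound n x hx
    refine isBigO_top.2 ⟨C, fun a => ?_⟩
    rw [Real.norm_eq_abs, Real.norm_of_nonneg (pow_nonneg (S.scale_nonneg (hs a) (hst a) (ht a)) _)]
    exact hC _ _ (hs a) (hst a) (ht a)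

/-- The central estimate: uniformly over pairs of controlled increments, the defect of the germ is
of order `r ^ (N + 1 - j)` in degree `j`, with Lipschitz dependence. -/
theorem IsRoughSystem.exists_defect_bound (M : ℝ) :
    ∃ K, 0 ≤ K ∧ ∀ s t, 0 ≤ s → s ≤ t → t ≤ T → ∀ (x y : Bool → Fin e → H) (δ : ℝ), 0 ≤ δ →
      (∀ c k, (∀ i, |b.repr (x i c) k| ≤ M) ∧ |b.repr (x true c - x false c) k| ≤ M * δ) →
      (∀ c k, (∀ i, |b.repr (y i c) k| ≤ M) ∧ |b.repr (y true c - y false c) k| ≤ M * δ) →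
      (∀ c k, (∀ i, |b.repr (y i c - translate (𝒳 s t) (x i c)) k| ≤
          M * (ω s t ^ γ) ^ (N - deg k)) ∧
        |b.repr ((y true c - translate (𝒳 s t) (x true c)) -
          (y false c - translate (𝒳 s t) (x false c))) k| ≤
            M * (δ * (ω s t ^ γ) ^ (N - deg k))) →
      ∀ l c k, (∀ i, |b.repr (defect (L l) (𝒳 s t) (image N (φ l) (x i) c)
          (image N (φ l) (y i) c)) k| ≤ K * (ω s t ^ γ) ^ (N + 1 - deg k)) ∧
        |b.repr (defect (L l) (𝒳 s t) (image N (φ l) (x true) c) (image N (φ l) (y true) c) -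
          defect (L l) (𝒳 s t) (image N (φ l) (x false) c) (image N (φ l) (y false) c)) k| ≤
            K * (δ * (ω s t ^ γ) ^ (N + 1 - deg k)) := by
  -- the parameter space over which orders of magnitude are taken
  let α := {a : ℝ × ℝ × (Bool → Fin e → H) × (Bool → Fin e → H) × ℝ //
    (0 ≤ a.1 ∧ a.1 ≤ a.2.1 ∧ a.2.1 ≤ T ∧ 0 ≤ a.2.2.2.2) ∧
    (∀ c k, (∀ i, |b.repr (a.2.2.1 i c) k| ≤ M) ∧
      |b.repr (a.2.2.1 true c - a.2.2.1 false c) k| ≤ M * a.2.2.2.2) ∧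
    (∀ c k, (∀ i, |b.repr (a.2.2.2.1 i c) k| ≤ M) ∧
      |b.repr (a.2.2.2.1 true c - a.2.2.2.1 false c) k| ≤ M * a.2.2.2.2) ∧
    (∀ c k, (∀ i, |b.repr (a.2.2.2.1 i c - translate (𝒳 a.1 a.2.1) (a.2.2.1 i c)) k| ≤
          M * (ω a.1 a.2.1 ^ γ) ^ (N - deg k)) ∧
        |b.repr ((a.2.2.2.1 true c - translate (𝒳 a.1 a.2.1) (a.2.2.1 true c)) -
          (a.2.2.2.1 false c - translate (𝒳 a.1 a.2.1) (a.2.2.1 false c))) k| ≤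
            M * (a.2.2.2.2 * (ω a.1 a.2.1 ^ γ) ^ (N - deg k)))}
  let s : α → ℝ := fun a => a.1.1
  let t : α → ℝ := fun a => a.1.2.1
  let x : α → Bool → Fin e → H := fun a => a.1.2.2.1
  let y : α → Bool → Fin e → H := fun a => a.1.2.2.2.1
  let δ : α → ℝ := fun a => a.1.2.2.2.2
  have hr : ∀ a : α, 0 ≤ ω (s a) (t a) ^ γ := fun a =>
    S.scale_nonneg a.2.1.1 a.2.1.2.1 a.2.1.2.2.1
  have hf : IsScaledCharacter 𝒜 N (fun a => ω (s a) (t a) ^ γ) fun a => 𝒳 (s a) (t a) :=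
    S.isScaledCharacter s t (fun a => a.2.1.1) (fun a => a.2.1.2.1) fun a => a.2.1.2.2.1
  have hctrl : ∀ c, Ctrl b deg N (fun a => ω (s a) (t a) ^ γ) δ (fun a => 𝒳 (s a) (t a))
      (fun a i => x a i c) fun a i => y a i c := by
    intro c
    refine ⟨fun k => Ord.of_bound (K := M) (fun a i => ?_) fun a => ?_,
      fun k => Ord.of_bound (K := M) (fun a i => ?_) fun a => ?_,
      fun k => Ord.of_bound (K := M) (fun a i => ?_) fun a => ?_⟩
    · rw [abs_one, mul_one]; exact (a.2.2.1 c k).1 i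
    · rw [abs_one, mul_one, abs_of_nonneg a.2.1.2.2.2, ← Finsupp.sub_apply, ← map_sub]
      exact (a.2.2.1 c k).2
    · rw [abs_one, mul_one]; exact (a.2.2.2.1 c k).1 i
    · rw [abs_one, mul_one, abs_of_nonneg a.2.1.2.2.2, ← Finsupp.sub_apply, ← map_sub]
      exact (a.2.2.2.1 c k).2
    · rw [abs_of_nonneg (pow_nonneg (hr a) _)]
      exact (a.2.2.2.2 c k).1 i
    · rw [abs_of_nonneg (pow_nonneg (hr a) _), abs_of_nonneg a.2.1.2.2.2, ← Finsupp.sub_apply,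
        ← map_sub]
      exact (a.2.2.2.2 c k).2
  have hdef : ∀ q : Fin d × Fin e × ι, ∃ K, 0 ≤ K ∧ ∀ a : α,
      (∀ i, |b.repr (defect (L q.1) (𝒳 (s a) (t a)) (image N (φ q.1) (x a i) q.2.1)
          (image N (φ q.1) (y a i) q.2.1)) q.2.2| ≤
            K * (ω (s a) (t a) ^ γ) ^ (N + 1 - deg q.2.2)) ∧
        |b.repr (defect (L q.1) (𝒳 (s a) (t a)) (image N (φ q.1) (x a true) q.2.1)
          (image N (φ q.1) (y a true) q.2.1) -
          defect (L q.1) (𝒳 (s a) (t a)) (image N (φ q.1) (x a false) q.2.1)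
          (image N (φ q.1) (y a false) q.2.1)) q.2.2| ≤
            K * (δ a * (ω (s a) (t a) ^ γ) ^ (N + 1 - deg q.2.2)) := by
    rintro ⟨l, c, k⟩
    have h1 := (Ctrl.image S.hopf S.one_le S.basis hf (S.contDiff l) hctrl c).cocycle S.hopf S.basis
      hf S.cocycle l
    obtain ⟨K, hK, h2⟩ := (h1 k).exists_bound
    refine ⟨K, hK, fun a => ?_⟩
    have h3 := h2 a
    rw [abs_of_nonneg (pow_nonneg (hr a) _), abs_of_nonneg a.2.1.2.2.2] at h3
    refine ⟨h3.1, ?_⟩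
    rw [map_sub, Finsupp.sub_apply]
    exact h3.2
  choose K hK0 hK using hdef
  refine ⟨∑ q, K q, Finset.sum_nonneg fun q _ => hK0 q, ?_⟩
  intro s₀ t₀ hs hst ht x₀ y₀ δ₀ hδ h1 h2 h3 l c k
  have hle : K (l, c, k) ≤ ∑ q, K q :=
    Finset.single_le_sum (fun q _ => hK0 q) (Finset.mem_univ (l, c, k))
  have h4 := hK (l, c, k) ⟨(s₀, t₀, x₀, y₀, δ₀), ⟨hs, hst, ht, hδ⟩, h1, h2, h3⟩
  have h5 := S.scale_nonneg hs hst ht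
  refine ⟨fun i => (h4.1 i).trans ?_, h4.2.trans ?_⟩
  · gcongr
  · gcongr

theorem IsRoughSystem.eta_pos : 0 < (N + 1) * γ - 1 := by linarith [S.one_lt_mul]

theorem IsRoughSystem.scale_pow {s t : ℝ} (hs : 0 ≤ s) (hst : s ≤ t) (ht : t ≤ T) :
    ω s t ^ ((N + 1) * γ - 1) * ω s t = (ω s t ^ γ) ^ (N + 1) := by
  have h0 := S.control.nonneg s t hs hst ht
  have h1 : ω s t ^ ((N + 1) * γ - 1) * ω s t =
      ω s t ^ ((N + 1) * γ - 1) * ω s t ^ (1 : ℝ) := by rw [Real.rpow_one]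
  rw [h1, ← Real.rpow_add_of_nonneg h0 S.eta_pos.le zero_le_one, ← Real.rpow_mul_natCast h0]
  congr 1
  push_cast
  ring

theorem IsRoughSystem.scale_mul_scale_le {s u t : ℝ} (hs : 0 ≤ s) (hsu : s ≤ u) (hut : u ≤ t)
    (ht : t ≤ T) {j : ℕ} (hjN : j ≤ N) :
    (ω s u ^ γ) ^ (N + 1 - j) * (ω u t ^ γ) ^ j ≤ ω s u ^ ((N + 1) * γ - 1) * ω s t := by
  have h1 := S.control.nonneg s u hs hsu (hut.trans ht)
  have h2 := S.control.nonneg u t (hs.trans hsu) hut ht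
  have h3 := S.control.nonneg s t hs (hsu.trans hut) ht
  have h4 := S.control.mono_right hs hsu hut ht
  have h5 := S.control.mono_left hs hsu hut ht
  have hjγ : (j : ℝ) * γ ≤ 1 :=
    (mul_le_mul_of_nonneg_right (by exact_mod_cast hjN) S.gamma_pos.le).trans S.mul_le_one
  have e1 : (ω s u ^ γ) ^ (N + 1 - j) =
      ω s u ^ ((N + 1) * γ - 1) * ω s u ^ (1 - j * γ) := by
    rw [← Real.rpow_mul_natCast h1, ← Real.rpow_add_of_nonneg h1 S.eta_pos.le (by linarith)]
    congr 1
    rw [Nat.cast_sub (by omega)]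
    push_cast
    ring
  have e2 : (ω u t ^ γ) ^ j = ω u t ^ (j * γ) := by
    rw [← Real.rpow_mul_natCast h2, mul_comm]
  have hjγ0 : 0 ≤ (j : ℝ) * γ := mul_nonneg (Nat.cast_nonneg j) S.gamma_pos.le
  have e3 : ω s t ^ (1 - j * γ) * ω s t ^ (j * γ) = ω s t := by
    rw [← Real.rpow_add_of_nonneg h3 (by linarith) hjγ0, sub_add_cancel, Real.rpow_one]
  have i1 : ω s u ^ (1 - j * γ) ≤ ω s t ^ (1 - j * γ) :=
    Real.rpow_le_rpow h1 h4 (by linarith)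
  have i2 : ω u t ^ (j * γ) ≤ ω s t ^ (j * γ) := Real.rpow_le_rpow h2 h5 hjγ0
  rw [e1, e2]
  calc _ ≤ ω s u ^ ((N + 1) * γ - 1) * ω s t ^ (1 - j * γ) * ω s t ^ (j * γ) := by
        have := Real.rpow_nonneg h1 (1 - j * γ)
        gcongr
    _ = _ := by rw [mul_assoc, e3]

theorem IsRoughSystem.exists_apply_bound : ∃ C, 0 ≤ C ∧ ∀ s u t, 0 ≤ s → s ≤ u → u ≤ t → t ≤ T →
    ∀ (D : H) (K : ℝ), 0 ≤ K → (∀ k, deg k = 0 → b.repr D k = 0) →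
      (∀ k, |b.repr D k| ≤ K * (ω s u ^ γ) ^ (N + 1 - deg k)) →
      |𝒳 u t D| ≤ C * K * ω s u ^ ((N + 1) * γ - 1) * ω s t := by
  choose C hC using fun k => S.bound (deg k) (b k) (S.basis.mem k)
  refine ⟨∑ k, |C k|, Finset.sum_nonneg fun k _ => abs_nonneg _, ?_⟩
  intro s u t hs hsu hut ht D K hK h0 hD
  have hsum : 𝒳 u t D = ∑ k, b.repr D k * 𝒳 u t (b k) := by
    conv_lhs => rw [← b.sum_repr D, map_sum]
    simp only [map_smul, smul_eq_mul]
  rw [hsum, Finset.sum_mul, Finset.sum_mul, Finset.sum_mul]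
  refine (Finset.abs_sum_le_sum_abs _ _).trans (Finset.sum_le_sum fun k _ => ?_)
  have hr1 := S.scale_nonneg hs hsu (hut.trans ht)
  have hr2 := S.scale_nonneg (hs.trans hsu) hut ht
  have hpos : 0 ≤ ω s u ^ ((N + 1) * γ - 1) * ω s t :=
    mul_nonneg (Real.rpow_nonneg (S.control.nonneg s u hs hsu (hut.trans ht)) _)
      (S.control.nonneg s t hs (hsu.trans hut) ht)
  rcases Nat.eq_zero_or_pos (deg k) with hk | hk
  · rw [h0 k hk, zero_mul, abs_zero, mul_assoc]
    positivity
  · rw [abs_mul]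
    have h1 : |𝒳 u t (b k)| ≤ |C k| * (ω u t ^ γ) ^ deg k :=
      (hC k u t (hs.trans hsu) hut ht).trans
        (mul_le_mul_of_nonneg_right (le_abs_self _) (pow_nonneg hr2 _))
    calc _ ≤ K * (ω s u ^ γ) ^ (N + 1 - deg k) * (|C k| * (ω u t ^ γ) ^ deg k) :=
          mul_le_mul (hD k) h1 (abs_nonneg _) (by positivity)
      _ = |C k| * K * ((ω s u ^ γ) ^ (N + 1 - deg k) * (ω u t ^ γ) ^ deg k) := by ring
      _ ≤ |C k| * K * (ω s u ^ ((N + 1) * γ - 1) * ω s t) := by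
          exact mul_le_mul_of_nonneg_left (S.scale_mul_scale_le hs hsu hut ht (S.basis.deg_le k))
            (by positivity)
      _ = _ := by ring

theorem IsRoughSystem.germ_defect (l : Fin d) (Z : ℝ → Fin e → H) {s u t : ℝ} (hs : 0 ≤ s)
    (hsu : s ≤ u) (hut : u ≤ t) (ht : t ≤ T) (c : Fin e) :
    (germ N 𝒳 (L l) (φ l) Z s t - germ N 𝒳 (L l) (φ l) Z s u - germ N 𝒳 (L l) (φ l) Z u t) c =
      -𝒳 u t (defect (L l) (𝒳 s u) (image N (φ l) (Z s) c) (image N (φ l) (Z u) c)) := by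
  simp only [germ, pair, Pi.sub_apply, defect, map_add, map_sub, map_smul,
    (S.character u t (hs.trans hsu) hut ht).map_one, smul_eq_mul, mul_one]
  rw [S.chen s u t hs hsu hut ht, conv_apply]
  ring

end System

/-- Bounds for a pair of paths on `[s, t] ⊆ [a, b']` and for their remainders, the differences being
measured in units of `δ`. -/
structure PairBound (N : ℕ) (b : Module.Basis ι ℝ H) (deg : ι → ℕ) (γ : ℝ) (ω : ℝ → ℝ → ℝ)
    (𝒳 : ℝ → ℝ → Module.Dual ℝ H) {e : ℕ} (a b' M δ : ℝ) (Z : Bool → ℝ → Fin e → H) : Prop where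
  bdd : ∀ i t, a ≤ t → t ≤ b' → ∀ c k, |b.repr (Z i t c) k| ≤ M
  lip : ∀ t, a ≤ t → t ≤ b' → ∀ c k, |b.repr (Z true t c - Z false t c) k| ≤ M * δ
  rem : ∀ i s t, a ≤ s → s ≤ t → t ≤ b' → ∀ c k,
    |b.repr (pathRem 𝒳 (Z i) s t c) k| ≤ M * (ω s t ^ γ) ^ (N - deg k)
  rem_lip : ∀ s t, a ≤ s → s ≤ t → t ≤ b' → ∀ c k,
    |b.repr (pathRem 𝒳 (Z true) s t c - pathRem 𝒳 (Z false) s t c) k| ≤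
      M * (δ * (ω s t ^ γ) ^ (N - deg k))

variable (S : IsRoughSystem 𝒜 N b deg L γ T ω 𝒳 φ)
include S

theorem IsRoughSystem.exists_germ_bound (M : ℝ) : ∃ K, 0 ≤ K ∧ ∀ a b', 0 ≤ a → b' ≤ T →
    ∀ δ, 0 ≤ δ → ∀ Z : Bool → ℝ → Fin e → H, PairBound N b deg γ ω 𝒳 a b' M δ Z →
      (∀ l i s t, a ≤ s → s ≤ t → t ≤ b' → ∀ c k, |b.repr (defect (L l) (𝒳 s t)
        (image N (φ l) (Z i s) c) (image N (φ l) (Z i t) c)) k| ≤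
          K * (ω s t ^ γ) ^ (N + 1 - deg k)) ∧
      (∀ l s t, a ≤ s → s ≤ t → t ≤ b' → ∀ c k, |b.repr (defect (L l) (𝒳 s t)
        (image N (φ l) (Z true s) c) (image N (φ l) (Z true t) c) - defect (L l) (𝒳 s t)
        (image N (φ l) (Z false s) c) (image N (φ l) (Z false t) c)) k| ≤
          K * (δ * (ω s t ^ γ) ^ (N + 1 - deg k))) ∧
      (∀ l i, IsAlmostAdditive ω ((N + 1) * γ - 1) K (germ N 𝒳 (L l) (φ l) (Z i)) a b') ∧
      ∀ l, IsAlmostAdditive ω ((N + 1) * γ - 1) (K * δ) (fun u v =>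
        germ N 𝒳 (L l) (φ l) (Z true) u v - germ N 𝒳 (L l) (φ l) (Z false) u v) a b' := by
  obtain ⟨K, hK, HK⟩ := S.exists_defect_bound M
  obtain ⟨C, hC, HC⟩ := S.exists_apply_bound
  refine ⟨K + C * K, by positivity, fun a b' ha hb δ hδ Z hZ => ?_⟩
  have hKle : K ≤ K + C * K := le_add_of_nonneg_right (by positivity)
  have key := fun (s t : ℝ) (h1 : a ≤ s) (h2 : s ≤ t) (h3 : t ≤ b') =>
    HK s t (ha.trans h1) h2 (h3.trans hb) (fun i => Z i s) (fun i => Z i t) δ hδ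
      (fun c k => ⟨fun i => hZ.bdd i s h1 (h2.trans h3) c k, hZ.lip s h1 (h2.trans h3) c k⟩)
      (fun c k => ⟨fun i => hZ.bdd i t (h1.trans h2) h3 c k, hZ.lip t (h1.trans h2) h3 c k⟩)
      fun c k => ⟨fun i => hZ.rem i s t h1 h2 h3 c k, hZ.rem_lip s t h1 h2 h3 c k⟩
  refine ⟨fun l i s t h1 h2 h3 c k => ?_, fun l s t h1 h2 h3 c k => ?_,
    fun l i s u t h1 h2 h3 h4 => ?_, fun l s u t h1 h2 h3 h4 => ?_⟩
  · have h5 := S.scale_nonneg (ha.trans h1) h2 (h3.trans hb)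
    refine ((key s t h1 h2 h3 l c k).1 i).trans ?_
    gcongr
  · have h5 := S.scale_nonneg (ha.trans h1) h2 (h3.trans hb)
    refine ((key s t h1 h2 h3 l c k).2).trans ?_
    gcongr
  · have h5 := S.control.nonneg s u (ha.trans h1) h2 ((h3.trans h4).trans hb)
    have h6 := S.control.nonneg s t (ha.trans h1) (h2.trans h3) (h4.trans hb)
    refine (pi_norm_le_iff_of_nonneg (by positivity)).2 fun c => ?_
    rw [S.germ_defect l (Z i) (ha.trans h1) h2 h3 (h4.trans hb), norm_neg, Real.norm_eq_abs]
    refine (HC s u t (ha.trans h1) h2 h3 (h4.trans hb) _ K hK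
      (fun k hk => repr_cocycle_eq_zero S.hopf S.basis S.cocycle l _ _ _ hk)
      fun k => (key s u h1 h2 (h3.trans h4) l c k).1 i).trans ?_
    gcongr
    linarith
  · have h5 := S.control.nonneg s u (ha.trans h1) h2 ((h3.trans h4).trans hb)
    have h6 := S.control.nonneg s t (ha.trans h1) (h2.trans h3) (h4.trans hb)
    refine (pi_norm_le_iff_of_nonneg (by positivity)).2 fun c => ?_
    have heq : (germ N 𝒳 (L l) (φ l) (Z true) s t - germ N 𝒳 (L l) (φ l) (Z false) s t -
        (germ N 𝒳 (L l) (φ l) (Z true) s u - germ N 𝒳 (L l) (φ l) (Z false) s u) -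
        (germ N 𝒳 (L l) (φ l) (Z true) u t - germ N 𝒳 (L l) (φ l) (Z false) u t)) c =
        -𝒳 u t (defect (L l) (𝒳 s u) (image N (φ l) (Z true s) c) (image N (φ l) (Z true u) c) -
          defect (L l) (𝒳 s u) (image N (φ l) (Z false s) c) (image N (φ l) (Z false u) c)) := by
      have e1 := S.germ_defect l (Z true) (ha.trans h1) h2 h3 (h4.trans hb) c
      have e2 := S.germ_defect l (Z false) (ha.trans h1) h2 h3 (h4.trans hb) c
      simp only [Pi.sub_apply] at e1 e2 ⊢
      rw [map_sub]
      linarith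
    rw [heq, norm_neg, Real.norm_eq_abs]
    refine (HC s u t (ha.trans h1) h2 h3 (h4.trans hb) _ (K * δ) (by positivity)
      (fun k hk => ?_) fun k => ((key s u h1 h2 (h3.trans h4) l c k).2).trans_eq
        (by rw [mul_assoc])).trans ?_
    · rw [map_sub, Finsupp.sub_apply, defect, defect,
        repr_cocycle_eq_zero S.hopf S.basis S.cocycle l _ _ _ hk,
        repr_cocycle_eq_zero S.hopf S.basis S.cocycle l _ _ _ hk, sub_zero]
    · have : C * (K * δ) ≤ (K + C * K) * δ := by nlinarith [mul_nonneg hK hδ]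
      gcongr

/-- The lifted integral gains one power of the scale over the integrand. -/
theorem IsRoughSystem.exists_integral_bound (M : ℝ) (y : Fin e → ℝ) : ∃ K, 0 ≤ K ∧
    ∀ a b', 0 ≤ a → b' ≤ T → ∀ δ, 0 ≤ δ →
    ∀ Z W : Bool → ℝ → Fin e → H, PairBound N b deg γ ω 𝒳 a b' M δ Z →
    ∀ J : Bool → Fin d → ℝ → Fin e → ℝ,
    (∀ i l s t, a ≤ s → s ≤ t → t ≤ b' →
      IsRRSLimit (germ N 𝒳 (L l) (φ l) (Z i)) s t (J i l t - J i l s)) →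
    (∀ i t, a ≤ t → t ≤ b' → ∀ c, W i t c =
      y c • (1 : H) + ∑ l, (L l (image N (φ l) (Z i t) c) + J i l t c • (1 : H))) →
    (∀ i s t, a ≤ s → s ≤ t → t ≤ b' → ∀ c k,
      |b.repr (pathRem 𝒳 (W i) s t c) k| ≤ K * (ω s t ^ γ) ^ (N + 1 - deg k)) ∧
    ∀ s t, a ≤ s → s ≤ t → t ≤ b' → ∀ c k,
      |b.repr (pathRem 𝒳 (W true) s t c - pathRem 𝒳 (W false) s t c) k| ≤
        K * (δ * (ω s t ^ γ) ^ (N + 1 - deg k)) := by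
  obtain ⟨K, hK, HK⟩ := S.exists_germ_bound M
  obtain ⟨hκ, -⟩ := sewingConst_spec S.eta_pos
  set κ := sewingConst ((N + 1) * γ - 1)
  set C₁ : ℝ := ∑ k, |b.repr 1 k| with hC₁
  have hC₁0 : 0 ≤ C₁ := Finset.sum_nonneg fun k _ => abs_nonneg _
  refine ⟨d * (K + κ * K * C₁), by positivity, ?_⟩
  intro a b' ha hb δ hδ Z W hZ J hJ hW
  obtain ⟨h1, h2, h3, h4⟩ := HK a b' ha hb δ hδ Z hZ
  have hrem : ∀ i s t, a ≤ s → s ≤ t → t ≤ b' → ∀ c, pathRem 𝒳 (W i) s t c =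
      ∑ l, (defect (L l) (𝒳 s t) (image N (φ l) (Z i s) c) (image N (φ l) (Z i t) c) +
        ((J i l t - J i l s) - germ N 𝒳 (L l) (φ l) (Z i) s t) c • (1 : H)) := by
    intro i s t hs hst ht c
    have h0 : ∀ x : ℝ, translate (𝒳 s t) (x • (1 : H)) = x • (1 : H) := fun x => by
      rw [map_smul, translate_one S.hopf,
        (S.character s t (ha.trans hs) hst (ht.trans hb)).map_one, one_smul]
    rw [pathRem, hW i t (hs.trans hst) ht, hW i s hs (hst.trans ht), map_add, map_sum, h0,
      add_sub_add_left_eq_sub, ← Finset.sum_sub_distrib]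
    refine Finset.sum_congr rfl fun l _ => ?_
    simp only [map_add, h0, defect, germ, pair, Pi.sub_apply, sub_smul]
    abel
  -- the coordinates of `1` live in degree `0`
  have hone : ∀ (x q : ℝ), 0 ≤ q → ∀ s t, a ≤ s → s ≤ t → t ≤ b' →
      |x| ≤ q * ω s t ^ ((N + 1) * γ - 1) * ω s t → ∀ k,
      |b.repr (x • (1 : H)) k| ≤ q * C₁ * (ω s t ^ γ) ^ (N + 1 - deg k) := by
    intro x q hq s t hs hst ht hx k
    have hr := S.scale_nonneg (ha.trans hs) hst (ht.trans hb)
    rw [map_smul, Finsupp.smul_apply, smul_eq_mul, abs_mul]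
    by_cases hk : deg k = 0
    · have h5 : |b.repr 1 k| ≤ C₁ :=
        Finset.single_le_sum (f := fun k => |b.repr 1 k|) (fun k _ => abs_nonneg _)
          (Finset.mem_univ k)
      rw [mul_assoc, S.scale_pow (ha.trans hs) hst (ht.trans hb)] at hx
      rw [hk, Nat.sub_zero]
      calc _ ≤ q * (ω s t ^ γ) ^ (N + 1) * C₁ := by gcongr
        _ = _ := by ring
    · rw [S.basis.repr_eq_zero 0 1 (SetLike.one_mem_graded 𝒜) k hk, abs_zero, mul_zero]
      positivity
  have hηpos := S.eta_pos
  refine ⟨fun i s t hs hst ht c k => ?_, fun s t hs hst ht c k => ?_⟩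
  · rw [hrem i s t hs hst ht c, map_sum, Finsupp.finsetSum_apply]
    refine (Finset.abs_sum_le_sum_abs _ _).trans ?_
    have : ∀ l ∈ Finset.univ, |b.repr (defect (L l) (𝒳 s t) (image N (φ l) (Z i s) c)
        (image N (φ l) (Z i t) c) +
        ((J i l t - J i l s) - germ N 𝒳 (L l) (φ l) (Z i) s t) c • (1 : H)) k| ≤
        (K + κ * K * C₁) * (ω s t ^ γ) ^ (N + 1 - deg k) := by
      intro l _
      have h5 := IsRRSLimit.norm_sub_le S.control hηpos hK (ha.trans hs) hst (ht.trans hb)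
        ((h3 l i).restrict hs ht) (hJ i l s t hs hst ht)
      have h6 := hone _ (κ * K) (by positivity) s t hs hst ht ((norm_le_pi_norm _ c).trans h5) k
      rw [map_add, Finsupp.add_apply, add_mul]
      exact (abs_add_le _ _).trans (add_le_add (h1 l i s t hs hst ht c k) h6)
    refine (Finset.sum_le_card_nsmul _ _ _ this).trans_eq ?_
    rw [Finset.card_univ, Fintype.card_fin, nsmul_eq_mul]
    ring
  · have heq : pathRem 𝒳 (W true) s t c - pathRem 𝒳 (W false) s t c =
        ∑ l, ((defect (L l) (𝒳 s t) (image N (φ l) (Z true s) c) (image N (φ l) (Z true t) c) -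
          defect (L l) (𝒳 s t) (image N (φ l) (Z false s) c) (image N (φ l) (Z false t) c)) +
        (((J true l t - J true l s) - (J false l t - J false l s)) -
          (germ N 𝒳 (L l) (φ l) (Z true) s t - germ N 𝒳 (L l) (φ l) (Z false) s t)) c •
            (1 : H)) := by
      rw [hrem true s t hs hst ht c, hrem false s t hs hst ht c, ← Finset.sum_sub_distrib]
      refine Finset.sum_congr rfl fun l _ => ?_
      simp only [Pi.sub_apply, sub_smul]
      abel
    rw [heq, map_sum, Finsupp.finsetSum_apply]
    refine (Finset.abs_sum_le_sum_abs _ _).trans ?_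
    have : ∀ l ∈ Finset.univ, |b.repr ((defect (L l) (𝒳 s t) (image N (φ l) (Z true s) c)
        (image N (φ l) (Z true t) c) -
          defect (L l) (𝒳 s t) (image N (φ l) (Z false s) c) (image N (φ l) (Z false t) c)) +
        (((J true l t - J true l s) - (J false l t - J false l s)) -
          (germ N 𝒳 (L l) (φ l) (Z true) s t - germ N 𝒳 (L l) (φ l) (Z false) s t)) c •
            (1 : H)) k| ≤
        (K + κ * K * C₁) * (δ * (ω s t ^ γ) ^ (N + 1 - deg k)) := by
      intro l _
      have h5 := IsRRSLimit.norm_sub_le S.control hηpos (mul_nonneg hK hδ) (ha.trans hs) hst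
        (ht.trans hb) ((h4 l).restrict hs ht)
        ((hJ true l s t hs hst ht).sub (hJ false l s t hs hst ht))
      have h6 := hone _ (κ * (K * δ)) (by positivity) s t hs hst ht
        ((norm_le_pi_norm _ c).trans h5) k
      rw [map_add, Finsupp.add_apply, add_mul]
      refine (abs_add_le _ _).trans (add_le_add (h2 l s t hs hst ht c k) (h6.trans_eq ?_))
      ring
    refine (Finset.sum_le_card_nsmul _ _ _ this).trans_eq ?_
    rw [Finset.card_univ, Fintype.card_fin, nsmul_eq_mul]
    ring

end Integral

/-! ### The algebraic part of the equation -/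

section AlgebraicLift

variable {H : Type*} [CommRing H] [Algebra ℝ H] [Coalgebra ℝ H]
  {𝒜 : ℕ → Submodule ℝ H} [GradedAlgebra 𝒜] {N : ℕ} {ι : Type*} [Fintype ι]
  {b : Module.Basis ι ℝ H} {deg : ι → ℕ} {d e : ℕ} {L : Fin d → H →ₗ[ℝ] H}

/-- The map `z ↦ v 1 + ∑ L_l (φ_l(z))`. At a fixed time the equation says that `Z_t` is a fixed
point of this map, `v` being the value of the underlying path. -/
def liftMap (N : ℕ) (L : Fin d → H →ₗ[ℝ] H) (φ : Fin d → (Fin e → ℝ) → (Fin e → ℝ))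
    (v : Fin e → ℝ) (z : Fin e → H) (c : Fin e) : H :=
  v c • (1 : H) + ∑ l, L l (image N (φ l) z c)

theorem pair_counit_liftMap (hH : IsTruncatedHopfAlgebra 𝒜 N) (hL : IsCocycleFamily 𝒜 N L)
    (φ : Fin d → (Fin e → ℝ) → (Fin e → ℝ)) (v : Fin e → ℝ) (z : Fin e → H) :
    pair Coalgebra.counit (liftMap N L φ v z) = v := by
  have h0 : ∀ l (x : H), Coalgebra.counit (R := ℝ) (L l x) = 0 := by
    intro l x
    induction x using DirectSum.Decomposition.inductionOn 𝒜 with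
    | zero => simp
    | add x y hx hy => rw [map_add, map_add, hx, hy, add_zero]
    | @homogeneous n x =>
      exact hH.counit_graded (n + 1) n.succ_pos _ (hL.degree_one l n _ x.2)
  funext c
  simp [pair, liftMap, h0, hH.counit_one]

theorem liftMap_sub_mem_degreeIdeal (hH : IsTruncatedHopfAlgebra 𝒜 N)
    (hb : IsHomogeneousBasis 𝒜 N b deg) (hL : IsCocycleFamily 𝒜 N L)
    (φ : Fin d → (Fin e → ℝ) → (Fin e → ℝ)) (v : Fin e → ℝ) {z z' : Fin e → H}
    (hε : pair (Coalgebra.counit (R := ℝ)) z = pair Coalgebra.counit z') {n : ℕ}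
    (h : ∀ j, z j - z' j ∈ degreeIdeal hb n) (c : Fin e) :
    liftMap N L φ v z c - liftMap N L φ v z' c ∈ degreeIdeal hb (n + 1) := by
  rw [liftMap, liftMap, add_sub_add_left_eq_sub, ← Finset.sum_sub_distrib]
  refine Ideal.sum_mem _ fun l _ => ?_
  rw [← map_sub]
  exact map_mem_degreeIdeal hL l (image_sub_mem_degreeIdeal hH hb (φ l) hε h c)

/-- Agreement up to degree `n` improves to agreement up to degree `n + 1`. -/
theorem eq_of_eq_liftMap (hH : IsTruncatedHopfAlgebra 𝒜 N) (hb : IsHomogeneousBasis 𝒜 N b deg)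
    (hL : IsCocycleFamily 𝒜 N L) {φ : Fin d → (Fin e → ℝ) → (Fin e → ℝ)} {v : Fin e → ℝ}
    {z z' : Fin e → H} (hz : z = liftMap N L φ v z) (hz' : z' = liftMap N L φ v z') : z = z' := by
  have hε : pair (Coalgebra.counit (R := ℝ)) z = pair Coalgebra.counit z' := by
    rw [hz, hz', pair_counit_liftMap hH hL, pair_counit_liftMap hH hL]
  have key : ∀ n c, z c - z' c ∈ degreeIdeal hb n := by
    intro n
    induction n with
    | zero => exact fun c k hk => absurd hk (Nat.not_lt_zero _)
    | succ n ih =>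
      intro c
      rw [hz, hz']
      exact liftMap_sub_mem_degreeIdeal hH hb hL φ v hε ih c
  exact funext fun c => sub_eq_zero.1 (eq_zero_of_mem_degreeIdeal (key (N + 1) c))

theorem exists_eq_liftMap (hH : IsTruncatedHopfAlgebra 𝒜 N) (hb : IsHomogeneousBasis 𝒜 N b deg)
    (hL : IsCocycleFamily 𝒜 N L) (φ : Fin d → (Fin e → ℝ) → (Fin e → ℝ)) (v : Fin e → ℝ) :
    ∃ z : Fin e → H, z = liftMap N L φ v z := by
  have key : ∀ n, ∃ z : Fin e → H, pair Coalgebra.counit z = v ∧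
      ∀ c, liftMap N L φ v z c - z c ∈ degreeIdeal hb n := by
    intro n
    induction n with
    | zero =>
      exact ⟨fun c => v c • (1 : H), by funext c; simp [pair, hH.counit_one],
        fun c k hk => absurd hk (Nat.not_lt_zero _)⟩
    | succ n ih =>
      obtain ⟨z, hz, h⟩ := ih
      refine ⟨liftMap N L φ v z, pair_counit_liftMap hH hL φ v z, ?_⟩
      exact liftMap_sub_mem_degreeIdeal hH hb hL φ v
        ((pair_counit_liftMap hH hL φ v z).trans hz.symm) h
  obtain ⟨z, -, hz⟩ := key (N + 1)
  exact ⟨z, funext fun c => (sub_eq_zero.1 (eq_zero_of_mem_degreeIdeal (hz c))).symm⟩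

end AlgebraicLift

/-! ### Contraction on short intervals -/

section Contraction

open Asymptotics Filter Topology

variable {H : Type*} [CommRing H] [Algebra ℝ H] [Coalgebra ℝ H]
  {𝒜 : ℕ → Submodule ℝ H} [GradedAlgebra 𝒜] {N : ℕ} {ι : Type*} [Fintype ι]
  {b : Module.Basis ι ℝ H} {deg : ι → ℕ} {d e : ℕ} {L : Fin d → H →ₗ[ℝ] H} {γ T : ℝ}
  {ω : ℝ → ℝ → ℝ} {𝒳 : ℝ → ℝ → Module.Dual ℝ H} {φ : Fin d → (Fin e → ℝ) → (Fin e → ℝ)}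

/-- A pair of paths with the same value at `a`, with bounds for their remainders on `[a, b']` and
for the difference of the latter, measured in units of `δ`. -/
structure RemBound (b : Module.Basis ι ℝ H) (deg : ι → ℕ) (N : ℕ) (γ : ℝ) (ω : ℝ → ℝ → ℝ)
    (𝒳 : ℝ → ℝ → Module.Dual ℝ H) {e : ℕ} (a b' M₀ M₁ δ : ℝ) (Z : Bool → ℝ → Fin e → H) :
    Prop where
  start : Z true a = Z false a
  bdd : ∀ i c k, |b.repr (Z i a c) k| ≤ M₀
  rem : ∀ i s t, a ≤ s → s ≤ t → t ≤ b' → ∀ c k,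
    |b.repr (pathRem 𝒳 (Z i) s t c) k| ≤ M₁ * (ω s t ^ γ) ^ (N - deg k)
  rem_lip : ∀ s t, a ≤ s → s ≤ t → t ≤ b' → ∀ c k,
    |b.repr (pathRem 𝒳 (Z true) s t c - pathRem 𝒳 (Z false) s t c) k| ≤
      M₁ * (δ * (ω s t ^ γ) ^ (N - deg k))

variable (S : IsRoughSystem 𝒜 N b deg L γ T ω 𝒳 φ)
include S

theorem IsRoughSystem.exists_translate_bound : ∃ C, 0 ≤ C ∧ ∀ s t, 0 ≤ s → s ≤ t → t ≤ T →
    ∀ (x : H) (M : ℝ), (∀ k, |b.repr x k| ≤ M) → ∀ k, |b.repr (translate (𝒳 s t) x) k| ≤ C * M := by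
  let α := {a : ℝ × ℝ // 0 ≤ a.1 ∧ a.1 ≤ a.2 ∧ a.2 ≤ T}
  have hf := S.isScaledCharacter (α := α) (fun a => a.1.1) (fun a => a.1.2) (fun a => a.2.1)
    (fun a => a.2.2.1) fun a => a.2.2.2
  have h1 : ∀ m k, ∃ C, ∀ a : α, |b.repr (translate (𝒳 a.1.1 a.1.2) (b m)) k| ≤ C := by
    intro m k
    have h2 := (translate_isBigO S.hopf S.basis hf (S.basis.mem m) k).trans
      (hf.bdd.pow (deg m - deg k))
    obtain ⟨C, hC⟩ := isBigO_top.1 h2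
    exact ⟨C, fun a => by simpa using hC a⟩
  choose C hC using h1
  refine ⟨∑ m, ∑ k, |C m k|, Finset.sum_nonneg fun m _ => Finset.sum_nonneg fun k _ => abs_nonneg _,
    fun s t hs hst ht x M hx k => ?_⟩
  rw [repr_map_eq_sum (translate (𝒳 s t)) x k, Finset.sum_mul]
  refine (Finset.abs_sum_le_sum_abs _ _).trans (Finset.sum_le_sum fun m _ => ?_)
  have h3 : |b.repr (translate (𝒳 s t) (b m)) k| ≤ ∑ k, |C m k| :=
    ((hC m k ⟨(s, t), hs, hst, ht⟩).trans (le_abs_self _)).trans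
      (Finset.single_le_sum (f := fun k => |C m k|) (fun k _ => abs_nonneg _) (Finset.mem_univ k))
  rw [abs_mul, mul_comm]
  exact mul_le_mul h3 (hx m) (abs_nonneg _) ((abs_nonneg _).trans h3)

theorem IsRoughSystem.translate_diag {t : ℝ} (h0 : 0 ≤ t) (hT : t ≤ T) (x : H) :
    translate (𝒳 t t) x = x := by
  have h : 𝒳 t t = Coalgebra.counit := by
    refine LinearMap.ext fun x => ?_
    induction x using DirectSum.Decomposition.inductionOn 𝒜 with
    | zero => simp
    | add x y hx hy => rw [map_add, map_add, hx, hy]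
    | @homogeneous n x =>
      rcases Nat.eq_zero_or_pos n with rfl | hn
      · obtain ⟨c, hc⟩ := Submodule.mem_span_singleton.1 (S.hopf.connected.le x.2)
        rw [← hc, map_smul, map_smul, (S.character t t h0 le_rfl hT).map_one, S.hopf.counit_one]
      · obtain ⟨C, hC⟩ := S.bound n x x.2
        have h1 := hC t t h0 le_rfl hT
        rw [S.control.diag t h0 hT, Real.zero_rpow S.gamma_pos.ne', zero_pow hn.ne', mul_zero,
          abs_nonpos_iff] at h1
        rw [h1, S.hopf.counit_graded n hn _ x.2]
  rw [h, translate_apply, contract, LinearMap.comp_apply, Coalgebra.rTensor_counit_comul]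
  simp

theorem IsRoughSystem.exists_pairBound (M₀ M₁ : ℝ) (h0 : 0 ≤ M₀) (h1 : 0 ≤ M₁) :
    ∃ M, 0 ≤ M ∧ ∀ a b', 0 ≤ a → b' ≤ T → ∀ δ, 0 ≤ δ → ∀ Z : Bool → ℝ → Fin e → H,
      RemBound b deg N γ ω 𝒳 a b' M₀ M₁ δ Z → PairBound N b deg γ ω 𝒳 a b' M δ Z := by
  obtain ⟨C, hC, HC⟩ := S.exists_translate_bound
  set R : ℝ := (max 1 (ω 0 T ^ γ)) ^ N with hR
  have hR0 : 0 ≤ R := by positivity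
  have hscale : ∀ s t, 0 ≤ s → s ≤ t → t ≤ T → ∀ k, (ω s t ^ γ) ^ (N - deg k) ≤ R := by
    intro s t hs hst ht k
    calc (ω s t ^ γ) ^ (N - deg k) ≤ (max 1 (ω 0 T ^ γ)) ^ (N - deg k) :=
          pow_le_pow_left₀ (S.scale_nonneg hs hst ht)
            ((S.scale_mono le_rfl hs hst ht le_rfl).trans (le_max_right _ _)) _
      _ ≤ R := pow_le_pow_right₀ (le_max_left _ _) (Nat.sub_le _ _)
  refine ⟨C * M₀ + M₁ * R + M₁, by positivity, fun a b' ha hb δ hδ Z hZ => ?_⟩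
  have hM₁ : M₁ ≤ C * M₀ + M₁ * R + M₁ := le_add_of_nonneg_left (by positivity)
  refine ⟨fun i t hat htb c k => ?_, fun t hat htb c k => ?_, fun i s t hs hst ht c k => ?_,
    fun s t hs hst ht c k => ?_⟩
  · have h2 := HC a t ha hat (htb.trans hb) _ M₀ (hZ.bdd i c) k
    have h3 := (hZ.rem i a t le_rfl hat htb c k).trans
      (mul_le_mul_of_nonneg_left (hscale a t ha hat (htb.trans hb) k) h1)
    have h4 : Z i t c = translate (𝒳 a t) (Z i a c) + pathRem 𝒳 (Z i) a t c := by
      rw [pathRem, add_sub_cancel]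
    rw [h4, map_add, Finsupp.add_apply]
    linarith [abs_add_le (b.repr (translate (𝒳 a t) (Z i a c)) k)
      (b.repr (pathRem 𝒳 (Z i) a t c) k)]
  · have h3 := (hZ.rem_lip a t le_rfl hat htb c k).trans (mul_le_mul_of_nonneg_left
      (mul_le_mul_of_nonneg_left (hscale a t ha hat (htb.trans hb) k) hδ) h1)
    have h4 : Z true t c - Z false t c =
        pathRem 𝒳 (Z true) a t c - pathRem 𝒳 (Z false) a t c := by
      rw [pathRem, pathRem, hZ.start, sub_sub_sub_cancel_right]
    rw [h4]
    refine h3.trans ?_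
    calc M₁ * (δ * R) = (M₁ * R) * δ := by ring
      _ ≤ _ := by
        refine mul_le_mul_of_nonneg_right ?_ hδ
        have : 0 ≤ C * M₀ := by positivity
        linarith
  · have h5 := S.scale_nonneg (ha.trans hs) hst (ht.trans hb)
    refine (hZ.rem i s t hs hst ht c k).trans ?_
    gcongr
  · have h5 := S.scale_nonneg (ha.trans hs) hst (ht.trans hb)
    refine (hZ.rem_lip s t hs hst ht c k).trans ?_
    gcongr

/-- On intervals of small control the extra power of the scale gained by the lifted integral makes
the solution map a contraction for the remainders. -/
theorem IsRoughSystem.exists_contraction (M₀ M₁ : ℝ) (h0 : 0 ≤ M₀) (h1 : 0 ≤ M₁)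
    (y : Fin e → ℝ) : ∃ M ε, 0 ≤ M ∧ 0 < ε ∧ ∀ a b', 0 ≤ a → a ≤ b' → b' ≤ T → ω a b' < ε →
      ∀ δ, 0 ≤ δ → ∀ Z W : Bool → ℝ → Fin e → H, RemBound b deg N γ ω 𝒳 a b' M₀ M₁ δ Z →
      PairBound N b deg γ ω 𝒳 a b' M δ Z ∧
      ∀ J : Bool → Fin d → ℝ → Fin e → ℝ,
      (∀ i l s t, a ≤ s → s ≤ t → t ≤ b' →
        IsRRSLimit (germ N 𝒳 (L l) (φ l) (Z i)) s t (J i l t - J i l s)) →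
      (∀ i t, a ≤ t → t ≤ b' → W i t = liftMap N L φ (y + ∑ l, J i l t) (Z i t)) →
      (∀ i s t, a ≤ s → s ≤ t → t ≤ b' → ∀ c k,
        |b.repr (pathRem 𝒳 (W i) s t c) k| ≤ (ω s t ^ γ) ^ (N - deg k)) ∧
      ∀ s t, a ≤ s → s ≤ t → t ≤ b' → ∀ c k,
        |b.repr (pathRem 𝒳 (W true) s t c - pathRem 𝒳 (W false) s t c) k| ≤
          δ / 2 * (ω s t ^ γ) ^ (N - deg k) := by
  obtain ⟨M, hM, HM⟩ := S.exists_pairBound (e := e) M₀ M₁ h0 h1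
  obtain ⟨K, hK, HK⟩ := S.exists_integral_bound M y
  have hq : 0 < 1 / (2 * (K + 1)) := by positivity
  refine ⟨M, (1 / (2 * (K + 1))) ^ (1 / γ), hM, Real.rpow_pos_of_pos hq _, ?_⟩
  intro a b' ha hab hb hsmall δ hδ Z W hZ
  have hP := HM a b' ha hb δ hδ Z hZ
  refine ⟨hP, fun J hJ hW => ?_⟩
  have hω0 := S.control.nonneg a b' ha hab hb
  have hr : K * ω a b' ^ γ ≤ 1 / 2 := by
    have h2 : ω a b' ^ γ ≤ 1 / (2 * (K + 1)) := by
      have := Real.rpow_le_rpow hω0 hsmall.le S.gamma_pos.le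
      rwa [← Real.rpow_mul hq.le, one_div_mul_cancel S.gamma_pos.ne', Real.rpow_one] at this
    calc K * ω a b' ^ γ ≤ K * (1 / (2 * (K + 1))) := mul_le_mul_of_nonneg_left h2 hK
      _ = K / (K + 1) / 2 := by field_simp
      _ ≤ 1 / 2 := by
        have : K / (K + 1) ≤ 1 := (div_le_one (by positivity)).2 (by linarith)
        linarith
  have hgain : ∀ s t, a ≤ s → s ≤ t → t ≤ b' → ∀ k,
      K * (ω s t ^ γ) ^ (N + 1 - deg k) ≤ 1 / 2 * (ω s t ^ γ) ^ (N - deg k) := by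
    intro s t hs hst ht k
    have h3 := S.scale_nonneg (ha.trans hs) hst (ht.trans hb)
    rw [Nat.succ_sub (S.basis.deg_le k), pow_succ', ← mul_assoc]
    refine mul_le_mul_of_nonneg_right (le_trans ?_ hr) (pow_nonneg h3 _)
    exact mul_le_mul_of_nonneg_left (S.scale_mono ha hs hst ht hb) hK
  obtain ⟨h4, h5⟩ := HK a b' ha hb δ hδ Z W hP J hJ fun i t hat htb c => by
    rw [hW i t hat htb, liftMap, Finset.sum_add_distrib, ← Finset.sum_smul, Pi.add_apply,
      Finset.sum_apply, add_smul]
    abel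
  refine ⟨fun i s t hs hst ht c k => ?_, fun s t hs hst ht c k => ?_⟩
  · have h6 := pow_nonneg (S.scale_nonneg (ha.trans hs) hst (ht.trans hb)) (N - deg k)
    linarith [h4 i s t hs hst ht c k, hgain s t hs hst ht k]
  · have h7 := mul_le_mul_of_nonneg_left (hgain s t hs hst ht k) hδ
    linarith [h5 s t hs hst ht c k]

/-- The rough integrals of a controlled path exist. -/
theorem IsRoughSystem.exists_integral {M : ℝ} {Z : ℝ → Fin e → H} {T' : ℝ} (hT : T' ≤ T)
    (hZ : PairBound N b deg γ ω 𝒳 0 T' M 0 fun _ => Z) (l : Fin d) :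
    ∃ J : ℝ → Fin e → ℝ, ∀ t, 0 ≤ t → t ≤ T' →
      IsRRSLimit (germ N 𝒳 (L l) (φ l) Z) 0 t (J t) := by
  obtain ⟨K, hK, HK⟩ := S.exists_germ_bound (e := e) M
  obtain ⟨-, -, h3, -⟩ := HK 0 T' le_rfl hT 0 le_rfl _ hZ
  have h4 : ∀ t, ∃ J : Fin e → ℝ, 0 ≤ t → t ≤ T' →
      IsRRSLimit (germ N 𝒳 (L l) (φ l) Z) 0 t J := by
    intro t
    by_cases h : 0 ≤ t ∧ t ≤ T'
    · obtain ⟨J, hJ⟩ := exists_isRRSLimit (S.control.restrict hT) (S.right.restrict hT) S.eta_pos hK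
        le_rfl h.1 h.2 ((h3 l true).restrict le_rfl h.2)
      exact ⟨J, fun _ _ => hJ⟩
    · exact ⟨0, fun h1 h2 => absurd ⟨h1, h2⟩ h⟩
  choose J hJ using h4
  exact ⟨J, hJ⟩

theorem IsRoughSystem.isRRSLimit_increment {M : ℝ} {Z : ℝ → Fin e → H} {T' : ℝ} (hT : T' ≤ T)
    (hZ : PairBound N b deg γ ω 𝒳 0 T' M 0 fun _ => Z) (l : Fin d) {J : ℝ → Fin e → ℝ}
    (hJ : ∀ t, 0 ≤ t → t ≤ T' → IsRRSLimit (germ N 𝒳 (L l) (φ l) Z) 0 t (J t)) {s t : ℝ}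
    (hs : 0 ≤ s) (hst : s ≤ t) (ht : t ≤ T') :
    IsRRSLimit (germ N 𝒳 (L l) (φ l) Z) s t (J t - J s) := by
  obtain ⟨K, hK, HK⟩ := S.exists_germ_bound (e := e) M
  obtain ⟨-, -, h3, -⟩ := HK 0 T' le_rfl hT 0 le_rfl _ hZ
  exact isRRSLimit_sub (S.control.restrict hT) (S.right.restrict hT) S.eta_pos hK (h3 l true) hJ hs
    hst ht

end Contraction

/-! ### Solutions -/

section Solution

open Filter Topology

variable {H : Type*} [CommRing H] [Algebra ℝ H] [Coalgebra ℝ H]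
  {𝒜 : ℕ → Submodule ℝ H} [GradedAlgebra 𝒜] {N : ℕ} {ι : Type*} [Fintype ι]
  {b : Module.Basis ι ℝ H} {deg : ι → ℕ} {d e : ℕ} {L : Fin d → H →ₗ[ℝ] H} {γ T : ℝ}
  {ω : ℝ → ℝ → ℝ} {𝒳 : ℝ → ℝ → Module.Dual ℝ H} {φ : Fin d → (Fin e → ℝ) → (Fin e → ℝ)}

/-- Controlled paths on `[0, T]`, in homogeneous coordinates. -/
def HasRemBound (b : Module.Basis ι ℝ H) (deg : ι → ℕ) (N : ℕ) (γ : ℝ) (ω : ℝ → ℝ → ℝ)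
    (𝒳 : ℝ → ℝ → Module.Dual ℝ H) (T C : ℝ) {e : ℕ} (Z : ℝ → Fin e → H) : Prop :=
  ∀ s t, 0 ≤ s → s ≤ t → t ≤ T → ∀ c k,
    |b.repr (pathRem 𝒳 Z s t c) k| ≤ C * (ω s t ^ γ) ^ (N - deg k)

/-- `W` is the image of `Z` under the solution map: its underlying path is `y + ∑ J_l`, where the
`J_l` are the rough integrals of the `φ_l(Z)`. -/
structure IsSolutionMap (N : ℕ) (L : Fin d → H →ₗ[ℝ] H) (𝒳 : ℝ → ℝ → Module.Dual ℝ H)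
    (φ : Fin d → (Fin e → ℝ) → (Fin e → ℝ)) (T : ℝ) (y : Fin e → ℝ) (Z W : ℝ → Fin e → H)
    (J : Fin d → ℝ → Fin e → ℝ) : Prop where
  integral : ∀ l t, 0 ≤ t → t ≤ T → IsRRSLimit (germ N 𝒳 (L l) (φ l) Z) 0 t (J l t)
  eq : ∀ t, 0 ≤ t → t ≤ T → W t = liftMap N L φ (y + ∑ l, J l t) (Z t)

variable (S : IsRoughSystem 𝒜 N b deg L γ T ω 𝒳 φ)
include S

theorem IsRoughSystem.exists_const_pairBound {T' C : ℝ} (hT : T' ≤ T) (hC : 0 ≤ C)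
    {Z : ℝ → Fin e → H} (hZ : HasRemBound b deg N γ ω 𝒳 T' C Z) :
    ∃ M, 0 ≤ M ∧ PairBound N b deg γ ω 𝒳 0 T' M 0 fun _ => Z := by
  obtain ⟨M, hM, HM⟩ := S.exists_pairBound (e := e) (∑ c, ∑ k, |b.repr (Z 0 c) k|) C
    (Finset.sum_nonneg fun c _ => Finset.sum_nonneg fun k _ => abs_nonneg _) hC
  refine ⟨M, hM, HM 0 T' le_rfl hT 0 le_rfl _ ⟨rfl, fun _ c k => ?_, fun _ => hZ, ?_⟩⟩
  · exact (Finset.single_le_sum (f := fun k => |b.repr (Z 0 c) k|) (fun k _ => abs_nonneg _)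
      (Finset.mem_univ k)).trans (Finset.single_le_sum (f := fun c => ∑ k, |b.repr (Z 0 c) k|)
        (fun c _ => Finset.sum_nonneg fun k _ => abs_nonneg _) (Finset.mem_univ c))
  · intro s t _ _ _ c k
    simp

/-- The rough integrals start from `0`. -/
theorem IsRoughSystem.solutionMap_zero {T' C : ℝ} (h0 : 0 ≤ T') (hT : T' ≤ T) (hC : 0 ≤ C)
    {y : Fin e → ℝ} {Z W : ℝ → Fin e → H} {J : Fin d → ℝ → Fin e → ℝ}
    (hZ : HasRemBound b deg N γ ω 𝒳 T' C Z) (hJ : IsSolutionMap N L 𝒳 φ T' y Z W J) :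
    W 0 = liftMap N L φ y (Z 0) := by
  obtain ⟨M, hM, HM⟩ := S.exists_const_pairBound hT hC hZ
  have h1 : ∀ l, J l 0 = 0 := fun l => by
    have h2 := S.isRRSLimit_increment hT HM l (hJ.integral l) le_rfl le_rfl h0
    rw [sub_self] at h2
    exact (hJ.integral l 0 le_rfl h0).unique h2
  rw [hJ.eq 0 le_rfl h0]
  simp [h1]

/-- Uniqueness. Agreement on `[0, t)` determines the rough integrals up to `t`, and then the value
at `t` by uniqueness of the algebraic lift; agreement up to `t` extends to the right by
contraction. -/
theorem IsRoughSystem.solution_unique {T' C : ℝ} (h0 : 0 ≤ T') (hT : T' ≤ T) {y : Fin e → ℝ}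
    {Z Z' : ℝ → Fin e → H} {J J' : Fin d → ℝ → Fin e → ℝ}
    (hZ : HasRemBound b deg N γ ω 𝒳 T' C Z) (hZ' : HasRemBound b deg N γ ω 𝒳 T' C Z')
    (hC : 1 ≤ C) (hJ : IsSolutionMap N L 𝒳 φ T' y Z Z J)
    (hJ' : IsSolutionMap N L 𝒳 φ T' y Z' Z' J') : ∀ t, 0 ≤ t → t ≤ T' → Z t = Z' t := by
  have hC0 : 0 ≤ C := zero_le_one.trans hC
  obtain ⟨M₁, hM₁, P₁⟩ := S.exists_const_pairBound hT hC0 hZ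
  obtain ⟨M₂, hM₂, P₂⟩ := S.exists_const_pairBound hT hC0 hZ'
  obtain ⟨M, ε, hM, hε, HC⟩ := S.exists_contraction (max M₁ M₂) C (hM₁.trans (le_max_left _ _)) hC0 y
  refine real_induction ?_ ?_ ?_
  · exact eq_of_eq_liftMap S.hopf S.basis S.cocycle (S.solutionMap_zero h0 hT hC0 hZ hJ)
      (S.solutionMap_zero h0 hT hC0 hZ' hJ')
  · intro t ht htT heq
    have h1 : ∀ l, J l t = J' l t := fun l =>
      ((hJ.integral l t ht.le htT).congr fun u v hu huv hv => by
        simp only [germ]; rw [heq u hu (huv.trans_le hv)]).unique (hJ'.integral l t ht.le htT)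
    refine eq_of_eq_liftMap S.hopf S.basis S.cocycle (v := y + ∑ l, J l t) (hJ.eq t ht.le htT) ?_
    simp only [h1]
    exact hJ'.eq t ht.le htT
  · intro τ hτ hτT heq
    obtain ⟨τ', hττ', hτ'T, hsmall⟩ :=
      exists_control_lt (S.control.restrict hT) (S.right.restrict hT) hτ hτT hε
    refine ⟨τ', hττ', fun u hu huτ' _ => ?_⟩
    let Q : Bool → ℝ → Fin e → H := fun i => if i then Z else Z'
    let J₂ : Bool → Fin d → ℝ → Fin e → ℝ := fun i => if i then J else J'
    have hQ : ∀ n : ℕ, RemBound b deg N γ ω 𝒳 τ τ' (max M₁ M₂) C (2 * (1 / 2) ^ n) Q := by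
      intro n
      have hrem : ∀ i s t, τ ≤ s → s ≤ t → t ≤ τ' → ∀ c k,
          |b.repr (pathRem 𝒳 (Q i) s t c) k| ≤ C * (ω s t ^ γ) ^ (N - deg k) := by
        rintro (_ | _) s t hs hst ht c k
        · exact hZ' s t (hτ.trans hs) hst (ht.trans hτ'T) c k
        · exact hZ s t (hτ.trans hs) hst (ht.trans hτ'T) c k
      have hbdd : ∀ i c k, |b.repr (Q i τ c) k| ≤ max M₁ M₂ := by
        rintro (_ | _) c k
        · exact (P₂.bdd true τ hτ hτT.le c k).trans (le_max_right _ _)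
        · exact (P₁.bdd true τ hτ hτT.le c k).trans (le_max_left _ _)
      induction n with
      | zero =>
        refine ⟨heq τ hτ le_rfl, hbdd, hrem, fun s t hs hst ht c k => ?_⟩
        rw [map_sub, Finsupp.sub_apply]
        refine (abs_sub _ _).trans ?_
        linarith [hrem true s t hs hst ht c k, hrem false s t hs hst ht c k]
      | succ n ih =>
        refine ⟨heq τ hτ le_rfl, hbdd, hrem, fun s t hs hst ht c k => ?_⟩
        have h2 := ((HC τ τ' hτ hττ'.le (hτ'T.trans hT) hsmall _ (by positivity) Q Q ih).2 J₂ ?_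
          ?_).2 s t hs hst ht c k
        · refine h2.trans ?_
          have h3 := S.scale_nonneg (hτ.trans hs) hst (ht.trans (hτ'T.trans hT))
          rw [pow_succ]
          have h4 : 0 ≤ 2 * (1 / 2 : ℝ) ^ n / 2 * (ω s t ^ γ) ^ (N - deg k) := by positivity
          nlinarith
        · rintro (_ | _) l s t hs hst ht
          · exact S.isRRSLimit_increment hT P₂ l (hJ'.integral l) (hτ.trans hs) hst (ht.trans hτ'T)
          · exact S.isRRSLimit_increment hT P₁ l (hJ.integral l) (hτ.trans hs) hst (ht.trans hτ'T)
        · rintro (_ | _) t hat htb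
          · exact hJ'.eq t (hτ.trans hat) (htb.trans hτ'T)
          · exact hJ.eq t (hτ.trans hat) (htb.trans hτ'T)
    have hlim : Tendsto (fun n : ℕ => M * (2 * (1 / 2 : ℝ) ^ n)) atTop (𝓝 0) := by
      have := (tendsto_pow_atTop_nhds_zero_of_lt_one (r := (1 / 2 : ℝ)) (by norm_num)
        (by norm_num)).const_mul 2 |>.const_mul M
      simpa using this
    funext c
    refine b.repr.injective (Finsupp.ext fun k => ?_)
    have h5 : |b.repr (Z u c - Z' u c) k| ≤ 0 := ge_of_tendsto' hlim fun n =>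
      (HC τ τ' hτ hττ'.le (hτ'T.trans hT) hsmall _ (by positivity) Q Q (hQ n)).1.lip u hu.le huτ' c k
    rw [abs_nonpos_iff, map_sub, Finsupp.sub_apply] at h5
    exact sub_eq_zero.1 h5

/-- Existence, by Picard iteration from the path `t ↦ Γ_{0t} z`, whose remainder vanishes; here `z`
is the algebraic lift of the initial value. -/
theorem IsRoughSystem.exists_solution (hT : 0 < T) (y : Fin e → ℝ) : ∃ T₀, 0 < T₀ ∧ T₀ ≤ T ∧
    ∀ T', 0 < T' → T' ≤ T₀ → ∃ (Z : ℝ → Fin e → H) (J : Fin d → ℝ → Fin e → ℝ),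
      HasRemBound b deg N γ ω 𝒳 T' 1 Z ∧ IsSolutionMap N L 𝒳 φ T' y Z Z J := by
  obtain ⟨z, hz⟩ := exists_eq_liftMap S.hopf S.basis S.cocycle φ y
  set B : ℝ := ∑ c, ∑ k, |b.repr (z c) k| with hB
  have hB0 : 0 ≤ B := Finset.sum_nonneg fun c _ => Finset.sum_nonneg fun k _ => abs_nonneg _
  have hzB : ∀ c k, |b.repr (z c) k| ≤ B := fun c k =>
    (Finset.single_le_sum (f := fun k => |b.repr (z c) k|) (fun k _ => abs_nonneg _)
      (Finset.mem_univ k)).trans (Finset.single_le_sum (f := fun c => ∑ k, |b.repr (z c) k|)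
        (fun c _ => Finset.sum_nonneg fun k _ => abs_nonneg _) (Finset.mem_univ c))
  obtain ⟨M, ε, hM, hε, HC⟩ := S.exists_contraction B 1 hB0 zero_le_one y
  obtain ⟨T₀, hT₀, hT₀T, hsmall⟩ := exists_control_lt S.control S.right le_rfl hT hε
  refine ⟨T₀, hT₀, hT₀T, fun T' hT' hT'₀ => ?_⟩
  have hT'T := hT'₀.trans hT₀T
  have hsmall' : ω 0 T' < ε := (S.control.mono_right le_rfl hT'.le hT'₀ hT₀T).trans_lt hsmall
  -- the ball on which the iteration takes place
  let Ball : (ℝ → Fin e → H) → Prop := fun Z => Z 0 = z ∧ HasRemBound b deg N γ ω 𝒳 T' 1 Z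
  let two : (ℝ → Fin e → H) → (ℝ → Fin e → H) → Bool → ℝ → Fin e → H :=
    fun Z Z' i => if i then Z else Z'
  let Close : ℝ → (ℝ → Fin e → H) → (ℝ → Fin e → H) → Prop := fun δ Z Z' =>
    ∀ s t, 0 ≤ s → s ≤ t → t ≤ T' → ∀ c k,
      |b.repr (pathRem 𝒳 Z s t c - pathRem 𝒳 Z' s t c) k| ≤ δ * (ω s t ^ γ) ^ (N - deg k)
  have hpair : ∀ Z Z' δ, Ball Z → Ball Z' → Close δ Z Z' →
      RemBound b deg N γ ω 𝒳 0 T' B 1 δ (two Z Z') := by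
    intro Z Z' δ hZ hZ' hδ
    refine ⟨hZ.1.trans hZ'.1.symm, ?_, ?_, fun s t hs hst ht c k => ?_⟩
    · rintro (_ | _) c k
      · exact (congrArg (fun w => |b.repr (w c) k|) hZ'.1).trans_le (hzB c k)
      · exact (congrArg (fun w => |b.repr (w c) k|) hZ.1).trans_le (hzB c k)
    · rintro (_ | _)
      · exact hZ'.2
      · exact hZ.2
    · rw [one_mul]
      exact hδ s t hs hst ht c k
  have hself : ∀ Z, Close 0 Z Z := fun Z s t _ _ _ c k => by simp
  have hstep : ∀ Z : {Z // Ball Z}, ∃ (W : {W // Ball W}) (J : Fin d → ℝ → Fin e → ℝ),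
      IsSolutionMap N L 𝒳 φ T' y Z.1 W.1 J := by
    rintro ⟨Z, hZ⟩
    obtain ⟨M', -, hP⟩ := S.exists_const_pairBound hT'T zero_le_one hZ.2
    choose J hJ using fun l => S.exists_integral hT'T hP l
    let W : ℝ → Fin e → H := fun t => liftMap N L φ (y + ∑ l, J l t) (Z t)
    have hW : IsSolutionMap N L 𝒳 φ T' y Z W J := ⟨hJ, fun t _ _ => rfl⟩
    refine ⟨⟨W, ?_, ?_⟩, J, hW⟩
    · rw [S.solutionMap_zero hT'.le hT'T zero_le_one hZ.2 hW, hZ.1]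
      exact hz.symm
    · intro s t hs hst ht c k
      rw [one_mul]
      refine ((HC 0 T' le_rfl hT'.le hT'T hsmall' 0 le_rfl _ (two W W)
        (hpair Z Z 0 hZ hZ (hself Z))).2 (fun _ => J) ?_ ?_).1 true s t hs hst ht c k
      · rintro (_ | _) l s t hs hst ht <;>
          exact S.isRRSLimit_increment hT'T hP l (hJ l) hs hst ht
      · rintro (_ | _) t _ _ <;> rfl
  choose Φ J hΦ using hstep
  have hcontr : ∀ Z Z' : {Z // Ball Z}, ∀ δ, 0 ≤ δ → Close δ Z.1 Z'.1 →
      Close (δ / 2) (Φ Z).1 (Φ Z').1 := by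
    intro Z Z' δ hδ hcl
    obtain ⟨M₁, -, P₁⟩ := S.exists_const_pairBound hT'T zero_le_one Z.2.2
    obtain ⟨M₂, -, P₂⟩ := S.exists_const_pairBound hT'T zero_le_one Z'.2.2
    refine ((HC 0 T' le_rfl hT'.le hT'T hsmall' δ hδ _ (two (Φ Z).1 (Φ Z').1)
      (hpair _ _ δ Z.2 Z'.2 hcl)).2 (fun i => if i then J Z else J Z') ?_ ?_).2
    · rintro (_ | _) l s t hs hst ht
      · exact S.isRRSLimit_increment hT'T P₂ l ((hΦ Z').integral l) hs hst ht
      · exact S.isRRSLimit_increment hT'T P₁ l ((hΦ Z).integral l) hs hst ht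
    · rintro (_ | _) t hat htb
      · exact (hΦ Z').eq t hat htb
      · exact (hΦ Z).eq t hat htb
  have hdist : ∀ Z Z' δ, 0 ≤ δ → Ball Z → Ball Z' → Close δ Z Z' → ∀ t, 0 ≤ t → t ≤ T' →
      ∀ c k, |b.repr (Z t c) k - b.repr (Z' t c) k| ≤ M * δ := by
    intro Z Z' δ hδ hZ hZ' hcl t h1 h2 c k
    rw [← Finsupp.sub_apply, ← map_sub]
    exact (HC 0 T' le_rfl hT'.le hT'T hsmall' δ hδ _ (two Z Z')
      (hpair Z Z' δ hZ hZ' hcl)).1.lip t h1 h2 c k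
  have hBall₀ : Ball fun t c => translate (𝒳 0 t) (z c) := by
    refine ⟨funext fun c => S.translate_diag le_rfl hT.le (z c), fun s t hs hst ht c k => ?_⟩
    have hr := S.scale_nonneg hs hst (ht.trans hT'T)
    rw [pathRem, S.chen 0 s t le_rfl hs hst (ht.trans hT'T), translate_conv, sub_self]
    simp only [map_zero, Finsupp.zero_apply, abs_zero]
    positivity
  obtain ⟨F, hF⟩ : ∃ F : ℕ → {Z // Ball Z}, ∀ n, F (n + 1) = Φ (F n) :=
    ⟨fun n => Φ^[n] ⟨fun t c => translate (𝒳 0 t) (z c), hBall₀⟩,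
      fun n => Function.iterate_succ_apply' Φ n _⟩
  have hclose : ∀ n, Close (2 * (1 / 2) ^ n) (F n).1 (F (n + 1)).1 := by
    intro n
    induction n with
    | zero =>
      intro s t hs hst ht c k
      rw [map_sub, Finsupp.sub_apply]
      refine (abs_sub _ _).trans ?_
      linarith [(F 0).2.2 s t hs hst ht c k, (F 1).2.2 s t hs hst ht c k]
    | succ n ih =>
      have h1 := hcontr _ _ _ (by positivity) ih
      rw [← hF, ← hF] at h1
      convert h1 using 1
      rw [pow_succ]
      ring
  -- pointwise convergence of the iterates
  have hconv : ∀ t, ∃ w : Fin e → H, 0 ≤ t → t ≤ T' → ∀ c k,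
      Tendsto (fun n => b.repr ((F n).1 t c) k) atTop (𝓝 (b.repr (w c) k)) := by
    intro t
    by_cases h : 0 ≤ t ∧ t ≤ T'
    · have h1 : ∀ c k, ∃ x, Tendsto (fun n => b.repr ((F n).1 t c) k) atTop (𝓝 x) := fun c k =>
        cauchySeq_tendsto_of_complete (cauchySeq_of_le_geometric (1 / 2) (M * 2) (by norm_num)
          fun n => by
            rw [Real.dist_eq, mul_assoc]
            exact hdist _ _ _ (by positivity) (F n).2 (F (n + 1)).2 (hclose n) t h.1 h.2 c k)
      choose x hx using h1
      exact ⟨fun c => ∑ k, x c k • b k, fun _ _ c k => by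
        rw [b.repr_sum_self]
        exact hx c k⟩
    · exact ⟨0, fun h1 h2 => absurd ⟨h1, h2⟩ h⟩
  choose Z hZ using hconv
  have hrem : ∀ s t, 0 ≤ s → s ≤ t → t ≤ T' → ∀ c k,
      Tendsto (fun n => b.repr (pathRem 𝒳 (F n).1 s t c) k) atTop
        (𝓝 (b.repr (pathRem 𝒳 Z s t c) k)) := by
    intro s t hs hst ht c k
    simp only [pathRem, map_sub, Finsupp.sub_apply]
    refine (hZ t (hs.trans hst) ht c k).sub ?_
    rw [repr_map_eq_sum (translate (𝒳 s t)) (Z s c) k]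
    exact (tendsto_finsetSum Finset.univ fun m _ =>
      (hZ s hs (hst.trans ht) c m).mul_const (b.repr (translate (𝒳 s t) (b m)) k)).congr
        fun n => (repr_map_eq_sum (translate (𝒳 s t)) ((F n).1 s c) k).symm
  have hBallZ : Ball Z := by
    refine ⟨funext fun c => b.repr.injective (Finsupp.ext fun k => ?_), fun s t hs hst ht c k => ?_⟩
    · refine tendsto_nhds_unique (hZ 0 le_rfl hT'.le c k) ?_
      exact tendsto_const_nhds.congr fun n => by rw [(F n).2.1]
    · exact le_of_tendsto' (hrem s t hs hst ht c k).abs fun n => (F n).2.2 s t hs hst ht c k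
  have hcloseZ : ∀ n, Close (4 * (1 / 2) ^ n) (F n).1 Z := by
    intro n s t hs hst ht c k
    have h1 := dist_le_of_le_geometric_of_tendsto (1 / 2) (2 * (ω s t ^ γ) ^ (N - deg k))
      (by norm_num) (fun n => by
        rw [Real.dist_eq, ← Finsupp.sub_apply, ← map_sub]
        exact (hclose n s t hs hst ht c k).trans_eq (by ring)) (hrem s t hs hst ht c k) n
    rw [Real.dist_eq, ← Finsupp.sub_apply, ← map_sub] at h1
    exact h1.trans_eq (by ring)
  have hfix : ∀ t, 0 ≤ t → t ≤ T' → Z t = (Φ ⟨Z, hBallZ⟩).1 t := by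
    intro t h1 h2
    funext c
    refine b.repr.injective (Finsupp.ext fun k => ?_)
    refine tendsto_nhds_unique ((hZ t h1 h2 c k).comp (tendsto_add_atTop_nat 1)) ?_
    refine tendsto_iff_dist_tendsto_zero.2 (squeeze_zero (fun _ => dist_nonneg)
      (g := fun n : ℕ => M * (2 * (1 / 2 : ℝ) ^ n)) (fun n => ?_) ?_)
    · have h3 := hcontr (F n) ⟨Z, hBallZ⟩ _ (by positivity) (hcloseZ n)
      rw [← hF] at h3
      rw [Function.comp_apply, Real.dist_eq]
      refine (hdist _ _ _ (by positivity) (F (n + 1)).2 (Φ ⟨Z, hBallZ⟩).2 h3 t h1 h2 c k).trans_eq ?_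
      ring
    · have := (tendsto_pow_atTop_nhds_zero_of_lt_one (r := (1 / 2 : ℝ)) (by norm_num)
        (by norm_num)).const_mul 2 |>.const_mul M
      simpa using this
  refine ⟨Z, J ⟨Z, hBallZ⟩, hBallZ.2, (hΦ ⟨Z, hBallZ⟩).integral, fun t h1 h2 => ?_⟩
  rw [← (hΦ ⟨Z, hBallZ⟩).eq t h1 h2]
  exact hfix t h1 h2

end Solution

/-! ### Controlled rough paths in homogeneous coordinates -/

section Norms

/-- Coordinates with respect to a finite basis are continuous for any norm. -/
theorem exists_repr_le {V : Type*} [AddCommGroup V] [Module ℝ V] (ν : Seminorm ℝ V)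
    (hν : ∀ x, ν x = 0 → x = 0) {ι : Type*} [Fintype ι] (b : Module.Basis ι ℝ V) :
    ∃ κ, 0 ≤ κ ∧ ∀ x k, |b.repr x k| ≤ κ * ν x := by
  let _ : NormedAddCommGroup V := AddGroupNorm.toNormedAddCommGroup
    { ν.toAddGroupSeminorm with eq_zero_of_map_eq_zero' := hν }
  let _ : NormedSpace ℝ V := { norm_smul_le := fun a x => (map_smul_eq_mul ν a x).le }
  have : FiniteDimensional ℝ V := Module.Finite.of_basis b
  have h : ∀ x, ‖x‖ = ν x := fun x => rfl
  refine ⟨∑ k, ‖LinearMap.toContinuousLinearMap (b.coord k)‖,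
    Finset.sum_nonneg fun k _ => norm_nonneg _, fun x k => ?_⟩
  refine ((LinearMap.toContinuousLinearMap (b.coord k)).le_opNorm x).trans ?_
  rw [h]
  exact mul_le_mul_of_nonneg_right (Finset.single_le_sum
    (f := fun k => ‖LinearMap.toContinuousLinearMap (b.coord k)‖) (fun k _ => norm_nonneg _)
    (Finset.mem_univ k)) (apply_nonneg ν x)

variable {H : Type*} [CommRing H] [Algebra ℝ H] [Coalgebra ℝ H]
  {𝒜 : ℕ → Submodule ℝ H} [GradedAlgebra 𝒜] {N : ℕ} {ι : Type*} [Fintype ι]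
  {b : Module.Basis ι ℝ H} {deg : ι → ℕ} {e : ℕ} {γ T : ℝ}
  {ω : ℝ → ℝ → ℝ} {𝒳 : ℝ → ℝ → Module.Dual ℝ H} {ν : Seminorm ℝ H}

theorem abs_le_dualNorm (hν : ∀ x, ν x = 0 → x = 0) (b : Module.Basis ι ℝ H)
    (h : Module.Dual ℝ H) (x : H) : |h x| ≤ dualNorm ν h * ν x := by
  obtain ⟨κ, hκ, H1⟩ := exists_repr_le ν hν b
  have hbdd : BddAbove {r : ℝ | ∃ x : H, ν x ≤ 1 ∧ r = |h x|} := by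
    refine ⟨∑ k, κ * |h (b k)|, ?_⟩
    rintro _ ⟨x, hx, rfl⟩
    rw [← b.sum_repr x, map_sum]
    refine (Finset.abs_sum_le_sum_abs _ _).trans (Finset.sum_le_sum fun k _ => ?_)
    rw [map_smul, smul_eq_mul, abs_mul]
    have : |b.repr x k| ≤ κ := (H1 x k).trans (mul_le_of_le_one_right hκ hx)
    exact mul_le_mul_of_nonneg_right this (abs_nonneg _)
  by_cases h0 : ν x = 0
  · rw [hν x h0]; simp
  · have hpos : 0 < ν x := lt_of_le_of_ne (apply_nonneg ν x) (Ne.symm h0)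
    have h1 : |h ((ν x)⁻¹ • x)| ≤ dualNorm ν h :=
      le_csSup hbdd ⟨(ν x)⁻¹ • x, by
        rw [map_smul_eq_mul, Real.norm_of_nonneg (by positivity), inv_mul_cancel₀ h0], rfl⟩
    rw [map_smul, smul_eq_mul, abs_mul, abs_of_pos (by positivity), inv_mul_le_iff₀ hpos] at h1
    rwa [mul_comm]

theorem rpow_sub_mul {x : ℝ} (hx : 0 ≤ x) {N j : ℕ} (hj : j ≤ N) (γ : ℝ) :
    x ^ (((N : ℝ) - (j : ℝ)) * γ) = (x ^ γ) ^ (N - j) := by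
  rw [← Real.rpow_mul_natCast hx, Nat.cast_sub hj, mul_comm]

theorem remainder_apply (Z : ℝ → Fin e → H) (h : Module.Dual ℝ H) (s t : ℝ) (c : Fin e) :
    remainder 𝒳 Z h s t c = h (pathRem 𝒳 Z s t c) := by
  rw [pathRem, map_sub, ← conv_apply]
  rfl

theorem IsControlled.exists_hasRemBound (hb : IsHomogeneousBasis 𝒜 N b deg) (hω : IsControl T ω)
    {Z : ℝ → Fin e → H} (hZ : IsControlled 𝒜 N ν γ T ω 𝒳 Z) :
    ∃ C, HasRemBound b deg N γ ω 𝒳 T C Z := by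
  obtain ⟨C, hC⟩ := hZ
  refine ⟨∑ k, |C * dualNorm ν (b.coord k)|, fun s t hs hst ht c k => ?_⟩
  have h0 := hω.nonneg s t hs hst ht
  have h1 := hC s t hs hst ht (deg k) (hb.deg_le k) (b.coord k) fun n hn x hx =>
    hb.repr_eq_zero n x hx k hn.symm
  rw [rpow_sub_mul h0 (hb.deg_le k)] at h1
  have h2 := (norm_le_pi_norm (remainder 𝒳 Z (b.coord k) s t) c).trans h1
  rw [remainder_apply, Module.Basis.coord_apply, Real.norm_eq_abs] at h2
  refine h2.trans (mul_le_mul_of_nonneg_right ((le_abs_self _).trans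
    (Finset.single_le_sum (f := fun k => |C * dualNorm ν (b.coord k)|) (fun k _ => abs_nonneg _)
      (Finset.mem_univ k))) (by positivity))

theorem HasRemBound.isControlled (hb : IsHomogeneousBasis 𝒜 N b deg) (hω : IsControl T ω)
    (hν : ∀ x, ν x = 0 → x = 0) {C : ℝ} (hC : 0 ≤ C) {Z : ℝ → Fin e → H}
    (hZ : HasRemBound b deg N γ ω 𝒳 T C Z) : IsControlled 𝒜 N ν γ T ω 𝒳 Z := by
  refine ⟨∑ k, C * ν (b k), fun s t hs hst ht j hj h hh => ?_⟩
  have h0 := hω.nonneg s t hs hst ht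
  have hn : 0 ≤ dualNorm ν h := Real.sSup_nonneg fun r ⟨x, _, hr⟩ => hr ▸ abs_nonneg _
  have hν0 : ∀ x, 0 ≤ ν x := apply_nonneg ν
  have hterm : ∀ c k, |b.repr (pathRem 𝒳 Z s t c) k * h (b k)| ≤
      C * ν (b k) * dualNorm ν h * (ω s t ^ γ) ^ (N - j) := by
    intro c k
    have := hν0 (b k)
    by_cases hk : deg k = j
    · rw [abs_mul]
      calc _ ≤ C * (ω s t ^ γ) ^ (N - deg k) * (dualNorm ν h * ν (b k)) :=
            mul_le_mul (hZ s t hs hst ht c k) (abs_le_dualNorm hν b h (b k)) (abs_nonneg _)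
              (by positivity)
        _ = _ := by rw [hk]; ring
    · rw [hh (deg k) hk (b k) (hb.mem k), mul_zero, abs_zero]
      positivity
  rw [rpow_sub_mul h0 hj]
  refine (pi_norm_le_iff_of_nonneg ?_).2 fun c => ?_
  · have : 0 ≤ ∑ k, C * ν (b k) := Finset.sum_nonneg fun k _ => mul_nonneg hC (hν0 _)
    positivity
  · rw [remainder_apply, Real.norm_eq_abs, Finset.sum_mul, Finset.sum_mul]
    conv_lhs => rw [← b.sum_repr (pathRem 𝒳 Z s t c), map_sum]
    refine (Finset.abs_sum_le_sum_abs _ _).trans (Finset.sum_le_sum fun k _ => ?_)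
    rw [map_smul, smul_eq_mul]
    exact hterm c k

end Norms

section Equation

variable {H : Type*} [CommRing H] [Algebra ℝ H] [Coalgebra ℝ H] {N d e : ℕ}
  {L : Fin d → H →ₗ[ℝ] H} {T : ℝ} {𝒳 : ℝ → ℝ → Module.Dual ℝ H}
  {φ : Fin d → (Fin e → ℝ) → (Fin e → ℝ)}

theorem solvesLiftedIVP_iff {y : Fin e → ℝ} {Z : ℝ → Fin e → H} :
    SolvesLiftedIVP N 𝒳 L T φ y Z ↔ ∃ J, IsSolutionMap N L 𝒳 φ T y Z Z J := by
  have key : ∀ (J : Fin d → Fin e → ℝ) (z : Fin e → H), (fun c => y c • (1 : H)) +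
      ∑ i, (fun c => L i (image N (φ i) z c) + J i c • (1 : H)) =
        liftMap N L φ (y + ∑ l, J l) z := by
    intro J z
    funext c
    rw [liftMap, Pi.add_apply, Finset.sum_apply, Finset.sum_add_distrib, ← Finset.sum_smul,
      Pi.add_apply, Finset.sum_apply, add_smul]
    abel
  constructor
  · rintro ⟨I, hI, h⟩
    choose J hJ using hI
    refine ⟨J, fun l t h1 h2 => (hJ l t h1 h2).1, fun t h1 h2 => ?_⟩
    exact ((h t h1 h2).trans (by rw [Finset.sum_congr rfl fun i _ => (hJ i t h1 h2).2])).trans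
      (key (fun l => J l t) (Z t))
  · rintro ⟨J, hJ⟩
    refine ⟨fun i t c => L i (image N (φ i) (Z t) c) + J i t c • (1 : H), fun i => ⟨J i,
      fun t h1 h2 => ⟨hJ.integral i t h1 h2, rfl⟩⟩, fun t h1 h2 => ?_⟩
    rw [key (fun l => J l t) (Z t)]
    exact hJ.eq t h1 h2

end Equation

theorem exponent_bounds {γ : ℝ} (hγ : 0 < γ) (hγ_le : γ ≤ 1) {N : ℕ} (hN : N = ⌊1 / γ⌋₊) :
    1 ≤ N ∧ N * γ ≤ 1 ∧ 1 < (N + 1) * γ := by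
  have h0 : 0 ≤ 1 / γ := by positivity
  refine ⟨?_, ?_, ?_⟩
  · rw [hN]
    exact Nat.le_floor (by rw [Nat.cast_one]; exact (one_le_div hγ).2 hγ_le)
  · rw [← le_div_iff₀ hγ, hN]
    exact Nat.floor_le h0
  · rw [← div_lt_iff₀ hγ, hN]
    exact Nat.lt_floor_add_one _

end HopfRough

end

theorem theorem6p1 {H : Type*} [CommRing H] [Algebra ℝ H] [Coalgebra ℝ H]
    (𝒜 : ℕ → Submodule ℝ H) [GradedAlgebra 𝒜] (N d e : ℕ)
    (hH : HopfRough.IsTruncatedHopfAlgebra 𝒜 N)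
    (L : Fin d → H →ₗ[ℝ] H) (hL : HopfRough.IsCocycleFamily 𝒜 N L)
    (ν : Seminorm ℝ H) (hν : HopfRough.IsGradedNorm 𝒜 ν)
    (γ : ℝ) (hγ : 0 < γ) (hγ_le : γ ≤ 1) (hN : N = ⌊1 / γ⌋₊)
    (T : ℝ) (hT : 0 < T) (ω : ℝ → ℝ → ℝ)
    (hω : HopfRough.IsControl T ω) (hω_right : HopfRough.IsRightContinuous T ω)
    (X : ℝ → Module.Dual ℝ (𝒜 1)) (𝒳 : ℝ → ℝ → Module.Dual ℝ H)
    (h𝒳 : HopfRough.IsRoughPath 𝒜 N ν γ T ω X 𝒳)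
    (φ : Fin d → (Fin e → ℝ) → (Fin e → ℝ)) (hφ : ∀ i, ContDiff ℝ (N + 1) (φ i))
    (y : Fin e → ℝ) :
    ∃ T₀ : ℝ, 0 < T₀ ∧ T₀ ≤ T ∧ ∀ T' : ℝ, 0 < T' → T' ≤ T₀ →
      ∃ Z : ℝ → Fin e → H,
        (HopfRough.IsControlled 𝒜 N ν γ T' ω 𝒳 Z ∧ HopfRough.SolvesLiftedIVP N 𝒳 L T' φ y Z) ∧
        ∀ Z' : ℝ → Fin e → H, HopfRough.IsControlled 𝒜 N ν γ T' ω 𝒳 Z' →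
          HopfRough.SolvesLiftedIVP N 𝒳 L T' φ y Z' → Set.EqOn Z' Z (Set.Icc 0 T') := by
  obtain ⟨hN1, hN2, hN3⟩ := HopfRough.exponent_bounds hγ hγ_le hN
  obtain ⟨ι, _, b, deg, hb⟩ := HopfRough.exists_isHomogeneousBasis hH
  have S : HopfRough.IsRoughSystem 𝒜 N b deg L γ T ω 𝒳 φ :=
    { hopf := hH
      basis := hb
      cocycle := hL
      one_le := hN1
      gamma_pos := hγ
      mul_le_one := hN2
      one_lt_mul := hN3
      control := hω
      right := hω_right
      character := h𝒳.character
      chen := h𝒳.chen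
      bound := fun n x hx => by
        obtain ⟨C, hC⟩ := h𝒳.bound
        refine ⟨C * ν x, fun s t hs hst ht => (hC s t hs hst ht n x hx).trans_eq ?_⟩
        rw [← Real.rpow_mul_natCast (hω.nonneg s t hs hst ht), mul_comm γ]
      contDiff := hφ }
  obtain ⟨T₀, hT₀, hT₀T, hsol⟩ := S.exists_solution hT y
  refine ⟨T₀, hT₀, hT₀T, fun T' hT' hT'₀ => ?_⟩
  have hT'T := hT'₀.trans hT₀T
  have hω' := hω.restrict hT'T
  obtain ⟨Z, J, hZ, hJ⟩ := hsol T' hT' hT'₀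
  refine ⟨Z, ⟨hZ.isControlled hb hω' hν.definite zero_le_one,
    HopfRough.solvesLiftedIVP_iff.2 ⟨J, hJ⟩⟩, fun Z' hZ' hsolZ' t ht => ?_⟩
  obtain ⟨C, hC⟩ := hZ'.exists_hasRemBound hb hω'
  obtain ⟨J', hJ'⟩ := HopfRough.solvesLiftedIVP_iff.1 hsolZ'
  have hmono : ∀ {K K' : ℝ} {W : ℝ → Fin e → H}, K ≤ K' →
      HopfRough.HasRemBound b deg N γ ω 𝒳 T' K W → HopfRough.HasRemBound b deg N γ ω 𝒳 T' K' W :=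
    fun hK hW s t hs hst ht c k => (hW s t hs hst ht c k).trans
      (mul_le_mul_of_nonneg_right hK (pow_nonneg (S.scale_nonneg hs hst (ht.trans hT'T)) _))
  exact S.solution_unique hT'.le hT'T (hmono (le_max_left C 1) hC) (hmono (le_max_right C 1) hZ)
    (le_max_right C 1) hJ' hJ t ht.1 ht.2
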